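/- Setting. Let $\mathcal P$ be a polygon with pairwise disjoint polygonal holes, $s\ne t$ two points in its interior (regarded as point obstacles), and $\mathcal T$ a triangulation of the closed region $\mathcal P$ whose vertices are those of $\mathcal P$ together with $s,t$. Let $U$ be a set of triangles of $\mathcal T$ that contains all triangles incident to $s$ (for example all triangles, or those of the useful corridors and junctions). The wavefront progresses in $U$: $d(p,q)$ is the length of a shortest path inside the triangles of $U$ that changes from one triangle to another through common edges. A side of a triangle of $U$ not shared with another triangle of $U$ is a wall. Junctions are the triangles of $U$ having three neighbours in $U$ and the triangles of $U$ incident to $s$ or $t$; corridors are the connected components of the remaining triangles of $U$; an edge shared by two triangles of $U$, at least one of which is a junction, is an enter/exit boundary (gate). A maximal run of consecutive walls between two gates on the boundary of a corridor or junction defines a convex chain: the shortest path, inside that corridor or junction, between the end points of the run. A bounding edge is a side of a gate, or a convex chain. Stage of the wavefront. Let $\delta\ge 0$. A gate is struck if it has a point at distance at most $\delta$ from $s$. Starting with the three sides of a triangle incident to $s$ as the only boundary cycle, pass successively through edges inside corridors and through struck gates, until every shared edge left on the cycles is a gate that is not struck: an edge of a cycle beyond which lies a triangle not yet entered is replaced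 in the cycle by the other two sides of that triangle; a cycle containing both sides of an edge, $b_1,\dots,b_k$ with $b_i,b_j$ these sides, splits into $b_1,\dots,b_{i-1},b_{j+1},\dots,b_k$ and $b_{i+1},\dots,b_{j-1}$. The resulting cycles, each read as a cyclic sequence of bounding edges, are the boundary cycles at distance $\delta$. Let $d'$ be the shortest path distance along paths in the entered triangles that do not cross the boundary cycles (they change triangles only through passed edges). A point $p$ has a shortest path to $s$ via $v$ if $d'(s,p)=d'(s,v)+d'(v,p)$. Segments, bunches, sections. For a vertex $v$ with $d(s,v)\le\delta$, the wavefront segment $w(v)$ is the (possibly empty) set of points $q$ such that $d(s,q)=\delta=d(s,v)+|vq|$ and $d(v,q)=|vq|$. A bunch is the single segment $w(s)$, or a sequence $w(v_j),\dots,w(v_k)$ of such segments whose centres are successive vertices of one convex chain with $d(s,q)=d(s,p)+d(p,q)$ for any two neighbours $p,q$ in this order. An association $\mathcal A$ is a relation between bounding edges on boundary cycles and wavefront segments such that (i) if $(g,w(v))\in\mathcal A$, then some point of $g$ has a shortest path to $s$ via $v$; (ii) if some point of $g$ has a shortest path to $s$ via $v$, and $g$ is reachable from $w(v)$, i.e.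 some line segment from a point of $w(v)$ to a point of $g$ stays in the entered triangles without crossing the boundary cycles, then $(g,w(v))\in\mathcal A$. A bunch is associated with $g$ if one of its segments is. For a boundary cycle $\Gamma$, a section of wavefront is a single bunch, or a sequence of bunches (not necessarily contiguous in the wavefront) that are all associated with one common bounding edge of $\Gamma$; it is associated with $g$ if one of its bunches is. Claim. At every distance $\delta\ge0$ there is an association $\mathcal A$ such that for every boundary cycle $\Gamma$: 1. for every wavefront segment $w(v)$, the bounding edges on $\Gamma$ associated with $w(v)$ form a contiguous (possibly empty) subsequence of the cyclic sequence $\Gamma$; 2. for every bunch, the bounding edges on $\Gamma$ associated with the bunch form a contiguous subsequence of $\Gamma$; 3. for every section of wavefront for $\Gamma$, the bounding edges on $\Gamma$ associated with the section form a contiguous subsequence of $\Gamma$. -/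

import Mathlib

open Set
open scoped ENNReal

noncomputable section

namespace Wavefront

/-- The Euclidean plane. -/
abbrev Plane := EuclideanSpace ℝ (Fin 2)

/-! ### Polygonal domains -/

/-- A simple closed polygonal chain; the index set is cyclic. -/
structure SimplePolygon where
  n : ℕ
  three_le : 3 ≤ n
  vertex : ZMod n → Plane
  injective : Function.Injective vertex
  meet_next : ∀ i, segment ℝ (vertex i) (vertex (i + 1)) ∩
    segment ℝ (vertex (i + 1)) (vertex (i + 1 + 1)) = {vertex (i + 1)}
  disjoint : ∀ i j, j ≠ i → j ≠ i + 1 → i ≠ j + 1 →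
    Disjoint (segment ℝ (vertex i) (vertex (i + 1))) (segment ℝ (vertex j) (vertex (j + 1)))

namespace SimplePolygon

/-- The closed polygonal chain itself. -/
def boundary (Q : SimplePolygon) : Set Plane :=
  ⋃ i, segment ℝ (Q.vertex i) (Q.vertex (i + 1))

/-- The open region bounded by the chain. -/
def inside (Q : SimplePolygon) : Set Plane :=
  {x | x ∉ Q.boundary ∧ Bornology.IsBounded (connectedComponentIn Q.boundaryᶜ x)}

/-- The simple polygon: the chain with the region bounded by it. -/
def region (Q : SimplePolygon) : Set Plane := Q.boundary ∪ Q.inside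

end SimplePolygon

/-- A polygon with `m` polygonal holes (obstacles), with a source `s` and a sink `t`, which are
point obstacles. -/
structure PolygonalDomain where
  outer : SimplePolygon
  m : ℕ
  hole : Fin m → SimplePolygon
  hole_subset : ∀ i, (hole i).region ⊆ outer.inside
  hole_disjoint : ∀ i j, i ≠ j → Disjoint (hole i).region (hole j).region
  s : Plane
  t : Plane
  s_mem : s ∈ outer.inside
  t_mem : t ∈ outer.inside
  s_notMem : ∀ i, s ∉ (hole i).region
  t_notMem : ∀ i, t ∉ (hole i).region
  s_ne_t : s ≠ t

namespace PolygonalDomain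

/-- The (closed) free space. -/
def free (D : PolygonalDomain) : Set Plane := D.outer.region \ ⋃ i, (D.hole i).inside

/-- The vertices of the domain, including the point obstacles `s` and `t`. -/
def vertices (D : PolygonalDomain) : Set Plane :=
  (range D.outer.vertex ∪ ⋃ i, range (D.hole i).vertex) ∪ {D.s, D.t}

end PolygonalDomain

/-- A triangulation of the free space with vertex set `D.vertices`: nondegenerate triangles with
counterclockwise corners, pairwise meeting in a common face. -/
structure Triangulation (D : PolygonalDomain) where
  num : ℕ
  corner : Fin num → Fin 3 → Plane
  ccw : ∀ t, 0 < (corner t 1 0 - corner t 0 0) * (corner t 2 1 - corner t 0 1) -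
    (corner t 1 1 - corner t 0 1) * (corner t 2 0 - corner t 0 0)
  distinct : ∀ t t', t ≠ t' → range (corner t) ≠ range (corner t')
  proper : ∀ t t', t ≠ t' → convexHull ℝ (range (corner t)) ∩ convexHull ℝ (range (corner t')) =
    convexHull ℝ (range (corner t) ∩ range (corner t'))
  cover : ⋃ t, convexHull ℝ (range (corner t)) = D.free
  corners : ⋃ t, range (corner t) = D.vertices

namespace Triangulation

variable {D : PolygonalDomain} (T : Triangulation D)

/-- A corner of a triangle. The pair `(t, i)` also stands for the side of the triangle `t` from
its corner `i` to its corner `i + 1`, seen from `t`; thus an edge shared by two triangles has two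
sides. -/
abbrev Corner := Fin T.num × Fin 3

/-- A point of the plane together with a triangle in which it is considered. -/
abbrev Spot := Fin T.num × Plane

/-- The triangle `t` as a closed set. -/
def tri (t : Fin T.num) : Set Plane := convexHull ℝ (range (T.corner t))

/-- The position of a corner. -/
def pos (x : T.Corner) : Plane := T.corner x.1 x.2

/-- The next corner (or side) of the same triangle, counterclockwise. -/
def succ (x : T.Corner) : T.Corner := (x.1, x.2 + 1)

/-- A corner as a spot. -/
def spot (x : T.Corner) : T.Spot := (x.1, T.pos x)

/-- The side from the corner `x` to the next corner, as a segment. -/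
def side (x : T.Corner) : Set Plane := segment ℝ (T.pos x) (T.pos (T.succ x))

/-! ### Paths and distances -/

/-- `Route glue a b ℓ`: there is a polygonal path of length `ℓ` from `a` to `b` that moves inside
triangles and changes from one triangle to another only at points of sides that `glue` joins. -/
inductive Route (glue : T.Corner → T.Corner → Prop) (a : T.Spot) : T.Spot → ℝ≥0∞ → Prop
  | refl : a.2 ∈ T.tri a.1 → Route glue a a 0
  | move {t : Fin T.num} {x y : Plane} {ℓ : ℝ≥0∞} : Route glue a (t, x) ℓ → y ∈ T.tri t →
      Route glue a (t, y) (ℓ + edist x y)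
  | cross {u v : T.Corner} {x : Plane} {ℓ : ℝ≥0∞} : Route glue a (u.1, x) ℓ → glue u v →
      x ∈ T.side u → Route glue a (v.1, x) ℓ

/-- The shortest path distance with respect to such paths (`⊤` if there is no path). -/
def gdist (glue : T.Corner → T.Corner → Prop) (a b : T.Spot) : ℝ≥0∞ :=
  sInf {ℓ | T.Route glue a b ℓ}

/-! ### Corridors and junctions

`U` is the set of triangles in which the wavefront progresses (the triangles of the useful
corridors and junctions, or all triangles). -/

variable (U : Set (Fin T.num))

/-- The two sides of an edge shared by two triangles of `U`. -/
def Joined (x y : T.Corner) : Prop :=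
  x.1 ∈ U ∧ y.1 ∈ U ∧ T.pos y = T.pos (T.succ x) ∧ T.pos (T.succ y) = T.pos x

/-- The shortest path distance in the domain. -/
def dist (a b : T.Spot) : ℝ≥0∞ := T.gdist (T.Joined U) a b

/-- Junction triangles: those of degree three in the dual graph, and those around `s` and `t`. -/
def Junction (t : Fin T.num) : Prop :=
  (∀ i, ∃ y, T.Joined U (t, i) y) ∨ D.s ∈ range (T.corner t) ∨ D.t ∈ range (T.corner t)

/-- (A side of) an enter/exit boundary: an edge between a junction and a corridor, or between two
junctions. A corridor is a maximal set of non-junction triangles connected by edges that are not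
gates. -/
def Gate (x : T.Corner) : Prop := ∃ y, T.Joined U x y ∧ (T.Junction U x.1 ∨ T.Junction U y.1)

/-- A side of a triangle of `U` that is not shared with another triangle of `U`. -/
def Wall (x : T.Corner) : Prop := x.1 ∈ U ∧ ¬ ∃ y, T.Joined U x y

/-- The edges inside corridors. -/
def Inner (x y : T.Corner) : Prop := T.Joined U x y ∧ ¬ T.Gate U x

/-- The shortest path distance inside one corridor or junction. -/
def cellDist (a b : T.Spot) : ℝ≥0∞ := T.gdist (T.Inner U) a b

/-- `y` follows `x` on the boundary of a corridor or junction: turn around the end point of `x`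
through the edges inside the corridor. -/
def CellNext (x y : T.Corner) : Prop :=
  Relation.ReflTransGen (fun z w => ∃ z', T.Inner U z z' ∧ w = T.succ z') (T.succ x) y ∧
    (T.Gate U y ∨ T.Wall U y)

/-- A side chain of a corridor: a maximal run of consecutive walls, between two gates. -/
def IsSideChain (g : List T.Corner) : Prop :=
  (∀ x ∈ g, T.Wall U x) ∧ g.IsChain (T.CellNext U) ∧
    (∃ x ∈ g.head?, ∃ y, T.Gate U y ∧ T.CellNext U y x) ∧
    (∃ x ∈ g.getLast?, ∃ y, T.Gate U y ∧ T.CellNext U x y)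

/-- A bounding edge is (a side of) an enter/exit boundary or a corridor convex chain; the latter
is represented by the side chain of the corridor that it spans. -/
def IsBoundingEdge (g : List T.Corner) : Prop := (∃ x, T.Gate U x ∧ g = [x]) ∨ T.IsSideChain U g

/-- The points of a bounding edge: the shortest path inside the corridor or junction between its
two end points. For a side chain this is the corridor convex chain, for a gate it is the gate. -/
def points (g : List T.Corner) : Set T.Spot :=
  {z | ∃ x ∈ g.head?, ∃ y ∈ g.getLast?,
    T.cellDist U (T.spot x) z + T.cellDist U z (y.1, T.pos (T.succ y)) =
      T.cellDist U (T.spot x) (y.1, T.pos (T.succ y))}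

/-! ### The wavefront and its boundary cycles

`o` is a corner at which the source lies, `d` the distance which the wavefront has reached. -/

variable (o : T.Corner) (d : ℝ)

/-- The shortest path wavefront at distance `d`. -/
def wavefront : Set T.Spot := {q | T.dist U (T.spot o) q = ENNReal.ofReal d}

/-- The wavefront has reached the vertex `v`. -/
def Initiated (v : T.Corner) : Prop := T.dist U (T.spot o) (T.spot v) ≤ ENNReal.ofReal d

/-- The wavefront segment with centre `v`: the points of the wavefront that have a shortest path
to the source whose first piece is the line segment to `v`. -/
def wsegment (v : T.Corner) : Set T.Spot :=
  {q | q ∈ T.wavefront U o d ∧ T.dist U (T.spot v) q = edist (T.pos v) q.2 ∧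
    T.dist U (T.spot o) (T.spot v) + edist (T.pos v) q.2 = ENNReal.ofReal d}

/-- The wavefront has reached some point of the edge. -/
def Struck (x : T.Corner) : Prop :=
  ∃ p ∈ T.side x, T.dist U (T.spot o) (x.1, p) ≤ ENNReal.ofReal d

/-- Evolution of the boundary cycles. `Develops E S M`: the triangles in `E` have been entered
through the edges (both sides of which are) in `S`, and `M` consists of the boundary cycles, given
as lists of sides in cyclic order. At the start there is one cycle, the sides of a triangle at the
source. If an edge bounds a triangle not yet entered, it is replaced by the other two edges of the
triangle; a corridor is entered triangle by triangle. If an edge occurs on a cycle with both of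
its sides, that cycle splits into two. -/
inductive Develops : Set (Fin T.num) → Set T.Corner → Multiset (List T.Corner) → Prop
  | start : Develops {o.1} ∅ {[(o.1, 0), (o.1, 1), (o.1, 2)]}
  | enter {E : Set (Fin T.num)} {S : Set T.Corner} {M : Multiset (List T.Corner)}
      {l₁ l₂ : List T.Corner} {x y : T.Corner} :
      Develops E S ((l₁ ++ x :: l₂) ::ₘ M) → T.Joined U x y → y.1 ∉ E →
      Develops (insert y.1 E) (insert x (insert y S))
        ((l₁ ++ T.succ y :: T.succ (T.succ y) :: l₂) ::ₘ M)
  | split {E : Set (Fin T.num)} {S : Set T.Corner} {M : Multiset (List T.Corner)}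
      {l₁ l₂ l₃ : List T.Corner} {x y : T.Corner} :
      Develops E S ((l₁ ++ x :: (l₂ ++ y :: l₃)) ::ₘ M) → T.Joined U x y →
      Develops E (insert x (insert y S)) ((l₁ ++ l₃) ::ₘ l₂ ::ₘ M)

/-- The stage of the wavefront progression at distance `d`: only struck gates have been passed,
and all edges on the boundary cycles are walls or gates that are not yet struck. -/
def IsStage (E : Set (Fin T.num)) (S : Set T.Corner) (M : Multiset (List T.Corner)) : Prop :=
  T.Develops U o E S M ∧ (∀ x ∈ S, T.Gate U x → T.Struck U o d x) ∧
    ∀ L ∈ M, ∀ x ∈ L, (∃ y, T.Joined U x y) → T.Gate U x ∧ ¬ T.Struck U o d x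

/-- `Γ` is one of the boundary cycles in `M`, as a cyclic sequence of bounding edges. -/
def IsBoundaryCycle (M : Multiset (List T.Corner)) (Γ : List (List T.Corner)) : Prop :=
  (∃ L ∈ M, L ≠ [] ∧ L ~r Γ.flatten) ∧ ∀ g ∈ Γ, T.IsBoundingEdge U g

/-- The elements of the cyclic sequence `Γ` with property `X` form a contiguous (possibly empty)
sequence. -/
def Contiguous {α : Type*} (Γ : List α) (X : α → Prop) : Prop :=
  ∃ k l₁ l₂, Γ.rotate k = l₁ ++ l₂ ∧ (∀ g ∈ l₁, X g) ∧ ∀ g ∈ l₂, ¬ X g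

/-! ### Associations -/

variable (S : Set T.Corner)

/-- The edges through which the wavefront has passed, both sides in `S`. -/
def Passed (x y : T.Corner) : Prop := T.Joined U x y ∧ x ∈ S ∧ y ∈ S

/-- The shortest path distance in the region bounded by the boundary cycles, for paths that do
not cross the boundary cycles. -/
def stageDist (a b : T.Spot) : ℝ≥0∞ := T.gdist (T.Passed U S) a b

/-- `b` has a shortest path to the source via `v`, in the region bounded by the boundary
cycles. -/
def Via (v : T.Corner) (b : T.Spot) : Prop :=
  T.stageDist U S (T.spot o) b =
    T.stageDist U S (T.spot o) (T.spot v) + T.stageDist U S (T.spot v) b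

/-- `g` is reachable from the wavefront segment with centre `v`: some line segment between points
of the two does not leave the region bounded by the boundary cycles. -/
def Reachable (g : List T.Corner) (v : T.Corner) : Prop :=
  ∃ q ∈ T.wsegment U o d v, ∃ p ∈ T.points U g, T.stageDist U S q p = edist q.2 p.2

/-- Associations of bounding edges with wavefront segments (given by their centres). A pair can be
associated only if some point of the bounding edge has a shortest path to the source via the
centre, and has to be associated if moreover the edge is reachable from the segment. -/
def IsAssociation (M : Multiset (List T.Corner)) (A : List T.Corner → T.Corner → Prop) : Prop :=
  ∀ Γ, T.IsBoundaryCycle U M Γ → ∀ g ∈ Γ, ∀ v, T.Initiated U o d v →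
    (A g v → ∃ b ∈ T.points U g, T.Via U o S v b) ∧
    (T.Reachable U o d S g v → (∃ b ∈ T.points U g, T.Via U o S v b) → A g v)

/-! ### Bunches and sections of wavefront -/

/-- `p` and `q` are neighbouring vertices on the corridor convex chain `g`. -/
def Successive (g : List T.Corner) (p q : T.Corner) : Prop :=
  T.cellDist U (T.spot p) (T.spot q) ≠ 0 ∧ ∀ r, T.spot r ∈ T.points U g →
    T.cellDist U (T.spot p) (T.spot r) + T.cellDist U (T.spot r) (T.spot q) =
      T.cellDist U (T.spot p) (T.spot q) →
    T.cellDist U (T.spot p) (T.spot r) = 0 ∨ T.cellDist U (T.spot r) (T.spot q) = 0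

/-- A bunch, as the list of the centres of its initiated wavefront segments. Maximality is not
required, so that the pieces of split bunches are included. -/
def IsBunch (B : List T.Corner) : Prop :=
  B = [o] ∨ B ≠ [] ∧ ∃ g, T.IsSideChain U g ∧
    (∀ v ∈ B, T.Initiated U o d v ∧ T.spot v ∈ T.points U g) ∧
    B.IsChain fun p q => T.Successive U g p q ∧
      T.dist U (T.spot o) (T.spot q) =
        T.dist U (T.spot o) (T.spot p) + T.dist U (T.spot p) (T.spot q)

/-- A bunch is associated with `g` if one of its wavefront segments is. -/
def BunchAssoc (A : List T.Corner → T.Corner → Prop) (g B : List T.Corner) : Prop :=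
  ∃ v ∈ B, A g v

/-- A section of wavefront, for a boundary cycle `Γ`: a single bunch, or a sequence of bunches in
the waveform-section of a bounding edge `C` of `Γ`, that is, all associated with `C`. -/
def IsSection (A : List T.Corner → T.Corner → Prop) (Γ : List (List T.Corner))
    (W : List (List T.Corner)) : Prop :=
  (∀ B ∈ W, T.IsBunch U o d B) ∧
    ((∃ B, W = [B]) ∨ ∃ C ∈ Γ, ∀ B ∈ W, T.BunchAssoc A C B)

end Triangulation

end Wavefront

end

/-!
The association that works is the largest possible one: a bounding edge `g` is associated with the
segment centred at `v` if and only if some point of `g` has a shortest path to the source via `v`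
in the region bounded by the boundary cycles (`Assoc`).

For a single segment, contiguity is a non-crossing argument (`IsStage.not_via_both`). Suppose that
two bounding edges of a boundary cycle which are not associated with `v` separate two bounding
edges which are. The former contain points `c`, `c'` without a shortest path via `v`, the latter
points `b`, `b'` with one. Nearly shortest paths from the source to `c` and `c'` form a curve that
cuts the region into two parts, and nearly shortest paths from `v` to `b` and `b'` cannot meet it:
at a common point the paths could be exchanged, and `c` or `c'` would have a shortest path via `v`
(`not_meet_of_via`). Hence `b` and `b'` are in the same part of the region, whereas the two parts
of the boundary cycle between `c` and `c'` are in different parts.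

Topology enters modulo two only. Paths are put in general position: they become lists of chords
of triangles between points in the interior of sides (`Route.exists_trail`). A list of chords
colours the corners of the triangles such that the colour changes along each side by the number of
chord ends on it. Such a colouring exists since the region is planar: this is shown along the
development of the boundary cycles (`Develops.exists_potential`), for every cochain that vanishes
on all cycles, and the colours then alternate along the boundary cycle as expected
(`Walk.eq_of_two`). Inside a triangle, a chord that separates two points of the boundary meets
every path between them (`bent_meets`), so that the colour is constant along paths that avoid the
chords (`Trail.col_eq`).

A convex chain does not lie on the boundary cycle, but possibly in the interior of the corridor.
It remains to show that the curve does not separate a point `b` of the chain from the walls below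
it (`IsStage.col_eq`). The curve is split into runs inside single corridors or junctions. A run
that separates `b` from these walls meets nearly shortest paths inside the corridor from `b` to
both ends of the chain (`IsRun.exists_meet`). As `b` lies on a shortest path between these ends,
the run could nearly as well pass through `b` (`detour_le`), which is excluded as `b` has
a shortest path via `v`. The colours defined by a single run exist since the triangles of
a corridor form a sequence (`exists_cell_potential`).

The claim on bunches follows from that on segments: behind the wavefront, shortest paths pass
through struck gates only (`IsStage.via_of_dist_eq`), so that a path via some centre of a bunch can
be chosen via its first centre (`IsStage.bunchAssoc_iff`). For sections, contiguity is used in the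
form that no two elements outside a set separate two elements of the set (`Unseparated`), which is
inherited by unions of sets with a common element.
-/

noncomputable section

namespace Wavefront

namespace Triangulation

variable {D : PolygonalDomain} (T : Triangulation D)

/-! ### Triangles -/

lemma plane_ext {p q : Plane} (h0 : p 0 = q 0) (h1 : p 1 = q 1) : p = q := by
  ext i; fin_cases i
  · exact h0
  · exact h1

/-- Twice the signed area of the triangle `a b c`. -/
def area (a b c : Plane) : ℝ := (b 0 - a 0) * (c 1 - a 1) - (b 1 - a 1) * (c 0 - a 0)

lemma succ_succ_succ (x : T.Corner) : T.succ (T.succ (T.succ x)) = x := by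
  rcases x with ⟨t, i⟩
  simp only [succ, Prod.mk.injEq, true_and]
  fin_cases i <;> rfl

lemma succ_ne (x : T.Corner) : T.succ x ≠ x := by
  rcases x with ⟨t, i⟩
  simp only [succ, ne_eq, Prod.mk.injEq, true_and]
  fin_cases i <;> decide

lemma succ_succ_ne (x : T.Corner) : T.succ (T.succ x) ≠ x := by
  rcases x with ⟨t, i⟩
  simp only [succ, ne_eq, Prod.mk.injEq, true_and]
  fin_cases i <;> decide

@[simp] lemma succ_fst (x : T.Corner) : (T.succ x).1 = x.1 := rfl

lemma eq_or_of_fst_eq {x y : T.Corner} (h : y.1 = x.1) :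
    y = x ∨ y = T.succ x ∨ y = T.succ (T.succ x) := by
  rcases x with ⟨t, i⟩
  rcases y with ⟨t', j⟩
  obtain rfl : t' = t := h
  simp only [succ, Prod.mk.injEq, true_and]
  fin_cases i <;> fin_cases j <;> decide

/-- Triangles are counterclockwise, whichever corner comes first. -/
lemma area_pos (x : T.Corner) :
    0 < area (T.pos x) (T.pos (T.succ x)) (T.pos (T.succ (T.succ x))) := by
  rcases x with ⟨t, i⟩
  have h := T.ccw t
  have h1 : (0 : Fin 3) + 1 = 1 := by decide
  have h2 : (1 : Fin 3) + 1 = 2 := by decide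
  have h3 : (2 : Fin 3) + 1 = 0 := by decide
  have hi : i = 0 ∨ i = 1 ∨ i = 2 := by fin_cases i <;> decide
  rcases hi with rfl | rfl | rfl <;> simp only [pos, succ, area, h1, h2, h3] <;> linarith

lemma pos_ne (x : T.Corner) : T.pos (T.succ x) ≠ T.pos x := fun h => by
  have := T.area_pos x
  rw [h] at this
  simp [area] at this

lemma pos_injOn {x y : T.Corner} (h : x.1 = y.1) (hp : T.pos x = T.pos y) : x = y := by
  rcases T.eq_or_of_fst_eq h with rfl | rfl | rfl
  · rfl
  · exact absurd hp (T.pos_ne y)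
  · have := T.pos_ne (T.succ (T.succ y))
    rw [T.succ_succ_succ] at this
    exact absurd hp.symm this

lemma range_corner (x : T.Corner) :
    range (T.corner x.1) = {T.pos x, T.pos (T.succ x), T.pos (T.succ (T.succ x))} := by
  ext p
  simp only [mem_range, mem_insert_iff, mem_singleton_iff]
  constructor
  · rintro ⟨i, rfl⟩
    rcases T.eq_or_of_fst_eq (x := x) (y := (x.1, i)) rfl with h | h | h <;> rw [← h]
    · exact Or.inl rfl
    · exact Or.inr (Or.inl rfl)
    · exact Or.inr (Or.inr rfl)
  · rintro (rfl | rfl | rfl)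
    exacts [⟨_, rfl⟩, ⟨_, rfl⟩, ⟨_, rfl⟩]

/-- Barycentric coordinates in a triangle. -/
lemma mem_tri_iff (x : T.Corner) (p : Plane) :
    p ∈ T.tri x.1 ↔ ∃ a b c : ℝ, 0 ≤ a ∧ 0 ≤ b ∧ 0 ≤ c ∧ a + b + c = 1 ∧
      p = a • T.pos x + b • T.pos (T.succ x) + c • T.pos (T.succ (T.succ x)) := by
  rw [tri, T.range_corner x]
  constructor
  · intro h
    have hc : Convex ℝ {p : Plane | ∃ a b c : ℝ, 0 ≤ a ∧ 0 ≤ b ∧ 0 ≤ c ∧ a + b + c = 1 ∧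
        p = a • T.pos x + b • T.pos (T.succ x) + c • T.pos (T.succ (T.succ x))} := by
      rintro _ ⟨a, b, c, ha, hb, hc, hs, rfl⟩ _ ⟨a', b', c', ha', hb', hc', hs', rfl⟩ u v hu hv huv
      refine ⟨u * a + v * a', u * b + v * b', u * c + v * c', by positivity, by positivity,
        by positivity, ?_, ?_⟩
      · linear_combination u * hs + v * hs' + huv
      · module
    refine convexHull_min ?_ hc h
    rintro q (rfl | rfl | rfl)
    · exact ⟨1, 0, 0, by simp⟩
    · exact ⟨0, 1, 0, by simp⟩
    · exact ⟨0, 0, 1, by simp⟩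
  · rintro ⟨a, b, c, ha, hb, hc, hs, rfl⟩
    have hcv := convex_convexHull ℝ
      ({T.pos x, T.pos (T.succ x), T.pos (T.succ (T.succ x))} : Set Plane)
    have h := hcv.sum_mem (t := Finset.univ) (w := ![a, b, c])
      (z := ![T.pos x, T.pos (T.succ x), T.pos (T.succ (T.succ x))]) (fun i _ => by
        fin_cases i <;> assumption) (by simpa [Fin.sum_univ_three] using hs) (fun i _ => by
        apply subset_convexHull
        fin_cases i <;> simp)
    simpa [Fin.sum_univ_three] using h

lemma pos_mem_tri (x : T.Corner) : T.pos x ∈ T.tri x.1 :=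
  subset_convexHull _ _ ⟨x.2, rfl⟩

lemma convex_tri (t : Fin T.num) : Convex ℝ (T.tri t) := convex_convexHull _ _

lemma side_subset_tri (x : T.Corner) : T.side x ⊆ T.tri x.1 :=
  (T.convex_tri x.1).segment_subset (T.pos_mem_tri x) (T.pos_mem_tri (T.succ x))

lemma isCompact_tri (t : Fin T.num) : IsCompact (T.tri t) :=
  (Set.finite_range _).isCompact_convexHull (𝕜 := ℝ)

/-- A directed edge is the side of at most one triangle, as two triangles on the same side of an
edge overlap. -/
lemma eq_of_pos_eq {x y : T.Corner} (h0 : T.pos x = T.pos y)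
    (h1 : T.pos (T.succ x) = T.pos (T.succ y)) : x = y := by
  by_cases hxy : x.1 = y.1
  · exact T.pos_injOn hxy h0
  exfalso
  have hx := T.area_pos x
  have hy := T.area_pos y
  rw [← h0, ← h1] at hy
  have hprop := T.proper x.1 y.1 hxy
  have hdist := T.distinct x.1 y.1 hxy
  rw [T.range_corner x, T.range_corner y, ← h0, ← h1] at hdist
  change T.tri x.1 ∩ T.tri y.1 = _ at hprop
  have hcommon : range (T.corner x.1) ∩ range (T.corner y.1) ⊆ {T.pos x, T.pos (T.succ x)} := by
    rw [T.range_corner x, T.range_corner y, ← h0, ← h1]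
    rintro q ⟨hq | hq | hq, hq'⟩
    · exact Or.inl hq
    · exact Or.inr hq
    · rcases hq' with hq' | hq' | hq'
      · exact Or.inl hq'
      · exact Or.inr hq'
      · exact absurd (by rw [← show _ = _ from hq, ← show _ = _ from hq']) hdist
  set A := T.pos x
  set B := T.pos (T.succ x)
  set C := T.pos (T.succ (T.succ x))
  set C' := T.pos (T.succ (T.succ y))
  set Δ := area A B C with hΔ
  -- the barycentric coordinates of the third corner of `y.1` with respect to `x.1`
  set α := area C' B C / Δ with hα
  set β := area A C' C / Δ with hβ
  set γ := area A B C' / Δ with hγ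
  have hγ0 : 0 < γ := div_pos hy hx
  have hsum : α + β + γ = 1 := by
    rw [hα, hβ, hγ, ← add_div, ← add_div, div_eq_one_iff_eq hx.ne', hΔ]
    unfold area; ring
  have hC' : C' = α • A + β • B + γ • C := by
    have e1 : α * Δ = area C' B C := div_mul_cancel₀ _ hx.ne'
    have e2 : β * Δ = area A C' C := div_mul_cancel₀ _ hx.ne'
    have e3 : γ * Δ = area A B C' := div_mul_cancel₀ _ hx.ne'
    apply plane_ext
    · apply mul_right_cancel₀ hx.ne'
      simp only [PiLp.add_apply, PiLp.smul_apply, smul_eq_mul]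
      have : (α * A 0 + β * B 0 + γ * C 0) * Δ
        = (α * Δ) * A 0 + (β * Δ) * B 0 + (γ * Δ) * C 0 := by ring
      rw [this, e1, e2, e3, hΔ]; unfold area; ring
    · apply mul_right_cancel₀ hx.ne'
      simp only [PiLp.add_apply, PiLp.smul_apply, smul_eq_mul]
      have : (α * A 1 + β * B 1 + γ * C 1) * Δ
        = (α * Δ) * A 1 + (β * Δ) * B 1 + (γ * Δ) * C 1 := by ring
      rw [this, e1, e2, e3, hΔ]; unfold area; ring
  -- a point near the midpoint of the common edge lies in both triangles
  obtain ⟨η, hη0, hη1, ha, hb⟩ : ∃ η : ℝ, 0 < η ∧ η ≤ 1 ∧ 0 ≤ (1 - η) / 2 + η * α ∧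
      0 ≤ (1 - η) / 2 + η * β := by
    have hpos : 0 < 1 + 2 * |α| + 2 * |β| := by positivity
    refine ⟨1 / (1 + 2 * |α| + 2 * |β|), by positivity, ?_, ?_, ?_⟩
    · rw [div_le_one hpos]; linarith [abs_nonneg α, abs_nonneg β]
    · have : (1 - 1 / (1 + 2 * |α| + 2 * |β|)) / 2 + 1 / (1 + 2 * |α| + 2 * |β|) * α
        = (|α| + |β| + α) / (1 + 2 * |α| + 2 * |β|) := by field_simp; ring
      rw [this]
      exact div_nonneg (by linarith [neg_abs_le α, abs_nonneg β]) hpos.le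
    · have : (1 - 1 / (1 + 2 * |α| + 2 * |β|)) / 2 + 1 / (1 + 2 * |α| + 2 * |β|) * β
        = (|α| + |β| + β) / (1 + 2 * |α| + 2 * |β|) := by field_simp; ring
      rw [this]
      exact div_nonneg (by linarith [neg_abs_le β, abs_nonneg α]) hpos.le
  set q : Plane := ((1 - η) / 2) • A + ((1 - η) / 2) • B + η • C' with hq
  have hqx : q ∈ T.tri x.1 := by
    rw [T.mem_tri_iff x]
    refine ⟨(1 - η) / 2 + η * α, (1 - η) / 2 + η * β, η * γ, ha, hb, by positivity, ?_, ?_⟩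
    · linear_combination η * hsum
    · rw [hq, hC']; module
  have hqy : q ∈ T.tri y.1 := by
    rw [T.mem_tri_iff y, ← h0, ← h1]
    exact ⟨(1 - η) / 2, (1 - η) / 2, η, by linarith, by linarith, hη0.le, by ring, rfl⟩
  have hmem : q ∈ segment ℝ A B := by
    rw [← convexHull_pair]
    apply convexHull_mono hcommon
    rw [← hprop]
    exact ⟨hqx, hqy⟩
  obtain ⟨u, v, -, -, huv, hqe⟩ := hmem
  have h0' : area A B q = 0 := by
    rw [← hqe, eq_sub_of_add_eq huv]
    simp only [area, PiLp.add_apply, PiLp.smul_apply, smul_eq_mul]; ring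
  have h1' : area A B q = η * area A B C' := by
    rw [hq]
    simp only [area, PiLp.add_apply, PiLp.smul_apply, smul_eq_mul]; ring
  rw [h1'] at h0'
  exact (mul_pos hη0 hy).ne' h0'

/-! ### Joined sides -/

section Gluing

variable {T} {U : Set (Fin T.num)}

lemma Joined.symm {x y : T.Corner} (h : T.Joined U x y) : T.Joined U y x :=
  ⟨h.2.1, h.1, h.2.2.2.symm, h.2.2.1.symm⟩

lemma Joined.unique {x y y' : T.Corner} (h : T.Joined U x y) (h' : T.Joined U x y') : y = y' :=
  T.eq_of_pos_eq (h.2.2.1.trans h'.2.2.1.symm) (h.2.2.2.trans h'.2.2.2.symm)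

lemma Joined.side_eq {x y : T.Corner} (h : T.Joined U x y) : T.side y = T.side x := by
  rw [side, side, h.2.2.1, h.2.2.2, segment_symm]

lemma Joined.fst_ne {x y : T.Corner} (h : T.Joined U x y) : y.1 ≠ x.1 := fun he => by
  have h1 : y = T.succ x := T.pos_injOn he h.2.2.1
  have h2 : T.succ y = x := T.pos_injOn (by simpa using he) h.2.2.2
  rw [h1] at h2
  exact T.succ_succ_ne x h2

lemma Joined.ne {x y : T.Corner} (h : T.Joined U x y) : y ≠ x := fun he => h.fst_ne (by rw [he])

lemma Gate.of_joined {x y : T.Corner} (h : T.Gate U x) (hxy : T.Joined U x y) : T.Gate U y := by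
  obtain ⟨z, hz, hj⟩ := h
  obtain rfl := hz.unique hxy
  exact ⟨x, hxy.symm, hj.symm⟩

lemma Inner.symm {x y : T.Corner} (h : T.Inner U x y) : T.Inner U y x :=
  ⟨h.1.symm, fun hg => h.2 (hg.of_joined h.1.symm)⟩

lemma Inner.unique {x y y' : T.Corner} (h : T.Inner U x y) (h' : T.Inner U x y') : y = y' :=
  h.1.unique h'.1

end Gluing

/-! ### Routes and distances -/

section Routes

variable {T} {U : Set (Fin T.num)} {G : T.Corner → T.Corner → Prop}

lemma Joined.mem_side {x y : T.Corner} (h : T.Joined U x y) {p : Plane} (hp : p ∈ T.side x) :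
    p ∈ T.side y := h.side_eq ▸ hp

lemma Route.mem_tri (hG : ∀ x y, G x y → T.Joined U x y) {a b : T.Spot} {ℓ : ℝ≥0∞}
    (h : T.Route G a b ℓ) : b.2 ∈ T.tri b.1 := by
  induction h with
  | refl h => exact h
  | move _ h _ => exact h
  | cross _ h hx _ => exact T.side_subset_tri _ ((hG _ _ h).mem_side hx)

lemma Route.trans {a b c : T.Spot} {ℓ m : ℝ≥0∞} (h : T.Route G a b ℓ) (h' : T.Route G b c m) :
    T.Route G a c (ℓ + m) := by
  induction h' with
  | refl _ => simpa using h
  | move _ hy ih => rw [← add_assoc]; exact ih.move hy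
  | cross _ hg hx ih => exact ih.cross hg hx

lemma Route.symm (hG : ∀ x y, G x y → T.Joined U x y) (hs : ∀ x y, G x y → G y x)
    {a b : T.Spot} {ℓ : ℝ≥0∞} (h : T.Route G a b ℓ) : T.Route G b a ℓ := by
  induction h with
  | refl h => exact .refl h
  | @move t x y ℓ h hy ih =>
    have h1 : T.Route G (t, y) (t, x) (0 + edist y x) :=
      Route.move (Route.refl (a := (t, y)) hy) (h.mem_tri hG)
    rw [zero_add, edist_comm] at h1
    rw [add_comm]
    exact h1.trans ih
  | @cross u v x ℓ h hg hx ih =>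
    have hx' := (hG _ _ hg).mem_side hx
    have h1 : T.Route G (v.1, x) (u.1, x) 0 :=
      Route.cross (Route.refl (a := (v.1, x)) (T.side_subset_tri _ hx')) (hs _ _ hg) hx'
    simpa using h1.trans ih

/-- A route remains a route for another gluing if the latter contains the former on a set of
triangles that the route cannot leave. -/
lemma Route.mono_on {G' : T.Corner → T.Corner → Prop} {K : Set (Fin T.num)}
    (hK : ∀ x y, G x y → x.1 ∈ K → G' x y ∧ y.1 ∈ K) {a b : T.Spot} {ℓ : ℝ≥0∞}
    (h : T.Route G a b ℓ) (ha : a.1 ∈ K) : T.Route G' a b ℓ ∧ b.1 ∈ K := by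
  induction h with
  | refl h => exact ⟨.refl h, ha⟩
  | move _ hy ih => exact ⟨ih.1.move hy, ih.2⟩
  | cross _ hg hx ih => exact ⟨ih.1.cross (hK _ _ hg ih.2).1 hx, (hK _ _ hg ih.2).2⟩

lemma gdist_le_of_route {a b : T.Spot} {ℓ : ℝ≥0∞} (h : T.Route G a b ℓ) : T.gdist G a b ≤ ℓ :=
  sInf_le h

lemma exists_route_lt {a b : T.Spot} {m : ℝ≥0∞} (h : T.gdist G a b < m) :
    ∃ ℓ, T.Route G a b ℓ ∧ ℓ < m := sInf_lt_iff.1 h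

lemma exists_route_le {a b : T.Spot} (h : T.gdist G a b ≠ ⊤) {ε : ℝ≥0∞} (hε : ε ≠ 0) :
    ∃ ℓ, T.Route G a b ℓ ∧ ℓ ≤ T.gdist G a b + ε := by
  obtain ⟨ℓ, h1, h2⟩ := exists_route_lt (ENNReal.lt_add_right h hε)
  exact ⟨ℓ, h1, h2.le⟩

lemma gdist_triangle (a b c : T.Spot) : T.gdist G a c ≤ T.gdist G a b + T.gdist G b c := by
  by_cases h1 : T.gdist G a b = ⊤
  · simp [h1]
  by_cases h2 : T.gdist G b c = ⊤
  · simp [h2]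
  refine ENNReal.le_of_forall_pos_le_add fun ε hε _ => ?_
  have hε' : (ε / 2 : ℝ≥0∞) ≠ 0 := by simpa using hε.ne'
  obtain ⟨ℓ, hℓ, hℓ'⟩ := exists_route_le h1 hε'
  obtain ⟨m, hm, hm'⟩ := exists_route_le h2 hε'
  calc T.gdist G a c ≤ ℓ + m := gdist_le_of_route (hℓ.trans hm)
    _ ≤ (T.gdist G a b + ε / 2) + (T.gdist G b c + ε / 2) := add_le_add hℓ' hm'
    _ = _ := by rw [add_add_add_comm, ENNReal.add_halves]

lemma gdist_comm (hG : ∀ x y, G x y → T.Joined U x y) (hs : ∀ x y, G x y → G y x)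
    (a b : T.Spot) : T.gdist G a b = T.gdist G b a := by
  unfold gdist
  congr 1
  ext ℓ
  exact ⟨Route.symm hG hs, Route.symm hG hs⟩

lemma gdist_le_edist {t : Fin T.num} {x y : Plane} (hx : x ∈ T.tri t) (hy : y ∈ T.tri t) :
    T.gdist G (t, x) (t, y) ≤ edist x y := by
  have := Route.move (Route.refl (glue := G) (a := (t, x)) hx) hy
  rw [zero_add] at this
  exact gdist_le_of_route this

lemma gdist_self {a : T.Spot} (h : a.2 ∈ T.tri a.1) : T.gdist G a a = 0 :=
  le_antisymm (gdist_le_of_route (.refl h)) zero_le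

lemma gdist_cross {u v : T.Corner} (h : G u v) {x : Plane} (hx : x ∈ T.side u) :
    T.gdist G (u.1, x) (v.1, x) = 0 :=
  le_antisymm (gdist_le_of_route (.cross (.refl (a := (u.1, x)) (T.side_subset_tri _ hx)) h hx))
    zero_le

lemma gdist_mono_on {G' : T.Corner → T.Corner → Prop} {K : Set (Fin T.num)}
    (hK : ∀ x y, G x y → x.1 ∈ K → G' x y ∧ y.1 ∈ K) {a b : T.Spot} (ha : a.1 ∈ K) :
    T.gdist G' a b ≤ T.gdist G a b :=
  le_sInf fun _ h => gdist_le_of_route (h.mono_on hK ha).1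

lemma mem_of_gdist_ne_top {K : Set (Fin T.num)}
    (hK : ∀ x y, G x y → x.1 ∈ K → y.1 ∈ K) {a b : T.Spot} (ha : a.1 ∈ K)
    (h : T.gdist G a b ≠ ⊤) : b.1 ∈ K := by
  obtain ⟨ℓ, hℓ, -⟩ := exists_route_le h one_ne_zero
  exact (hℓ.mono_on (G' := G) (fun x y hg hx => ⟨hg, hK x y hg hx⟩) ha).2

lemma mem_tri_of_gdist_ne_top (hG : ∀ x y, G x y → T.Joined U x y) {a b : T.Spot}
    (h : T.gdist G a b ≠ ⊤) : b.2 ∈ T.tri b.1 := by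
  obtain ⟨ℓ, hℓ, -⟩ := exists_route_le h one_ne_zero
  exact hℓ.mem_tri hG

end Routes

/-! ### Trails in general position -/

section Trails

/-- A node: a point of a side that is not a corner, given by its position in the side. -/
abbrev Node := T.Corner × ℝ

/-- The point of the plane that a node stands for. -/
def pt (n : T.Node) : Plane := AffineMap.lineMap (T.pos n.1) (T.pos (T.succ n.1)) n.2

/-- A chord: two nodes, which in a valid chord lie on sides of the same triangle. -/
abbrev Chord := T.Node × T.Node

variable {T} {U : Set (Fin T.num)} {G : T.Corner → T.Corner → Prop}

/-- The node is not a corner. -/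
def Proper (n : T.Node) : Prop := n.2 ∈ Ioo (0 : ℝ) 1

/-- The chord joins two nodes of one triangle. -/
def ValidChord (c : T.Chord) : Prop := c.1.1.1 = c.2.1.1 ∧ Proper c.1 ∧ Proper c.2

/-- `n` and `m` are the same point of an edge, seen from the two triangles at it. -/
def Twin (G : T.Corner → T.Corner → Prop) (n m : T.Node) : Prop := G n.1 m.1 ∧ m.2 = 1 - n.2

/-- The chord as a segment. -/
def seg (c : T.Chord) : Set Plane := segment ℝ (T.pt c.1) (T.pt c.2)

/-- `Trail G n l m`: the chords in `l` form a path which starts at the node `n` and which passes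
through a glued edge after each chord; after the last of these edges it is at the node `m`. -/
def Trail (G : T.Corner → T.Corner → Prop) : T.Node → List T.Chord → T.Node → Prop
  | n, [], m => n = m
  | n, c :: l, m => c.1 = n ∧ ValidChord c ∧ ∃ n', Twin G c.2 n' ∧ Trail G n' l m

/-- The length of a trail. -/
def len (l : List T.Chord) : ℝ≥0∞ := (l.map fun c => edist (T.pt c.1) (T.pt c.2)).sum

@[simp] lemma len_nil : len ([] : List T.Chord) = 0 := rfl

@[simp] lemma len_cons (c : T.Chord) (l : List T.Chord) :
    len (c :: l) = edist (T.pt c.1) (T.pt c.2) + len l := by simp [len]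

@[simp] lemma len_append (l l' : List T.Chord) : len (l ++ l') = len l + len l' := by simp [len]

lemma Trail.append {n k m : T.Node} {l l' : List T.Chord} (h : Trail G n l k)
    (h' : Trail G k l' m) : Trail G n (l ++ l') m := by
  induction l generalizing n with
  | nil => obtain rfl : n = k := h; exact h'
  | cons c l ih =>
    obtain ⟨h1, h2, n', h3, h4⟩ := h
    exact ⟨h1, h2, n', h3, ih h4⟩

lemma pt_mem_side {n : T.Node} (h : Proper n) : T.pt n ∈ T.side n.1 := by
  rw [side, segment_eq_image_lineMap]
  exact ⟨n.2, ⟨h.1.le, h.2.le⟩, rfl⟩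

lemma pt_mem_tri {n : T.Node} (h : Proper n) : T.pt n ∈ T.tri n.1.1 :=
  T.side_subset_tri _ (pt_mem_side h)

lemma seg_subset_tri {c : T.Chord} (h : ValidChord c) : seg c ⊆ T.tri c.1.1.1 :=
  (T.convex_tri _).segment_subset (pt_mem_tri h.2.1) (h.1 ▸ pt_mem_tri h.2.2)

lemma Twin.proper {n m : T.Node} (h : Twin G n m) (hn : Proper n) : Proper m := by
  rw [Proper, h.2]
  exact ⟨by linarith [hn.2], by linarith [hn.1]⟩

lemma Twin.pt_eq (hG : ∀ x y, G x y → T.Joined U x y) {n m : T.Node} (h : Twin G n m) :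
    T.pt m = T.pt n := by
  have hj := hG _ _ h.1
  rw [pt, pt, h.2, hj.2.2.1, hj.2.2.2, AffineMap.lineMap_apply_one_sub]

lemma Trail.proper {n m : T.Node} {l : List T.Chord} (h : Trail G n l m) (hn : Proper n) :
    Proper m := by
  induction l generalizing n with
  | nil => obtain rfl : n = m := h; exact hn
  | cons c l ih =>
    obtain ⟨h1, h2, n', h3, h4⟩ := h
    exact ih h4 (h3.proper h2.2.2)

lemma Trail.valid {n m : T.Node} {l : List T.Chord} (h : Trail G n l m) :
    ∀ c ∈ l, ValidChord c := by
  induction l generalizing n with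
  | nil => simp
  | cons c l ih =>
    obtain ⟨h1, h2, n', h3, h4⟩ := h
    rintro c' (_ | ⟨_, hc'⟩)
    · exact h2
    · exact ih h4 c' hc'

/-- The spot of a node. -/
def nspot (n : T.Node) : T.Spot := (n.1.1, T.pt n)

lemma Twin.gdist_eq_zero {n m : T.Node} (h : Twin G n m)
    (hG : ∀ x y, G x y → T.Joined U x y) (hn : Proper n) : T.gdist G (nspot n) (nspot m) = 0 := by
  rw [nspot, nspot, h.pt_eq hG]
  exact gdist_cross h.1 (pt_mem_side hn)

/-- A node close to a given point of a side. -/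
lemma exists_node_near (x : T.Corner) {p : Plane} (hp : p ∈ T.side x) {ε : ℝ≥0∞} (hε : ε ≠ 0) :
    ∃ n : T.Node, n.1 = x ∧ Proper n ∧ edist p (T.pt n) ≤ ε := by
  rw [side, segment_eq_image_lineMap] at hp
  obtain ⟨r, hr, rfl⟩ := hp
  have hcont : Continuous fun r : ℝ => AffineMap.lineMap (k := ℝ) (T.pos x) (T.pos (T.succ x)) r :=
    AffineMap.lineMap_continuous
  have hcl : r ∈ closure (Ioo (0 : ℝ) 1) := by rwa [closure_Ioo zero_ne_one]
  have hnhds : {r' : ℝ | edist (AffineMap.lineMap (k := ℝ) (T.pos x) (T.pos (T.succ x)) r)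
      (AffineMap.lineMap (k := ℝ) (T.pos x) (T.pos (T.succ x)) r') < ε} ∈ nhds r := by
    apply IsOpen.mem_nhds
    · exact isOpen_lt (continuous_const.edist hcont) continuous_const
    · simpa using pos_iff_ne_zero.2 hε
  obtain ⟨r', hr', hr''⟩ := mem_closure_iff_nhds.1 hcl _ hnhds
  exact ⟨(x, r'), rfl, hr'', le_of_lt hr'⟩

/-- Routes can be put in general position, at an arbitrarily small cost: they become trails, which
avoid the corners. The end of the route is not a node; the trail ends at the last edge that has
been passed, and its length is compared for all points `y` of the last triangle. -/
lemma Route.exists_trail {a b : T.Spot} {ℓ : ℝ≥0∞} (h : T.Route G a b ℓ)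
    (hG : ∀ x y, G x y → T.Joined U x y) {n : T.Node} (hn : n.1.1 = a.1) (hnp : Proper n)
    {ε : ℝ≥0∞} (hε : ε ≠ 0) :
    ∃ l m, Trail G n l m ∧ m.1.1 = b.1 ∧ ∀ y ∈ T.tri b.1,
      len l + edist (T.pt m) y ≤ ℓ + edist a.2 (T.pt n) + edist b.2 y + ε := by
  induction h generalizing ε with
  | refl h =>
    refine ⟨[], n, rfl, hn, fun y _ => ?_⟩
    rw [len_nil, zero_add, zero_add]
    exact ((edist_triangle_left _ _ a.2)).trans le_self_add
  | @move t x y ℓ h hy ih =>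
    obtain ⟨l, m, h1, h2, h3⟩ := ih hε
    refine ⟨l, m, h1, h2, fun z hz => (h3 z hz).trans ?_⟩
    have := edist_triangle x y z
    calc ℓ + edist a.2 (T.pt n) + edist x z + ε
        ≤ ℓ + edist a.2 (T.pt n) + (edist x y + edist y z) + ε := by gcongr
      _ = _ := by simp only; ring
  | @cross u v x ℓ h hg hx ih =>
    have hε4 : ε / 4 ≠ 0 := by simpa using hε
    obtain ⟨l, m, h1, h2, h3⟩ := ih hε4
    obtain ⟨k, rfl, hkp, hk⟩ := exists_node_near u hx hε4
    have htw : Twin G k (v, 1 - k.2) := ⟨hg, rfl⟩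
    have hpt := htw.pt_eq hG
    refine ⟨l ++ [(m, k)], (v, 1 - k.2),
      h1.append ⟨rfl, ⟨h2, h1.proper hnp, hkp⟩, _, htw, rfl⟩, rfl, fun y hy => ?_⟩
    have h4 := h3 (T.pt k) (pt_mem_tri hkp)
    rw [len_append, len_cons, len_nil, add_zero, hpt]
    have h5 : edist (T.pt k) y ≤ ε / 4 + edist x y :=
      (edist_triangle_left _ _ x).trans (add_le_add_left hk _)
    calc len l + edist (T.pt m) (T.pt k) + edist (T.pt k) y
        ≤ (ℓ + edist a.2 (T.pt n) + edist x (T.pt k) + ε / 4) + (ε / 4 + edist x y) :=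
          add_le_add h4 h5
      _ ≤ (ℓ + edist a.2 (T.pt n) + ε / 4 + ε / 4) + (ε / 4 + edist x y) := by gcongr
      _ ≤ ℓ + edist a.2 (T.pt n) + edist x y + (ε / 4 + ε / 4 + ε / 4 + ε / 4) := by
          have : (ℓ + edist a.2 (T.pt n) + ε / 4 + ε / 4) + (ε / 4 + edist x y)
            = ℓ + edist a.2 (T.pt n) + edist x y + (ε / 4 + ε / 4 + ε / 4) := by ring
          rw [this, ← add_assoc _ (ε / 4 + ε / 4 + ε / 4) (ε / 4)]
          exact le_self_add
      _ = _ := by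
          have : ε / 4 + ε / 4 + ε / 4 + ε / 4 = ε := by
            calc ε / 4 + ε / 4 + ε / 4 + ε / 4 = 4 * (ε / 4) := by ring
              _ = ε := ENNReal.mul_div_cancel (by norm_num) (by norm_num)
          rw [this]

end Trails

/-! ### Points on trails -/

section OnTrail

variable {T} {U : Set (Fin T.num)} {G : T.Corner → T.Corner → Prop}

lemma edist_add_edist_of_mem_segment {a b p : Plane} (h : p ∈ segment ℝ a b) :
    edist a p + edist p b = edist a b := by
  rw [edist_dist, edist_dist, edist_dist, ← ENNReal.ofReal_add dist_nonneg dist_nonneg,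
    dist_add_dist_of_mem_segment h]

lemma gdist_add_le_of_mem_segment {t : Fin T.num} {a b p : Plane} (ha : a ∈ T.tri t)
    (hb : b ∈ T.tri t) (hp : p ∈ segment ℝ a b) :
    T.gdist G (t, a) (t, p) + T.gdist G (t, p) (t, b) ≤ edist a b := by
  have hpt := (T.convex_tri t).segment_subset ha hb hp
  rw [← edist_add_edist_of_mem_segment hp]
  exact add_le_add (gdist_le_edist ha hpt) (gdist_le_edist hpt hb)

lemma gdist_add_add_le_of_mem_segment {t : Fin T.num} {a b p q : Plane} (ha : a ∈ T.tri t)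
    (hb : b ∈ T.tri t) (hp : p ∈ segment ℝ a b) (hq : q ∈ segment ℝ a b) :
    T.gdist G (t, a) (t, p) + T.gdist G (t, p) (t, q) + T.gdist G (t, q) (t, b) ≤ edist a b ∨
    T.gdist G (t, a) (t, q) + T.gdist G (t, q) (t, p) + T.gdist G (t, p) (t, b) ≤ edist a b := by
  have key : ∀ r r' : ℝ, 0 ≤ r → r ≤ r' → r' ≤ 1 →
      AffineMap.lineMap (k := ℝ) a b r ∈ segment ℝ a (AffineMap.lineMap (k := ℝ) a b r') := by
    intro r r' h0 h1 h2
    rw [segment_eq_image_lineMap]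
    rcases (h0.trans h1).eq_or_lt with h | h
    · exact ⟨0, by simp, by
        rw [← h, (h ▸ h1 : r ≤ 0).antisymm h0]; simp⟩
    · refine ⟨r / r', ⟨by positivity, (div_le_one h).2 h1⟩, ?_⟩
      simp only [AffineMap.lineMap_apply, vsub_eq_sub, vadd_eq_add, add_sub_cancel_right, smul_smul,
        div_mul_cancel₀ _ h.ne']
  have key2 : ∀ p q : Plane, p ∈ segment ℝ a q → q ∈ segment ℝ a b →
      T.gdist G (t, a) (t, p) + T.gdist G (t, p) (t, q) + T.gdist G (t, q) (t, b)
        ≤ edist a b := by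
    intro p q hp hq
    have hqt := (T.convex_tri t).segment_subset ha hb hq
    rw [← edist_add_edist_of_mem_segment hq]
    exact add_le_add (gdist_add_le_of_mem_segment ha hqt hp) (gdist_le_edist hqt hb)
  have hp' := hp
  have hq' := hq
  rw [segment_eq_image_lineMap] at hp hq
  obtain ⟨r, hr, rfl⟩ := hp
  obtain ⟨r', hr', rfl⟩ := hq
  rcases le_total r r' with h | h
  · exact Or.inl (key2 _ _ (key r r' hr.1 h hr'.2) hq')
  · exact Or.inr (key2 _ _ (key r' r hr'.1 h hr.2) hp')

/-- The spot `z` lies on the trail with chords `l`, extended by a line segment from its last node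
`m` to the point `y`. -/
def OnTrail (l : List T.Chord) (m : T.Node) (y : Plane) (z : T.Spot) : Prop :=
  (∃ c ∈ l, z.1 = c.1.1.1 ∧ z.2 ∈ seg c) ∨ z.1 = m.1.1 ∧ z.2 ∈ segment ℝ (T.pt m) y

lemma onTrail_cons {c : T.Chord} {l : List T.Chord} {m : T.Node} {y : Plane} {z : T.Spot} :
    OnTrail (c :: l) m y z ↔ (z.1 = c.1.1.1 ∧ z.2 ∈ seg c) ∨ OnTrail l m y z := by
  simp only [OnTrail, List.mem_cons, exists_eq_or_imp, or_assoc]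

lemma Trail.gdist_cons (hG : ∀ x y, G x y → T.Joined U x y) {c : T.Chord} {n' : T.Node}
    (hc : ValidChord c) (ht : Twin G c.2 n') (z : T.Spot) :
    T.gdist G (nspot c.1) z ≤ edist (T.pt c.1) (T.pt c.2) + T.gdist G (nspot n') z := by
  have h1 : T.gdist G (nspot c.1) (nspot c.2) ≤ edist (T.pt c.1) (T.pt c.2) := by
    rw [nspot, nspot, ← hc.1]
    exact gdist_le_edist (pt_mem_tri hc.2.1) (hc.1 ▸ pt_mem_tri hc.2.2)
  have h2 := gdist_triangle (G := G) (nspot c.1) (nspot c.2) z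
  have h3 := gdist_triangle (G := G) (nspot c.2) (nspot n') z
  rw [ht.gdist_eq_zero hG hc.2.2, zero_add] at h3
  exact h2.trans (add_le_add h1 h3)

lemma Trail.gdist_le (hG : ∀ x y, G x y → T.Joined U x y) {n m : T.Node} {l : List T.Chord}
    (h : Trail G n l m) (hn : Proper n) {y : Plane} (hy : y ∈ T.tri m.1.1) :
    T.gdist G (nspot n) (m.1.1, y) ≤ len l + edist (T.pt m) y := by
  induction l generalizing n with
  | nil =>
    obtain rfl : n = m := h
    simpa [nspot] using gdist_le_edist (pt_mem_tri hn) hy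
  | cons c l ih =>
    obtain ⟨rfl, h2, n', h3, h4⟩ := h
    rw [len_cons, add_assoc]
    exact (Trail.gdist_cons hG h2 h3 _).trans (add_le_add_right (ih h4 (h3.proper h2.2.2)) _)

/-- From a point of a chord to the next node. -/
lemma Trail.gdist_chord (hG : ∀ x y, G x y → T.Joined U x y) {c : T.Chord} {n' : T.Node}
    (hc : ValidChord c) (ht : Twin G c.2 n') {z : T.Spot} (hz : z.1 = c.1.1.1)
    (hz' : z.2 ∈ seg c) :
    T.gdist G (nspot c.1) z + T.gdist G z (nspot n') ≤ edist (T.pt c.1) (T.pt c.2) := by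
  obtain ⟨t, p⟩ := z
  obtain rfl : t = c.1.1.1 := hz
  have h1 := gdist_add_le_of_mem_segment (G := G) (pt_mem_tri hc.2.1) (hc.1 ▸ pt_mem_tri hc.2.2) hz'
  have h3 := gdist_triangle (G := G) (c.1.1.1, p) (nspot c.2) (nspot n')
  rw [ht.gdist_eq_zero hG hc.2.2, add_zero,
    show nspot c.2 = (c.1.1.1, T.pt c.2) by rw [nspot, hc.1]] at h3
  exact (add_le_add_right h3 _).trans h1

/-- A trail is at least as long as a shortest path through one of its points. -/
lemma Trail.gdist_add_le (hG : ∀ x y, G x y → T.Joined U x y) {n m : T.Node} {l : List T.Chord}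
    (h : Trail G n l m) (hn : Proper n) {y : Plane} (hy : y ∈ T.tri m.1.1) {z : T.Spot}
    (hz : OnTrail l m y z) :
    T.gdist G (nspot n) z + T.gdist G z (m.1.1, y) ≤ len l + edist (T.pt m) y := by
  induction l generalizing n with
  | nil =>
    obtain rfl : n = m := h
    obtain ⟨t, p⟩ := z
    rcases hz with ⟨c, hc, -⟩ | ⟨rfl, hz⟩
    · simp at hc
    · simpa [nspot] using gdist_add_le_of_mem_segment (pt_mem_tri hn) hy hz
  | cons c l ih =>
    obtain ⟨rfl, h2, n', h3, h4⟩ := h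
    have hn' := h3.proper h2.2.2
    rw [len_cons, add_assoc]
    rcases onTrail_cons.1 hz with hz | hz
    · have h5 := Trail.gdist_chord hG h2 h3 hz.1 hz.2
      calc _ ≤ T.gdist G (nspot c.1) z +
              (T.gdist G z (nspot n') + T.gdist G (nspot n') (m.1.1, y)) :=
            add_le_add_right (gdist_triangle _ _ _) _
        _ ≤ _ := by rw [← add_assoc]; exact add_le_add h5 (h4.gdist_le hG hn' hy)
    · calc _ ≤ (edist (T.pt c.1) (T.pt c.2) + T.gdist G (nspot n') z) + T.gdist G z (m.1.1, y) :=
            add_le_add_left (Trail.gdist_cons hG h2 h3 _) _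
        _ ≤ _ := by rw [add_assoc]; exact add_le_add_right (ih h4 hn' hz) _

/-- Two points on a trail are passed in one of the two possible orders. -/
lemma Trail.gdist_add_add_le (hG : ∀ x y, G x y → T.Joined U x y) {n m : T.Node}
    {l : List T.Chord} (h : Trail G n l m) (hn : Proper n) {y : Plane} (hy : y ∈ T.tri m.1.1)
    {z w : T.Spot} (hz : OnTrail l m y z) (hw : OnTrail l m y w) :
    T.gdist G (nspot n) z + T.gdist G z w + T.gdist G w (m.1.1, y) ≤ len l + edist (T.pt m) y ∨
    T.gdist G (nspot n) w + T.gdist G w z + T.gdist G z (m.1.1, y) ≤ len l + edist (T.pt m) y := by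
  induction l generalizing n with
  | nil =>
    obtain rfl : n = m := h
    obtain ⟨t, p⟩ := z
    obtain ⟨t', p'⟩ := w
    rcases hz with ⟨c, hc, -⟩ | ⟨rfl, hz⟩
    · simp at hc
    rcases hw with ⟨c, hc, -⟩ | ⟨rfl, hw⟩
    · simp at hc
    simpa [nspot] using gdist_add_add_le_of_mem_segment (G := G) (pt_mem_tri hn) hy hz hw
  | cons c l ih =>
    obtain ⟨rfl, h2, n', h3, h4⟩ := h
    have hn' := h3.proper h2.2.2
    rw [len_cons, add_assoc (edist _ _) (len l)]
    -- one point on the first chord, the other one further on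
    have mixed : ∀ z w : T.Spot, z.1 = c.1.1.1 ∧ z.2 ∈ seg c → OnTrail l m y w →
        T.gdist G (nspot c.1) z + T.gdist G z w + T.gdist G w (m.1.1, y)
          ≤ edist (T.pt c.1) (T.pt c.2) + (len l + edist (T.pt m) y) := by
      intro z w hz hw
      have h5 := Trail.gdist_chord hG h2 h3 hz.1 hz.2
      calc _ ≤ T.gdist G (nspot c.1) z + (T.gdist G z (nspot n') + T.gdist G (nspot n') w)
            + T.gdist G w (m.1.1, y) := by gcongr; exact gdist_triangle _ _ _
        _ = (T.gdist G (nspot c.1) z + T.gdist G z (nspot n')) +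
            (T.gdist G (nspot n') w + T.gdist G w (m.1.1, y)) := by ring
        _ ≤ _ := add_le_add h5 (h4.gdist_add_le hG hn' hy hw)
    rcases onTrail_cons.1 hz with hz | hz <;> rcases onTrail_cons.1 hw with hw | hw
    · obtain ⟨t, p⟩ := z
      obtain ⟨t', p'⟩ := w
      obtain ⟨rfl, hz⟩ := hz
      obtain ⟨rfl, hw⟩ := hw
      have h5 : ∀ q : Plane, T.gdist G (c.1.1.1, q) (m.1.1, y) ≤
          T.gdist G (c.1.1.1, q) (c.1.1.1, T.pt c.2) + (len l + edist (T.pt m) y) := by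
        intro q
        refine (gdist_triangle _ (nspot c.2) _).trans ?_
        have h6 := gdist_triangle (G := G) (nspot c.2) (nspot n') (m.1.1, y)
        rw [h3.gdist_eq_zero hG h2.2.2, zero_add] at h6
        have h7 := h6.trans (h4.gdist_le hG hn' hy)
        rw [show nspot c.2 = (c.1.1.1, T.pt c.2) by rw [nspot, h2.1]] at h7 ⊢
        exact add_le_add_right h7 _
      rcases gdist_add_add_le_of_mem_segment (G := G) (pt_mem_tri h2.2.1)
        (h2.1 ▸ pt_mem_tri h2.2.2) hz hw with h6 | h6
      · left
        refine (add_le_add_right (h5 p') _).trans ?_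
        rw [← add_assoc, ← add_assoc, ← add_assoc] at *
        exact add_le_add_left (add_le_add_left h6 _) _
      · right
        refine (add_le_add_right (h5 p) _).trans ?_
        rw [← add_assoc, ← add_assoc, ← add_assoc] at *
        exact add_le_add_left (add_le_add_left h6 _) _
    · exact Or.inl (mixed z w hz hw)
    · exact Or.inr (mixed w z hw hz)
    · refine (ih h4 hn' hz hw).imp (fun h5 => ?_) (fun h5 => ?_) <;>
      · refine le_trans ?_ (add_le_add_right h5 _)
        rw [← add_assoc, ← add_assoc]
        gcongr
        exact Trail.gdist_cons hG h2 h3 _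

end OnTrail

/-! ### Crossing chords in a triangle -/

section Crossing

variable {T}

lemma area_combo (a b p q : Plane) (u v : ℝ) (h : u + v = 1) :
    area a b (u • p + v • q) = u * area a b p + v * area a b q := by
  obtain rfl := eq_sub_of_add_eq h
  simp only [area, PiLp.add_apply, PiLp.smul_apply, smul_eq_mul]; ring

lemma exists_area_eq_zero {a b p q : Plane} (hp : area a b p ≤ 0) (hq : 0 ≤ area a b q) :
    ∃ z ∈ segment ℝ p q, area a b z = 0 := by
  rcases hq.eq_or_lt with h | h
  · exact ⟨q, right_mem_segment _ _ _, h.symm⟩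
  have hd : 0 < area a b q - area a b p := by linarith
  refine ⟨(area a b q / (area a b q - area a b p)) • p +
    (-area a b p / (area a b q - area a b p)) • q, ⟨_, _, by positivity, ?_, ?_, rfl⟩, ?_⟩
  · exact div_nonneg (by linarith) hd.le
  · field_simp; ring
  · rw [area_combo _ _ _ _ _ _ (by field_simp; ring)]
    field_simp; ring

/-- If the line through `a` and `b` meets a segment, then its end points are not strictly on the
same side. -/
lemma exists_area_eq_zero_of_bent {a b n m y z : Plane} (hy : y ∈ segment ℝ n m)
    (h : area a b y = 0) :
    (∃ q ∈ segment ℝ n z, area a b q = 0) ∨ ∃ q ∈ segment ℝ z m, area a b q = 0 := by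
  obtain ⟨u, v, hu, hv, huv, rfl⟩ := hy
  rw [area_combo _ _ _ _ _ _ huv] at h
  have key : ∀ p q : Plane, area a b p * area a b q ≤ 0 →
      ∃ z ∈ segment ℝ p q, area a b z = 0 := by
    intro p q hpq
    rcases le_total (area a b p) 0 with h1 | h1 <;> rcases le_total 0 (area a b q) with h2 | h2
    · exact exists_area_eq_zero h1 h2
    · rcases h1.eq_or_lt with h3 | h3
      · exact ⟨p, left_mem_segment _ _ _, h3⟩
      · have : area a b q = 0 := by nlinarith
        exact ⟨q, right_mem_segment _ _ _, this⟩
    · rcases h1.eq_or_lt with h3 | h3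
      · exact ⟨p, left_mem_segment _ _ _, h3.symm⟩
      · have : area a b q = 0 := by nlinarith
        exact ⟨q, right_mem_segment _ _ _, this⟩
    · obtain ⟨z, hz, hz'⟩ := exists_area_eq_zero h2 h1
      exact ⟨z, segment_symm ℝ q p ▸ hz, hz'⟩
  have hnm : area a b n * area a b m ≤ 0 := by
    rcases hu.eq_or_lt with h0 | h0
    · have h1 : v = 1 := by linarith
      rw [← h0, h1] at h
      have : area a b m = 0 := by linarith
      rw [this, mul_zero]
    · have h1 : u * (area a b n * area a b m) = - (v * area a b m ^ 2) := by
        linear_combination area a b m * h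
      nlinarith [sq_nonneg (area a b m), mul_nonneg hv (sq_nonneg (area a b m))]
  by_contra! hcon
  have h1 := mt (key n z) (by push Not; exact hcon.1)
  have h2 := mt (key z m) (by push Not; exact hcon.2)
  push Not at h1 h2
  nlinarith [mul_pos h1 h2, sq_nonneg (area a b z)]

lemma pt_eq (n : T.Node) :
    T.pt n = (1 - n.2) • T.pos n.1 + n.2 • T.pos (T.succ n.1) := by
  rw [pt, AffineMap.lineMap_apply_module]

/-- The area spanned by a point and two nodes on successive sides, in barycentric coordinates. -/
lemma area_nodes {n m : T.Node} (hm : m.1 = T.succ n.1) {u v w : ℝ} (h : u + v + w = 1) :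
    area (T.pt n) (T.pt m)
      (u • T.pos n.1 + v • T.pos (T.succ n.1) + w • T.pos (T.succ (T.succ n.1))) =
    area (T.pos n.1) (T.pos (T.succ n.1)) (T.pos (T.succ (T.succ n.1))) *
      (u * m.2 + w * (1 - n.2) - (1 - n.2) * m.2) := by
  obtain rfl : v = 1 - u - w := by linarith
  rw [pt_eq, pt_eq, hm]
  simp only [area, PiLp.add_apply, PiLp.smul_apply, smul_eq_mul]; ring

/-- A line through two nodes on successive sides meets the triangle in the segment between them. -/
lemma mem_segment_of_area_eq_zero {n m : T.Node} (hn : Proper n) (hm : Proper m)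
    (hnm : m.1 = T.succ n.1) {q : Plane} (hq : q ∈ T.tri n.1.1)
    (h : area (T.pt n) (T.pt m) q = 0) : q ∈ segment ℝ (T.pt n) (T.pt m) := by
  obtain ⟨u, v, w, hu, hv, hw, hs, rfl⟩ := (T.mem_tri_iff n.1 q).1 hq
  rw [area_nodes hnm hs, mul_eq_zero, or_iff_right (T.area_pos n.1).ne'] at h
  have h1 : 0 < 1 - n.2 := by linarith [hn.2]
  have h2 : 0 < m.2 := hm.1
  refine ⟨u / (1 - n.2), w / m.2, by positivity, by positivity, ?_, ?_⟩
  · field_simp; linarith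
  · have e : v = u / (1 - n.2) * n.2 + w / m.2 * (1 - m.2) := by
      have e1 : u / (1 - n.2) + w / m.2 = 1 := by field_simp; linarith
      have e2 : u / (1 - n.2) * (1 - n.2) = u := div_mul_cancel₀ _ h1.ne'
      have e3 : w / m.2 * m.2 = w := div_mul_cancel₀ _ h2.ne'
      linear_combination hs + e2 + e3 - e1
    have e2 : u / (1 - n.2) * (1 - n.2) = u := div_mul_cancel₀ _ h1.ne'
    have e3 : w / m.2 * m.2 = w := div_mul_cancel₀ _ h2.ne'
    rw [pt_eq, pt_eq, hnm]
    simp only [smul_add, smul_smul, e2, e3]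
    rw [e]
    module

/-- If a chord between different sides of a triangle meets the segment `n m`, then it meets any
path from `n` to `m` which consists of two segments in the triangle. -/
lemma bent_meets {c : T.Chord} (hc : ValidChord c) (hne : c.1.1 ≠ c.2.1) {n m y z : Plane}
    (hn : n ∈ T.tri c.1.1.1) (hm : m ∈ T.tri c.1.1.1) (hz : z ∈ T.tri c.1.1.1)
    (hy : y ∈ segment ℝ n m) (hy' : y ∈ seg c) :
    (seg c ∩ segment ℝ n z).Nonempty ∨ (seg c ∩ segment ℝ z m).Nonempty := by
  have hcv := T.convex_tri c.1.1.1
  have key : ∀ k k' : T.Node, Proper k → Proper k' → k'.1 = T.succ k.1 → k.1.1 = c.1.1.1 →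
      segment ℝ (T.pt k) (T.pt k') = seg c →
      (seg c ∩ segment ℝ n z).Nonempty ∨ (seg c ∩ segment ℝ z m).Nonempty := by
    intro k k' hk hk' hkk ht hs
    have h0 : area (T.pt k) (T.pt k') y = 0 := by
      rw [← hs] at hy'
      obtain ⟨u, v, -, -, huv, rfl⟩ := hy'
      rw [area_combo _ _ _ _ _ _ huv]
      simp only [area]; ring
    refine (exists_area_eq_zero_of_bent (z := z) hy h0).imp ?_ ?_
    · rintro ⟨q, hq, hq'⟩
      refine ⟨q, ?_, hq⟩
      rw [← hs]
      exact mem_segment_of_area_eq_zero hk hk' hkk (ht ▸ hcv.segment_subset hn hz hq) hq'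
    · rintro ⟨q, hq, hq'⟩
      refine ⟨q, ?_, hq⟩
      rw [← hs]
      exact mem_segment_of_area_eq_zero hk hk' hkk (ht ▸ hcv.segment_subset hz hm hq) hq'
  rcases T.eq_or_of_fst_eq (x := c.1.1) (y := c.2.1) hc.1.symm with h | h | h
  · exact absurd h.symm hne
  · exact key c.1 c.2 hc.2.1 hc.2.2 h rfl rfl
  · refine key c.2 c.1 hc.2.2 hc.2.1 ?_ hc.1.symm (segment_symm _ _ _)
    rw [h, T.succ_succ_succ]

lemma pt_mem_segment {x : T.Corner} {a b r : ℝ} (h1 : a ≤ r) (h2 : r ≤ b) :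
    T.pt (x, r) ∈ segment ℝ (T.pt (x, a)) (T.pt (x, b)) := by
  rcases h1.eq_or_lt with rfl | h1
  · exact left_mem_segment _ _ _
  have hd : 0 < b - a := by linarith
  refine ⟨(b - r) / (b - a), (r - a) / (b - a), div_nonneg (by linarith) hd.le,
    div_nonneg (by linarith) hd.le, by field_simp; ring, ?_⟩
  rw [pt_eq, pt_eq, pt_eq]
  simp only [smul_add, smul_smul]
  have e : (b - r) / (b - a) + (r - a) / (b - a) = 1 := by field_simp; ring
  have e' : (b - r) / (b - a) * a + (r - a) / (b - a) * b = r := by field_simp; ring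
  have e'' : (b - r) / (b - a) * (1 - a) + (r - a) / (b - a) * (1 - b) = 1 - r := by
    linear_combination e - e'
  rw [← e'']
  nth_rewrite 7 [← e']
  module

end Crossing

/-! ### Counting chord ends modulo two -/

section Colours

variable {T} {U : Set (Fin T.num)} {G : T.Corner → T.Corner → Prop}

/-- The sum of a function over all ends of chords, modulo two. -/
def cnt (l : List T.Chord) (φ : T.Node → ZMod 2) : ZMod 2 := (l.map fun c => φ c.1 + φ c.2).sum

@[simp] lemma cnt_nil (φ : T.Node → ZMod 2) : cnt [] φ = 0 := rfl

@[simp] lemma cnt_cons (c : T.Chord) (l : List T.Chord) (φ : T.Node → ZMod 2) :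
    cnt (c :: l) φ = φ c.1 + φ c.2 + cnt l φ := by simp [cnt]

@[simp] lemma cnt_append (l l' : List T.Chord) (φ : T.Node → ZMod 2) :
    cnt (l ++ l') φ = cnt l φ + cnt l' φ := by simp [cnt]

lemma cnt_add (l : List T.Chord) (φ ψ : T.Node → ZMod 2) :
    cnt l φ + cnt l ψ = cnt l fun n => φ n + ψ n := by
  induction l with
  | nil => simp
  | cons c l ih => rw [cnt_cons, cnt_cons, cnt_cons, ← ih]; ring

lemma cnt_eq_zero {l : List T.Chord} {φ : T.Node → ZMod 2} (h : ∀ c ∈ l, φ c.1 + φ c.2 = 0) :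
    cnt l φ = 0 := by
  induction l with
  | nil => rfl
  | cons c l ih =>
    rw [cnt_cons, h c (by simp), zero_add]
    exact ih fun c' hc' => h c' (by simp [hc'])

open Classical in
/-- The number of chord ends on a side, modulo two. -/
def ends (l : List T.Chord) (x : T.Corner) : ZMod 2 := cnt l fun n => if n.1 = x then 1 else 0

open Classical in
/-- The number of chord ends before the node `n` on its side, modulo two. -/
def before (l : List T.Chord) (n : T.Node) : ZMod 2 :=
  cnt l fun m => if m.1 = n.1 ∧ m.2 < n.2 then 1 else 0

/-- The colour of a node, if `κ` gives the colours at the corners: it changes at each end of a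
chord. -/
def col (κ : T.Corner → ZMod 2) (l : List T.Chord) (n : T.Node) : ZMod 2 := κ n.1 + before l n

lemma two_self (a : ZMod 2) : a + a = 0 := CharTwo.add_self_eq_zero a

/-- In the triangle `t`, no chord meets the segment from `p` to `q`. -/
def Avoids (l : List T.Chord) (t : Fin T.num) (p q : Plane) : Prop :=
  ∀ c ∈ l, c.1.1.1 = t → Disjoint (seg c) (segment ℝ p q)

lemma Avoids.symm {l : List T.Chord} {t : Fin T.num} {p q : Plane} (h : Avoids l t p q) :
    Avoids l t q p := fun c hc ht => segment_symm ℝ p q ▸ h c hc ht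

lemma ends_sum_triangle {l : List T.Chord} (hl : ∀ c ∈ l, ValidChord c) (x : T.Corner) :
    ends l x + ends l (T.succ x) + ends l (T.succ (T.succ x)) = 0 := by
  classical
  rw [ends, ends, ends, cnt_add, cnt_add]
  refine cnt_eq_zero fun c hc => ?_
  have hv := (hl c hc).1
  have key : ∀ n : T.Node, ((if n.1 = x then 1 else 0) + (if n.1 = T.succ x then 1 else 0) +
      (if n.1 = T.succ (T.succ x) then 1 else 0) : ZMod 2) = if n.1.1 = x.1 then 1 else 0 := by
    intro n
    by_cases hn : n.1.1 = x.1
    · rw [if_pos hn]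
      rcases T.eq_or_of_fst_eq hn with h | h | h
      · rw [if_pos h, if_neg (by rw [h]; exact (T.succ_ne x).symm),
          if_neg (by rw [h]; exact (T.succ_succ_ne x).symm)]; rfl
      · rw [if_neg (by rw [h]; exact T.succ_ne x), if_pos h,
          if_neg (by rw [h]; exact (T.succ_ne _).symm)]; rfl
      · rw [if_neg (by rw [h]; exact T.succ_succ_ne x), if_neg (by rw [h]; exact T.succ_ne _),
          if_pos h]; rfl
    · rw [if_neg hn, if_neg fun h => hn (by rw [h]), if_neg fun h => hn (by rw [h]; rfl),
        if_neg fun h => hn (by rw [h]; rfl)]; rfl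
  rw [key, key, hv, two_self]

lemma zmod_ite_add {P Q : Prop} [Decidable P] [Decidable Q] (h : (P ↔ Q)) :
    ((if P then 1 else 0) + (if Q then 1 else 0) : ZMod 2) = 0 := by
  by_cases hP : P
  · rw [if_pos hP, if_pos (h.1 hP)]; rfl
  · rw [if_neg hP, if_neg (mt h.2 hP)]; rfl

/-- Nodes on the same side that are connected by a path avoiding the chords have the same
colour. -/
lemma col_eq_of_same_side {l : List T.Chord} (hl : ∀ c ∈ l, ValidChord c) {κ : T.Corner → ZMod 2}
    {x : T.Corner} {a b : ℝ} (ha : a ∈ Ioo (0 : ℝ) 1) (hb : b ∈ Ioo (0 : ℝ) 1) (hab : a ≤ b)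
    {z : Plane} (hz : z ∈ T.tri x.1) (h1 : Avoids l x.1 (T.pt (x, a)) z)
    (h2 : Avoids l x.1 z (T.pt (x, b))) : col κ l (x, a) = col κ l (x, b) := by
  classical
  have hdiff : before l (x, a) + before l (x, b) = 0 := by
    rw [before, before, cnt_add]
    refine cnt_eq_zero fun c hc => ?_
    have hv := hl c hc
    have key : ∀ n : T.Node, ((if n.1 = x ∧ n.2 < a then 1 else 0) +
        (if n.1 = x ∧ n.2 < b then 1 else 0) : ZMod 2) =
          if n.1 = x ∧ a ≤ n.2 ∧ n.2 < b then 1 else 0 := by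
      intro n
      by_cases hx : n.1 = x
      · rcases lt_or_ge n.2 a with h | h
        · simp only [hx, h, h.trans_le hab, h.not_ge, true_and, false_and, if_true, if_false]; rfl
        · rcases lt_or_ge n.2 b with h' | h'
          · simp only [hx, h, h', h.not_gt, true_and, and_self, if_true, if_false]; rfl
          · simp only [hx, h, h'.not_gt, h.not_gt, and_false, if_false]; rfl
      · simp only [hx, false_and, if_false]; rfl
    change _ + _ + (_ + _) = _
    rw [key, key]
    apply zmod_ite_add
    -- a chord with exactly one end between the two nodes meets the path
    have main : ∀ c : T.Chord, ValidChord c → (c.1.1.1 = x.1 → Disjoint (seg c)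
        (segment ℝ (T.pt (x, a)) z) ∧ Disjoint (seg c) (segment ℝ z (T.pt (x, b)))) →
        c.1.1 = x ∧ a ≤ c.1.2 ∧ c.1.2 < b → c.2.1 = x ∧ a ≤ c.2.2 ∧ c.2.2 < b := by
      rintro ⟨⟨y, r⟩, ⟨y', r'⟩⟩ hv hd ⟨hx, hr, hr'⟩
      obtain rfl : y = x := hx
      obtain ⟨hd1, hd2⟩ := hd rfl
      simp only at hr hr'
      by_cases hx' : y' = y
      · subst hx'
        refine ⟨rfl, ?_⟩
        simp only [seg] at hd1 hd2 ⊢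
        by_contra hcon
        rcases lt_or_ge r' a with h | h
        · exact hd1.ne_of_mem (segment_symm ℝ (T.pt (y', r')) _ ▸ pt_mem_segment h.le hr)
            (left_mem_segment _ _ _) rfl
        · have h' : b ≤ r' := by by_contra h'; exact hcon ⟨h, not_le.1 h'⟩
          exact hd2.ne_of_mem (pt_mem_segment hr'.le h') (right_mem_segment _ _ _) rfl
      · exfalso
        rcases bent_meets hv (fun h => hx' h.symm) (pt_mem_tri (n := (y, a)) ha)
          (pt_mem_tri (n := (y, b)) hb) hz (pt_mem_segment hr hr'.le) (left_mem_segment _ _ _)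
          with h | h
        · exact h.ne_empty hd1.inter_eq
        · exact h.ne_empty hd2.inter_eq
    have hswap : seg (c.2, c.1) = seg c := segment_symm _ _ _
    refine ⟨main c hv fun ht => ⟨h1 c hc ht, h2 c hc ht⟩, main (c.2, c.1)
      ⟨hv.1.symm, hv.2.2, hv.2.1⟩ fun ht => ?_⟩
    rw [hswap]
    exact ⟨h1 c hc (hv.1.trans ht), h2 c hc (hv.1.trans ht)⟩
  rw [col, col, CharTwo.add_eq_zero.1 hdiff]

/-- Nodes on successive sides that are connected by a path avoiding the chords have the same
colour. -/
lemma col_eq_of_succ_side {l : List T.Chord} (hl : ∀ c ∈ l, ValidChord c) {κ : T.Corner → ZMod 2}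
    {n m : T.Node} (hn : Proper n) (hm : Proper m) (hnm : m.1 = T.succ n.1)
    (hκ : κ (T.succ n.1) = κ n.1 + ends l n.1)
    {z : Plane} (hz : z ∈ T.tri n.1.1) (h1 : Avoids l n.1.1 (T.pt n) z)
    (h2 : Avoids l n.1.1 z (T.pt m)) : col κ l n = col κ l m := by
  classical
  have hdiff : ends l n.1 + before l n + before l m = 0 := by
    rw [before, before, ends, cnt_add, cnt_add]
    refine cnt_eq_zero fun c hc => ?_
    have hv := hl c hc
    have hne := T.succ_ne n.1
    have key : ∀ k : T.Node, ((if k.1 = n.1 then 1 else 0) +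
        (if k.1 = n.1 ∧ k.2 < n.2 then 1 else 0) +
        (if k.1 = m.1 ∧ k.2 < m.2 then 1 else 0) : ZMod 2) =
          if (k.1 = n.1 ∧ n.2 ≤ k.2) ∨ (k.1 = m.1 ∧ k.2 < m.2) then 1 else 0 := by
      intro k
      by_cases hx : k.1 = n.1
      · have hx' : k.1 ≠ m.1 := by rw [hx, hnm]; exact hne.symm
        rcases lt_or_ge k.2 n.2 with h | h
        · rw [if_pos hx, if_pos ⟨hx, h⟩, if_neg fun h => hx' h.1, if_neg]
          · rfl
          · rintro (h' | h')
            · exact h.not_ge h'.2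
            · exact hx' h'.1
        · rw [if_pos hx, if_neg fun h' => h.not_gt h'.2, if_neg fun h => hx' h.1,
            if_pos (Or.inl ⟨hx, h⟩)]
          rfl
      · simp only [hx, false_and, if_false, zero_add, false_or]
    change _ + _ + (_ + _) = _
    rw [key, key]
    apply zmod_ite_add
    -- the chord ends on the boundary path between the nodes are on one side of the line `n m`,
    -- the other ones are on the other side
    have sgn : ∀ k : T.Node, Proper k → k.1.1 = n.1.1 →
        (((k.1 = n.1 ∧ n.2 ≤ k.2) ∨ (k.1 = m.1 ∧ k.2 < m.2)) →
          area (T.pt n) (T.pt m) (T.pt k) ≤ 0) ∧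
        (¬((k.1 = n.1 ∧ n.2 ≤ k.2) ∨ (k.1 = m.1 ∧ k.2 < m.2)) →
          0 ≤ area (T.pt n) (T.pt m) (T.pt k)) := by
      rintro ⟨x, r⟩ ⟨hr0, hr1⟩ ht
      obtain ⟨hn0, hn1⟩ := hn
      obtain ⟨hm0, hm1⟩ := hm
      simp only at hr0 hr1 ht ⊢
      have hA := T.area_pos n.1
      rcases T.eq_or_of_fst_eq ht with rfl | rfl | rfl
      · have e : T.pt (n.1, r) = (1 - r) • T.pos n.1 + r • T.pos (T.succ n.1) +
          (0 : ℝ) • T.pos (T.succ (T.succ n.1)) := by rw [pt_eq]; simp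
        rw [e, area_nodes hnm (by ring)]
        have hne' : n.1 ≠ m.1 := by rw [hnm]; exact hne.symm
        constructor
        · rintro (⟨-, h⟩ | ⟨h, -⟩)
          · apply mul_nonpos_of_nonneg_of_nonpos hA.le
            nlinarith
          · exact absurd h hne'
        · intro h
          have h' : r < n.2 := by by_contra h'; exact h (Or.inl ⟨rfl, not_lt.1 h'⟩)
          apply mul_nonneg hA.le
          nlinarith
      · have e : T.pt (T.succ n.1, r) = (0 : ℝ) • T.pos n.1 + (1 - r) • T.pos (T.succ n.1) +
          r • T.pos (T.succ (T.succ n.1)) := by rw [pt_eq]; simp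
        rw [e, area_nodes hnm (by ring)]
        constructor
        · rintro (⟨h, -⟩ | ⟨-, h⟩)
          · exact absurd h hne
          · apply mul_nonpos_of_nonneg_of_nonpos hA.le
            nlinarith
        · intro h
          have h' : m.2 ≤ r := by by_contra h'; exact h (Or.inr ⟨hnm.symm, not_le.1 h'⟩)
          apply mul_nonneg hA.le
          nlinarith
      · have e : T.pt (T.succ (T.succ n.1), r) = r • T.pos n.1 + (0 : ℝ) • T.pos (T.succ n.1) +
          (1 - r) • T.pos (T.succ (T.succ n.1)) := by
            rw [pt_eq, T.succ_succ_succ]; simp only [zero_smul, add_zero]; rw [add_comm]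
        rw [e, area_nodes hnm (by ring)]
        refine ⟨?_, fun _ => mul_nonneg hA.le ?_⟩
        · rintro (⟨h, -⟩ | ⟨h, -⟩)
          · exact absurd h (T.succ_succ_ne _)
          · exact absurd (h.trans hnm) (T.succ_ne _)
        · have i1 : 0 ≤ r * m.2 * n.2 := by positivity
          have i2 : 0 ≤ (1 - r) * (1 - n.2) * (1 - m.2) :=
            mul_nonneg (mul_nonneg (by linarith) (by linarith)) (by linarith)
          nlinarith
    -- a chord with exactly one end on the boundary path meets every path between the nodes
    have main : ∀ c : T.Chord, ValidChord c → (c.1.1.1 = n.1.1 → Disjoint (seg c)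
        (segment ℝ (T.pt n) z) ∧ Disjoint (seg c) (segment ℝ z (T.pt m))) →
        (c.1.1 = n.1 ∧ n.2 ≤ c.1.2 ∨ c.1.1 = m.1 ∧ c.1.2 < m.2) →
        (c.2.1 = n.1 ∧ n.2 ≤ c.2.2 ∨ c.2.1 = m.1 ∧ c.2.2 < m.2) := by
      intro c hv hd h
      have ht : c.1.1.1 = n.1.1 := by
        rcases h with h | h
        · rw [h.1]
        · rw [h.1, hnm]; rfl
      obtain ⟨hd1, hd2⟩ := hd ht
      by_contra hcon
      have hmt : m.1.1 = n.1.1 := by rw [hnm]; rfl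
      by_cases hs : c.1.1 = c.2.1
      · rcases h with h | h
        · have hr : c.2.2 ≤ n.2 := by
            by_contra hr; exact hcon (Or.inl ⟨hs ▸ h.1, (not_le.1 hr).le⟩)
          have : T.pt n ∈ seg c := by
            have := pt_mem_segment (T := T) (x := n.1) hr h.2
            rw [show (n.1, c.2.2) = c.2 from Prod.ext (h.1.symm.trans hs) rfl,
              show (n.1, c.1.2) = c.1 from Prod.ext h.1.symm rfl, segment_symm] at this
            exact this
          exact hd1.ne_of_mem this (left_mem_segment _ _ _) rfl
        · have hr : m.2 ≤ c.2.2 := by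
            by_contra hr; exact hcon (Or.inr ⟨hs ▸ h.1, not_le.1 hr⟩)
          have : T.pt m ∈ seg c := by
            have := pt_mem_segment (T := T) (x := m.1) h.2.le hr
            rw [show (m.1, c.2.2) = c.2 from Prod.ext (h.1.symm.trans hs) rfl,
              show (m.1, c.1.2) = c.1 from Prod.ext h.1.symm rfl] at this
            exact this
          exact hd2.ne_of_mem this (right_mem_segment _ _ _) rfl
      · obtain ⟨y, hy, hy0⟩ := exists_area_eq_zero ((sgn c.1 hv.2.1 ht).1 h)
          ((sgn c.2 hv.2.2 (hv.1.symm.trans ht)).2 hcon)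
        have hy' := mem_segment_of_area_eq_zero hn hm hnm (ht ▸ seg_subset_tri hv hy) hy0
        rcases bent_meets hv hs (ht ▸ pt_mem_tri hn) (ht ▸ hmt ▸ pt_mem_tri hm)
          (ht ▸ hz) hy' hy with h | h
        · exact h.ne_empty hd1.inter_eq
        · exact h.ne_empty hd2.inter_eq
    have hswap : seg (c.2, c.1) = seg c := segment_symm _ _ _
    refine ⟨main c hv fun ht => ⟨h1 c hc ht, h2 c hc ht⟩, main (c.2, c.1)
      ⟨hv.1.symm, hv.2.2, hv.2.1⟩ fun ht => ?_⟩
    rw [hswap]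
    exact ⟨h1 c hc (hv.1.trans ht), h2 c hc (hv.1.trans ht)⟩
  have h3 : ends l n.1 + before l n = before l m := CharTwo.add_eq_zero.1 hdiff
  rw [col, col, hnm, hκ, ← h3]
  linear_combination -two_self (ends l n.1)

/-- Nodes of one triangle that are connected by a path avoiding the chords have the same
colour. -/
lemma col_eq_of_avoids {l : List T.Chord} (hl : ∀ c ∈ l, ValidChord c) {κ : T.Corner → ZMod 2}
    {n m : T.Node} (hn : Proper n) (hm : Proper m) (hnm : m.1.1 = n.1.1)
    (hκ : ∀ x : T.Corner, x.1 = n.1.1 → κ (T.succ x) = κ x + ends l x)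
    {z : Plane} (hz : z ∈ T.tri n.1.1) (h1 : Avoids l n.1.1 (T.pt n) z)
    (h2 : Avoids l n.1.1 z (T.pt m)) : col κ l n = col κ l m := by
  rcases T.eq_or_of_fst_eq hnm with h | h | h
  · obtain ⟨x, a⟩ := n
    obtain ⟨y, b⟩ := m
    obtain rfl : y = x := h
    rcases le_total a b with hab | hab
    · exact col_eq_of_same_side hl hn hm hab hz h1 h2
    · exact (col_eq_of_same_side hl hm hn hab hz h2.symm h1.symm).symm
  · exact col_eq_of_succ_side hl hn hm h (hκ _ rfl) hz h1 h2
  · have h' : n.1 = T.succ m.1 := by rw [h, T.succ_succ_succ]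
    exact (col_eq_of_succ_side hl hm hn h' (hκ _ hnm) (hnm ▸ hz) (hnm ▸ h2.symm)
      (hnm ▸ h1.symm)).symm

end Colours

/-! ### Paths and the colours they define -/

section Paths

variable {T} {U : Set (Fin T.num)} {G : T.Corner → T.Corner → Prop}

/-- The chords in `R` form a path from the node `n` to the node `e`. -/
def IsPath (G : T.Corner → T.Corner → Prop) (n : T.Node) (R : List T.Chord) (e : T.Node) : Prop :=
  ∃ l m, Trail G n l m ∧ ValidChord (m, e) ∧ R = l ++ [(m, e)]

lemma IsPath.valid {n e : T.Node} {R : List T.Chord} (h : IsPath G n R e) :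
    ∀ c ∈ R, ValidChord c := by
  obtain ⟨l, m, h1, h2, rfl⟩ := h
  intro c hc
  rcases List.mem_append.1 hc with hc | hc
  · exact h1.valid c hc
  · rw [List.mem_singleton.1 hc]; exact h2

lemma Trail.exists_first {n m e : T.Node} {l : List T.Chord} (h : Trail G n l m) :
    ∃ c ∈ l ++ [(m, e)], c.1 = n := by
  cases l with
  | nil => exact ⟨(m, e), by simp, h.symm⟩
  | cons c l => exact ⟨c, by simp, h.1⟩

lemma IsPath.proper {n e : T.Node} {R : List T.Chord} (h : IsPath G n R e) : Proper n := by
  have hv := h.valid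
  obtain ⟨l, m, h1, h2, rfl⟩ := h
  obtain ⟨c, hc, rfl⟩ := h1.exists_first (e := e)
  exact (hv c hc).2.1

/-- In a sum over the chord ends of a path, the nodes at which it changes triangles contribute
in pairs. -/
lemma Trail.cnt_eq {n m e : T.Node} {l : List T.Chord} (h : Trail G n l m) {φ : T.Node → ZMod 2}
    (hφ : ∀ k k', (∃ c ∈ l ++ [(m, e)], c.2 = k) → (∃ c ∈ l ++ [(m, e)], c.1 = k') →
      Twin G k k' → φ k + φ k' = 0) : cnt (l ++ [(m, e)]) φ = φ n + φ e := by
  induction l generalizing n with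
  | nil =>
    obtain rfl : n = m := h
    simp
  | cons c l ih =>
    obtain ⟨rfl, h2, n', h3, h4⟩ := h
    have hc : φ c.2 + φ n' = 0 := by
      refine hφ _ _ ⟨c, by simp, rfl⟩ ?_ h3
      obtain ⟨c', hc', he⟩ := h4.exists_first (e := e)
      exact ⟨c', by simp only [List.cons_append, List.mem_cons]; exact Or.inr hc', he⟩
    have := ih h4 fun k k' ⟨c1, hc1, e1⟩ ⟨c2, hc2, e2⟩ ht =>
      hφ k k' ⟨c1, List.mem_cons_of_mem _ hc1, e1⟩ ⟨c2, List.mem_cons_of_mem _ hc2, e2⟩ ht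
    rw [List.cons_append, cnt_cons, this]
    linear_combination hc

lemma IsPath.cnt_eq {n e : T.Node} {R : List T.Chord} (h : IsPath G n R e) {φ : T.Node → ZMod 2}
    (hφ : ∀ k k', (∃ c ∈ R, c.2 = k) → (∃ c ∈ R, c.1 = k') → Twin G k k' → φ k + φ k' = 0) :
    cnt R φ = φ n + φ e := by
  obtain ⟨l, m, h1, h2, rfl⟩ := h
  exact h1.cnt_eq hφ

/-- The chords end at the same points of the two sides `u` and `v` of an edge, up to the
parity. -/
def Balanced (l : List T.Chord) (u v : T.Corner) : Prop :=
  ends l u + ends l v = 0 ∧ ∀ r, (∀ c ∈ l, c.1 ≠ (u, r) ∧ c.2 ≠ (u, r)) →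
    before l (u, r) + before l (v, 1 - r) = ends l u

lemma balanced_of_cnt {l : List T.Chord} {u v : T.Corner} (huv : T.Joined U u v)
    (hG : ∀ x y, G x y → T.Joined U x y)
    (h : ∀ φ : T.Node → ZMod 2, (∀ k : T.Node, k.1 ≠ u → k.1 ≠ v → φ k = 0) →
      (∀ k k', (∃ c ∈ l, c.2 = k) → (∃ c ∈ l, c.1 = k') → Twin G k k' → φ k + φ k' = 0) →
      cnt l φ = 0) : Balanced l u v := by
  classical
  have hne := huv.ne
  constructor
  · rw [ends, ends, cnt_add]
    refine h _ (fun k h1 h2 => by rw [if_neg h1, if_neg h2]; rfl) ?_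
    rintro k k' - - ⟨ht, -⟩
    have ht := hG _ _ ht
    by_cases h1 : k.1 = u
    · rw [h1] at ht
      have h2 := ht.unique huv
      rw [h1, h2, if_pos rfl, if_pos rfl, if_neg hne, if_neg hne.symm]; rfl
    · by_cases h2 : k.1 = v
      · rw [h2] at ht
        have h3 := ht.unique huv.symm
        rw [h2, h3, if_pos rfl, if_pos rfl, if_neg hne, if_neg hne.symm]; rfl
      · rw [if_neg h1, if_neg h2, if_neg, if_neg]
        · rfl
        · intro h3; rw [h3] at ht; exact h1 (ht.symm.unique huv.symm)
        · intro h3; rw [h3] at ht; exact h2 (ht.symm.unique huv)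
  · intro r hr
    have key : before l (u, r) + before l (v, 1 - r) + ends l u = 0 := by
      rw [before, before, ends, cnt_add, cnt_add]
      refine h _ (fun k h1 h2 => ?_) ?_
      · rw [if_neg fun h => h1 h.1, if_neg fun h => h2 h.1, if_neg h1]; rfl
      rintro ⟨x, a⟩ ⟨y, b⟩ ⟨c, hc, hk⟩ ⟨c', hc', hk'⟩ ⟨ht, hb⟩
      have ht := hG _ _ ht
      obtain rfl : b = 1 - a := hb
      simp only
      simp only at ht
      by_cases h1 : x = u
      · subst h1
        obtain rfl := ht.unique huv
        have har : a ≠ r := fun h => (hr c hc).2 (hk.trans (by rw [h]))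
        rcases lt_or_gt_of_ne har with h | h
        · have h' : ¬ (1 - a < 1 - r) := by linarith
          simp only [h, h', hne, hne.symm, if_true, if_false, and_true, and_false, false_and]; rfl
        · have h' : (1 - a < 1 - r) := by linarith
          simp only [h.not_gt, h', hne, hne.symm, if_true, if_false, and_true, and_false,
            false_and]; rfl
      · by_cases h2 : x = v
        · subst h2
          obtain rfl := ht.unique huv.symm
          have har : 1 - a ≠ r := fun h => (hr c' hc').1 (hk'.trans (by rw [h]))
          rcases lt_or_gt_of_ne har with h | h
          · have h' : ¬ (a < 1 - r) := by linarith
            simp only [h, h', hne, hne.symm, if_true, if_false, and_true, and_false, false_and]; rfl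
          · have h' : (a < 1 - r) := by linarith
            simp only [h.not_gt, h', hne, hne.symm, if_true, if_false, and_true, and_false,
              false_and]; rfl
        · have h3 : y ≠ v := by
            intro h3; rw [h3] at ht; exact h1 (ht.symm.unique huv.symm)
          have h4 : y ≠ u := by
            intro h3; rw [h3] at ht; exact h2 (ht.symm.unique huv)
          simp only [h1, h2, h3, h4, if_false, false_and]; rfl
    exact CharTwo.add_eq_zero.1 key

/-- A path that neither starts nor ends at an edge has the same ends on both sides of it. -/
lemma IsPath.balanced (hG : ∀ x y, G x y → T.Joined U x y) {n e : T.Node} {R : List T.Chord}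
    (h : IsPath G n R e) {u v : T.Corner} (huv : T.Joined U u v) (hnu : n.1 ≠ u) (hnv : n.1 ≠ v)
    (heu : e.1 ≠ u) (hev : e.1 ≠ v) : Balanced R u v :=
  balanced_of_cnt huv hG fun φ h1 h2 => by
    rw [h.cnt_eq h2, h1 n hnu hnv, h1 e heu hev, zero_add]

/-- For two paths with a common start, the chord ends there cancel, so that the edge may be the
one at which they start. -/
lemma IsPath.balanced_append (hG : ∀ x y, G x y → T.Joined U x y) {n e e' : T.Node}
    {R R' : List T.Chord} (h : IsPath G n R e) (h' : IsPath G n R' e') {u v : T.Corner}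
    (huv : T.Joined U u v) (heu : e.1 ≠ u) (hev : e.1 ≠ v) (heu' : e'.1 ≠ u) (hev' : e'.1 ≠ v) :
    Balanced (R ++ R') u v :=
  balanced_of_cnt huv hG fun φ h1 h2 => by
    rw [cnt_append, h.cnt_eq fun k k' ⟨c, hc, e⟩ ⟨c', hc', e'⟩ =>
        h2 k k' ⟨c, by simp [hc], e⟩ ⟨c', by simp [hc'], e'⟩,
      h'.cnt_eq fun k k' ⟨c, hc, e⟩ ⟨c', hc', e'⟩ =>
        h2 k k' ⟨c, by simp [hc], e⟩ ⟨c', by simp [hc'], e'⟩,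
      h1 e heu hev, h1 e' heu' hev', add_zero, two_self]

/-- Potentials on the triangles in `K` for the chord ends: the colours at the corners, which
fit together along the edges that `G` joins. -/
structure IsPot (G : T.Corner → T.Corner → Prop) (K : Set (Fin T.num)) (l : List T.Chord)
    (κ : T.Corner → ZMod 2) : Prop where
  succ_eq : ∀ x : T.Corner, x.1 ∈ K → κ (T.succ x) = κ x + ends l x
  twin_eq : ∀ x y : T.Corner, x.1 ∈ K → G x y → κ y = κ x + ends l x

/-- The colour does not change along a trail that avoids the chords. -/
lemma Trail.col_eq {K : Set (Fin T.num)} (hK : ∀ x y, G x y → x.1 ∈ K → y.1 ∈ K)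
    {l : List T.Chord} (hl : ∀ c ∈ l, ValidChord c) {κ : T.Corner → ZMod 2}
    (hκ : IsPot G K l κ) (hb : ∀ u v, G u v → Balanced l u v) {n m : T.Node} {la : List T.Chord}
    (h : Trail G n la m) (hn : n.1.1 ∈ K)
    (hav : ∀ c ∈ la, Avoids l c.1.1.1 (T.pt c.1) (T.pt c.2)) :
    col κ l n = col κ l m ∧ m.1.1 ∈ K := by
  induction la generalizing n with
  | nil =>
    obtain rfl : n = m := h
    exact ⟨rfl, hn⟩
  | cons c la ih =>
    obtain ⟨rfl, h2, n', h3, h4⟩ := h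
    have hK' : n'.1.1 ∈ K := hK _ _ h3.1 (h2.1 ▸ hn)
    have hc := hav c (by simp)
    refine (ih h4 hK' fun c' hc' => hav c' (by simp [hc'])).imp_left fun h => Eq.trans ?_ h
    have h5 : col κ l c.1 = col κ l c.2 := by
      refine col_eq_of_avoids hl h2.2.1 h2.2.2 h2.1.symm (fun x hx => hκ.succ_eq x (hx ▸ hn))
        (pt_mem_tri h2.2.1) (fun c' hc' ht => (hc c' hc' ht).mono_right ?_) hc
      rw [segment_same]
      exact singleton_subset_iff.2 (left_mem_segment _ _ _)
    have h6 : ∀ c' ∈ l, c'.1 ≠ (c.2.1, c.2.2) ∧ c'.2 ≠ (c.2.1, c.2.2) := by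
      intro c' hc'
      constructor
      · intro he
        have he : c'.1 = c.2 := he
        refine (hc c' hc' (by rw [he, h2.1])).ne_of_mem (left_mem_segment _ _ _)
          (right_mem_segment _ _ _) (by rw [he])
      · intro he
        have he : c'.2 = c.2 := he
        refine (hc c' hc' (by rw [(hl c' hc').1, he, h2.1])).ne_of_mem (right_mem_segment _ _ _)
          (right_mem_segment _ _ _) (by rw [he])
    have h7 := (hb _ _ h3.1).2 c.2.2 h6
    rw [h5, col, col, hκ.twin_eq _ _ (h2.1 ▸ hn) h3.1]
    obtain ⟨y, b⟩ := n'
    obtain rfl : b = 1 - c.2.2 := h3.2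
    linear_combination -h7 + two_self (before l c.2) - two_self (ends l c.2.1)

end Paths

/-! ### The development of the boundary cycles -/

section Development

variable {T} {U : Set (Fin T.num)} {o : T.Corner}

/-- All sides on the boundary cycles. -/
def cycleSides (M : Multiset (List T.Corner)) : Multiset T.Corner :=
  (M.map fun L => (L : Multiset T.Corner)).sum

@[simp] lemma cycleSides_cons (L : List T.Corner) (M : Multiset (List T.Corner)) :
    cycleSides (L ::ₘ M) = (L : Multiset T.Corner) + cycleSides M := by simp [cycleSides]

lemma mem_cycleSides {M : Multiset (List T.Corner)} {x : T.Corner} :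
    x ∈ cycleSides M ↔ ∃ L ∈ M, x ∈ L := by
  induction M using Multiset.induction with
  | empty => simp [cycleSides]
  | cons L M ih => simp [ih]

@[simp] lemma cycleSides_singleton (L : List T.Corner) :
    cycleSides {L} = (L : Multiset T.Corner) := by simp [cycleSides]

lemma coe_append_cons (l₁ l₂ : List T.Corner) (x : T.Corner) :
    ((l₁ ++ x :: l₂ : List T.Corner) : Multiset T.Corner) =
      x ::ₘ ((l₁ : Multiset T.Corner) + (l₂ : Multiset T.Corner)) := by
  rw [← Multiset.coe_add, ← Multiset.cons_coe, Multiset.add_cons]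

/-- Basic properties of a stage of the development. -/
structure DevInv (U : Set (Fin T.num)) (o : T.Corner) (E : Set (Fin T.num)) (S : Set T.Corner)
    (M : Multiset (List T.Corner)) : Prop where
  start_mem : o.1 ∈ E
  passed : ∀ x ∈ S, x.1 ∈ E ∧ ∃ y ∈ S, T.Joined U x y
  side_mem : ∀ x : T.Corner, x.1 ∈ E → x ∈ S ∨ x ∈ cycleSides M
  cycle_mem : ∀ x ∈ cycleSides M, x.1 ∈ E ∧ x ∉ S
  nodup : (cycleSides M).Nodup
  connected : ∀ t ∈ E, ∀ p ∈ T.tri t, T.gdist (T.Passed U S) (T.spot o) (t, p) ≠ ⊤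

lemma gdist_passed_anti {S S' : Set T.Corner} (h : S ⊆ S') (a b : T.Spot) :
    T.gdist (T.Passed U S') a b ≤ T.gdist (T.Passed U S) a b :=
  gdist_mono_on (K := univ) (fun _ _ hp _ => ⟨⟨hp.1, h hp.2.1, h hp.2.2⟩, mem_univ _⟩) (mem_univ _)

lemma edist_plane_ne_top (p q : Plane) : edist p q ≠ ⊤ := edist_ne_top _ _

lemma Develops.inv {E : Set (Fin T.num)} {S : Set T.Corner} {M : Multiset (List T.Corner)}
    (h : T.Develops U o E S M) : DevInv U o E S M := by
  induction h with
  | start =>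
    refine ⟨rfl, by simp, fun x hx => Or.inr ?_, fun x hx => ⟨?_, by simp⟩, ?_, ?_⟩
    · obtain ⟨t, i⟩ := x
      obtain rfl : t = o.1 := hx
      rw [cycleSides_singleton]
      fin_cases i <;> simp
    · rw [cycleSides_singleton] at hx
      rcases (by simpa using hx : x = (o.1, 0) ∨ x = (o.1, 1) ∨ x = (o.1, 2)) with
        rfl | rfl | rfl <;> rfl
    · simp
    · rintro t rfl p hp
      exact ((gdist_le_edist (T.pos_mem_tri o) hp).trans_lt (edist_plane_ne_top _ _).lt_top).ne
  | @enter E S M l₁ l₂ x y _ hj hy ih =>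
    have hE : E ⊆ insert y.1 E := subset_insert _ _
    have hS : S ⊆ insert x (insert y S) := (subset_insert _ _).trans (subset_insert _ _)
    have hold : cycleSides ((l₁ ++ x :: l₂) ::ₘ M) =
        x ::ₘ ((l₁ : Multiset T.Corner) + (l₂ : Multiset T.Corner) + cycleSides M) := by
      rw [cycleSides_cons, coe_append_cons, Multiset.cons_add]
    have hnew : cycleSides ((l₁ ++ T.succ y :: T.succ (T.succ y) :: l₂) ::ₘ M) =
        T.succ y ::ₘ T.succ (T.succ y) ::ₘ
          ((l₁ : Multiset T.Corner) + (l₂ : Multiset T.Corner) + cycleSides M) := by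
      rw [cycleSides_cons, coe_append_cons, ← Multiset.cons_coe, Multiset.add_cons,
        Multiset.cons_add, Multiset.cons_add]
    set rest := (l₁ : Multiset T.Corner) + (l₂ : Multiset T.Corner) + cycleSides M
    have hrest : ∀ z ∈ rest, z.1 ∈ E ∧ z ∉ S ∧ z ≠ x := fun z hz => by
      have hz' : z ∈ cycleSides ((l₁ ++ x :: l₂) ::ₘ M) := by
        rw [hold]; exact Multiset.mem_cons_of_mem hz
      refine ⟨(ih.cycle_mem z hz').1, (ih.cycle_mem z hz').2, ?_⟩
      rintro rfl
      have := ih.nodup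
      rw [hold, Multiset.nodup_cons] at this
      exact this.1 hz
    have hxE : x.1 ∈ E := (ih.cycle_mem x (by rw [hold]; exact Multiset.mem_cons_self _ _)).1
    refine ⟨hE ih.start_mem, ?_, ?_, ?_, ?_, ?_⟩
    · rintro z (rfl | rfl | hz)
      · exact ⟨hE hxE, y, by simp, hj⟩
      · exact ⟨mem_insert _ _, x, by simp, hj.symm⟩
      · obtain ⟨h1, w, hw, h2⟩ := ih.passed z hz
        exact ⟨hE h1, w, hS hw, h2⟩
    · rintro z (hz | hz)
      · rcases T.eq_or_of_fst_eq hz with h | h | h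
        · left; rw [h]; simp
        · right; rw [hnew, h]; simp
        · right; rw [hnew, h]; simp
      · rcases ih.side_mem z hz with h | h
        · exact Or.inl (hS h)
        · rw [hold, Multiset.mem_cons] at h
          rcases h with rfl | h
          · left; simp
          · right; rw [hnew]; exact Multiset.mem_cons_of_mem (Multiset.mem_cons_of_mem h)
    · have hyS : ∀ z : T.Corner, z.1 = y.1 → z ≠ y → z ∉ insert x (insert y S) := by
        rintro z hz hzy (rfl | rfl | h)
        · exact hy (hz ▸ hxE)
        · exact hzy rfl
        · exact hy (hz ▸ (ih.passed z h).1)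
      intro z hz
      rw [hnew, Multiset.mem_cons, Multiset.mem_cons] at hz
      rcases hz with rfl | rfl | hz
      · exact ⟨mem_insert _ _, hyS _ rfl (T.succ_ne y)⟩
      · exact ⟨mem_insert _ _, hyS _ rfl (T.succ_succ_ne y)⟩
      · obtain ⟨h1, h2, h3⟩ := hrest z hz
        refine ⟨hE h1, ?_⟩
        rintro (rfl | rfl | h)
        · exact h3 rfl
        · exact hy h1
        · exact h2 h
    · have hnd := ih.nodup
      rw [hold, Multiset.nodup_cons] at hnd
      rw [hnew, Multiset.nodup_cons, Multiset.nodup_cons, Multiset.mem_cons]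
      refine ⟨?_, fun h => hy (hrest _ h).1, hnd.2⟩
      rintro (h | h)
      · exact T.succ_ne _ h.symm
      · exact hy (hrest _ h).1
    · have hpass : T.Passed U (insert x (insert y S)) x y := ⟨hj, by simp, by simp⟩
      rintro t (rfl | ht) p hp
      · have h1 := ih.connected x.1 hxE _ (T.pos_mem_tri x)
        have h2 := gdist_passed_anti (U := U) hS (T.spot o) (x.1, T.pos x)
        have h3 := gdist_cross hpass (left_mem_segment ℝ (T.pos x) (T.pos (T.succ x)))
        have h4 : T.pos x ∈ T.tri y.1 := T.side_subset_tri y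
          (hj.mem_side (left_mem_segment ℝ _ _))
        have h5 := gdist_le_edist (G := T.Passed U (insert x (insert y S))) h4 hp
        refine ne_top_of_le_ne_top ?_ ((gdist_triangle _ (x.1, T.pos x) _).trans
          (add_le_add h2 ((gdist_triangle _ (y.1, T.pos x) _).trans (add_le_add h3.le h5))))
        simp [h1]
      · exact ne_top_of_le_ne_top (ih.connected t ht p hp) (gdist_passed_anti hS _ _)
  | @split E S M l₁ l₂ l₃ x y _ hj ih =>
    have hS : S ⊆ insert x (insert y S) := (subset_insert _ _).trans (subset_insert _ _)
    have hold : cycleSides ((l₁ ++ x :: (l₂ ++ y :: l₃)) ::ₘ M) =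
        x ::ₘ y ::ₘ ((l₁ : Multiset T.Corner) + (l₃ : Multiset T.Corner) +
          ((l₂ : Multiset T.Corner) + cycleSides M)) := by
      rw [cycleSides_cons, coe_append_cons, coe_append_cons, Multiset.add_cons, Multiset.cons_add,
        Multiset.cons_add]
      congr 2
      abel
    have hnew : cycleSides ((l₁ ++ l₃) ::ₘ l₂ ::ₘ M) =
        (l₁ : Multiset T.Corner) + (l₃ : Multiset T.Corner) +
          ((l₂ : Multiset T.Corner) + cycleSides M) := by
      rw [cycleSides_cons, cycleSides_cons, Multiset.coe_add]
    rw [← hnew] at hold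
    have hnd := ih.nodup
    rw [hold, Multiset.nodup_cons, Multiset.nodup_cons] at hnd
    have hcyc := ih.cycle_mem
    rw [hold] at hcyc
    have hside := ih.side_mem
    rw [hold] at hside
    refine ⟨ih.start_mem, ?_, ?_, ?_, hnd.2.2, ?_⟩
    · rintro z (rfl | rfl | hz)
      · exact ⟨(hcyc z (by simp)).1, y, by simp, hj⟩
      · exact ⟨(hcyc z (by simp)).1, x, by simp, hj.symm⟩
      · obtain ⟨h1, w, hw, h2⟩ := ih.passed z hz
        exact ⟨h1, w, hS hw, h2⟩
    · intro z hz
      rcases hside z hz with h | h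
      · exact Or.inl (hS h)
      · rcases Multiset.mem_cons.1 h with rfl | h
        · left; simp
        · rcases Multiset.mem_cons.1 h with rfl | h
          · left; simp
          · exact Or.inr h
    · intro z hz
      have hz' := hcyc z (Multiset.mem_cons_of_mem (Multiset.mem_cons_of_mem hz))
      refine ⟨hz'.1, ?_⟩
      rintro (rfl | rfl | h)
      · exact hnd.1 (Multiset.mem_cons_of_mem hz)
      · exact hnd.2.1 hz
      · exact hz'.2 h
    · intro t ht p hp
      exact ne_top_of_le_ne_top (ih.connected t ht p hp) (gdist_passed_anti hS _ _)

/-- Going through the list of sides with the colour `κ` at their first corners, where the colour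
changes by `j` along each side, leads from the colour `a` to the colour `b`. -/
def Walk (κ j : T.Corner → ZMod 2) : List T.Corner → ZMod 2 → ZMod 2 → Prop
  | [], a, b => a = b
  | x :: l, a, b => κ x = a ∧ Walk κ j l (a + j x) b

lemma walk_append {κ j : T.Corner → ZMod 2} {l l' : List T.Corner} {a b : ZMod 2} :
    Walk κ j (l ++ l') a b ↔ ∃ c, Walk κ j l a c ∧ Walk κ j l' c b := by
  induction l generalizing a with
  | nil => simp [Walk]
  | cons x l ih => simp only [List.cons_append, Walk, ih, and_assoc, exists_and_left]

lemma Walk.sum_eq {κ j : T.Corner → ZMod 2} {l : List T.Corner} {a b : ZMod 2}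
    (h : Walk κ j l a b) : b = a + (l.map j).sum := by
  induction l generalizing a with
  | nil => simpa [Walk, eq_comm] using h
  | cons x l ih => rw [ih h.2, List.map_cons, List.sum_cons, add_assoc]

lemma Walk.congr {κ κ' j : T.Corner → ZMod 2} {l : List T.Corner} {a b : ZMod 2}
    (h : Walk κ j l a b) (hκ : ∀ x ∈ l, κ' x = κ x) : Walk κ' j l a b := by
  induction l generalizing a with
  | nil => exact h
  | cons x l ih =>
    exact ⟨(hκ x (by simp)).trans h.1, ih h.2 fun y hy => hκ y (by simp [hy])⟩

lemma Walk.const {κ j : T.Corner → ZMod 2} {l : List T.Corner} {a b : ZMod 2}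
    (h : Walk κ j l a b) (hj : ∀ x ∈ l, j x = 0) : b = a ∧ ∀ x ∈ l, κ x = a := by
  induction l generalizing a with
  | nil => exact ⟨h.symm, by simp⟩
  | cons x l ih =>
    have h2 := h.2
    rw [hj x (by simp), add_zero] at h2
    obtain ⟨h3, h4⟩ := ih h2 fun y hy => hj y (by simp [hy])
    refine ⟨h3, ?_⟩
    rintro y (_ | ⟨_, hy⟩)
    · exact h.1
    · exact h4 y hy

/-- The region inside the boundary cycles is planar: a cochain modulo two that vanishes on all
boundary cycles has a potential. -/
lemma Develops.exists_potential {E : Set (Fin T.num)} {S : Set T.Corner}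
    {M : Multiset (List T.Corner)} (h : T.Develops U o E S M) {j : T.Corner → ZMod 2}
    (hjoin : ∀ x y, T.Passed U S x y → j x = j y)
    (htri : ∀ x : T.Corner, j x + j (T.succ x) + j (T.succ (T.succ x)) = 0)
    (hM : ∀ L ∈ M, (L.map j).sum = 0) :
    ∃ κ : T.Corner → ZMod 2, (∀ x : T.Corner, x.1 ∈ E → κ (T.succ x) = κ x + j x) ∧
      (∀ x y, T.Passed U S x y → κ y = κ x + j x) ∧ ∀ L ∈ M, ∃ a, Walk κ j L a a := by
  induction h with
  | start =>
    have e0 : T.succ (o.1, 0) = (o.1, 1) := rfl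
    have e1 : T.succ (o.1, 1) = (o.1, 2) := rfl
    have e2 : T.succ (o.1, 2) = (o.1, 0) := rfl
    have h3 := htri (o.1, 0)
    rw [e0, e1] at h3
    have hne1 : ((o.1, 1) : T.Corner) ≠ (o.1, 0) := by simp
    have hne2 : ((o.1, 2) : T.Corner) ≠ (o.1, 0) := by simp
    have hne3 : ((o.1, 2) : T.Corner) ≠ (o.1, 1) := by simp
    classical
    set κ : T.Corner → ZMod 2 := fun x => if x = (o.1, 0) then 0 else
      if x = (o.1, 1) then j (o.1, 0) else j (o.1, 0) + j (o.1, 1)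
    have k0 : κ (o.1, 0) = 0 := if_pos rfl
    have k1 : κ (o.1, 1) = j (o.1, 0) := (if_neg hne1).trans (if_pos rfl)
    have k2 : κ (o.1, 2) = j (o.1, 0) + j (o.1, 1) :=
      (if_neg hne2).trans (if_neg hne3)
    refine ⟨κ, fun x hx => ?_, fun x y hp => absurd hp.2.1 (by simp), fun L hL => ?_⟩
    · obtain ⟨t, i⟩ := x
      obtain rfl : t = o.1 := hx
      have hi : i = 0 ∨ i = 1 ∨ i = 2 := by fin_cases i <;> decide
      rcases hi with rfl | rfl | rfl
      · rw [e0, k0, k1, zero_add]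
      · rw [e1, k1, k2]
      · rw [e2, k2, k0, h3]
    · rw [Multiset.mem_singleton.1 hL]
      exact ⟨0, k0, by rw [k1, zero_add], by rw [k2, zero_add], by rw [Walk]; linear_combination h3⟩
  | @enter E S M l₁ l₂ x y hd hj hy ih =>
    have hinv := hd.inv
    have hjxy : j x = j y := hjoin x y ⟨hj, by simp, by simp⟩
    have htr := htri y
    obtain ⟨κ, h1, h2, h3⟩ := ih
      (fun a b hp => hjoin a b ⟨hp.1, Or.inr (Or.inr hp.2.1), Or.inr (Or.inr hp.2.2)⟩) (by
        intro L hL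
        rcases Multiset.mem_cons.1 hL with rfl | hL
        · have := hM _ (Multiset.mem_cons_self _ _)
          simp only [List.map_append, List.map_cons, List.sum_append, List.sum_cons] at this ⊢
          linear_combination this + hjxy + htr - two_self (j (T.succ y)) -
            two_self (j (T.succ (T.succ y)))
        · exact hM L (Multiset.mem_cons_of_mem hL))
    classical
    set κ' : T.Corner → ZMod 2 := fun z => if z = y then κ x + j x else
      if z = T.succ y then κ x else if z = T.succ (T.succ y) then κ x + j (T.succ y) else κ z
    have k0 : κ' y = κ x + j x := if_pos rfl
    have k1 : κ' (T.succ y) = κ x :=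
      (if_neg (T.succ_ne y)).trans (if_pos rfl)
    have k2 : κ' (T.succ (T.succ y)) = κ x + j (T.succ y) :=
      (if_neg (T.succ_succ_ne y)).trans ((if_neg (T.succ_ne _)).trans (if_pos rfl))
    have k3 : ∀ z : T.Corner, z.1 ∈ E → κ' z = κ z := by
      intro z hz
      have hne : ∀ w : T.Corner, w.1 = y.1 → z ≠ w := fun w hw he => hy (hw ▸ he ▸ hz)
      exact (if_neg (hne y rfl)).trans
        ((if_neg (hne (T.succ y) rfl)).trans (if_neg (hne (T.succ (T.succ y)) rfl)))
    have hcyc : ∀ L ∈ (l₁ ++ x :: l₂) ::ₘ M, ∀ z ∈ L, z.1 ∈ E := fun L hL z hz =>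
      (hinv.cycle_mem z (mem_cycleSides.2 ⟨L, hL, hz⟩)).1
    have hxE : x.1 ∈ E := hcyc _ (Multiset.mem_cons_self _ _) x (by simp)
    refine ⟨κ', ?_, ?_, ?_⟩
    · rintro z (hz | hz)
      · rcases T.eq_or_of_fst_eq hz with rfl | rfl | rfl
        · rw [k1, k0, hjxy]; linear_combination -two_self (j z)
        · rw [k2, k1]
        · rw [T.succ_succ_succ, k0, k2, hjxy]
          linear_combination htr - two_self (j (T.succ y)) - two_self (j (T.succ (T.succ y)))
      · rw [k3 _ hz, k3 _ (by simpa using hz), h1 z hz]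
    · rintro a b ⟨hab, ha, -⟩
      rcases ha with rfl | rfl | ha
      · obtain rfl := hab.unique hj
        rw [k0, k3 _ hxE]
      · obtain rfl := hab.unique hj.symm
        rw [k0, k3 _ hxE, hjxy]; linear_combination -two_self (j a)
      · obtain ⟨haE, b', hb', hab'⟩ := hinv.passed a ha
        obtain rfl := hab.unique hab'
        rw [k3 _ haE, k3 _ (hinv.passed b hb').1]
        exact h2 a b ⟨hab, ha, hb'⟩
    · intro L hL
      rcases Multiset.mem_cons.1 hL with rfl | hL
      · obtain ⟨a, ha⟩ := h3 _ (Multiset.mem_cons_self _ _)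
        obtain ⟨b, hb, hb1, hb2⟩ := walk_append.1 ha
        have hmem := hcyc _ (Multiset.mem_cons_self (l₁ ++ x :: l₂) M)
        refine ⟨a, walk_append.2 ⟨b, hb.congr fun z hz => k3 z (hmem z (by simp [hz])), ?_, ?_, ?_⟩⟩
        · rw [k1, hb1]
        · rw [k2, hb1]
        · have e : b + j (T.succ y) + j (T.succ (T.succ y)) = b + j x := by
            rw [hjxy]; linear_combination htr - two_self (j y)
          rw [e]
          exact hb2.congr fun z hz => k3 z (hmem z (by simp [hz]))
      · obtain ⟨a, ha⟩ := h3 L (Multiset.mem_cons_of_mem hL)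
        exact ⟨a, ha.congr fun z hz => k3 z (hcyc L (Multiset.mem_cons_of_mem hL) z hz)⟩
  | @split E S M l₁ l₂ l₃ x y hd hj ih =>
    have hinv := hd.inv
    have hjxy : j x = j y := hjoin x y ⟨hj, by simp, by simp⟩
    have hs13 := hM _ (Multiset.mem_cons_self _ _)
    have hs2 := hM l₂ (by simp)
    obtain ⟨κ, h1, h2, h3⟩ := ih
      (fun a b hp => hjoin a b ⟨hp.1, Or.inr (Or.inr hp.2.1), Or.inr (Or.inr hp.2.2)⟩) (by
        intro L hL
        rcases Multiset.mem_cons.1 hL with rfl | hL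
        · simp only [List.map_append, List.map_cons, List.sum_append, List.sum_cons] at hs13 ⊢
          rw [hs2, hjxy]
          linear_combination hs13 + two_self (j y)
        · exact hM L (by simp [hL]))
    obtain ⟨a, ha⟩ := h3 _ (Multiset.mem_cons_self _ _)
    obtain ⟨b, hb, hb1, hb2⟩ := walk_append.1 ha
    obtain ⟨c, hc, hc1, hc2⟩ := walk_append.1 hb2
    have hc0 := hc.sum_eq
    rw [hs2, add_zero] at hc0
    have hyx : κ y = κ x + j x := by rw [hc1, hc0, hb1]
    refine ⟨κ, h1, ?_, ?_⟩
    · rintro p q ⟨hpq, hp, -⟩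
      rcases hp with rfl | rfl | hp
      · obtain rfl := hpq.unique hj
        exact hyx
      · obtain rfl := hpq.unique hj.symm
        rw [hyx, hjxy]; linear_combination -two_self (j p)
      · obtain ⟨-, q', hq', hpq'⟩ := hinv.passed p hp
        obtain rfl := hpq.unique hpq'
        exact h2 p q ⟨hpq, hp, hq'⟩
    · intro L hL
      rcases Multiset.mem_cons.1 hL with rfl | hL
      · refine ⟨a, walk_append.2 ⟨b, hb, ?_⟩⟩
        have e : c + j y = b := by rw [hc0, hjxy]; linear_combination two_self (j y)
        rwa [e] at hc2
      · rcases Multiset.mem_cons.1 hL with rfl | hL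
        · rw [← hc0] at hc
          exact ⟨c, hc⟩
        · exact h3 L (by simp [hL])

end Development

/-! ### Potentials in a corridor -/

section Cell

variable {T} {U : Set (Fin T.num)}

lemma not_junction_of_inner {x y : T.Corner} (h : T.Inner U x y) : ¬ T.Junction U x.1 :=
  fun hj => h.2 ⟨y, h.1, Or.inl hj⟩

/-- A triangle of a corridor has at most two neighbours. -/
lemma not_inner_of_joined {b w x y : T.Corner} (hb : T.Joined U b w)
    (h1 : T.Inner U (T.succ b) x) (h2 : T.Inner U (T.succ (T.succ b)) y) : False := by
  apply not_junction_of_inner h1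
  left
  intro i
  rcases T.eq_or_of_fst_eq (x := b) (y := (b.1, i)) rfl with h | h | h
  · exact ⟨w, by rw [succ_fst, h]; exact hb⟩
  · exact ⟨x, by rw [succ_fst, h]; exact h1.1⟩
  · exact ⟨y, by rw [succ_fst, h]; exact h2.1⟩

/-- Exploration of a corridor from the gate `a`: the triangles in `C` have been entered, the last
of them through its side `b`. -/
inductive Sleeve (U : Set (Fin T.num)) (a : T.Corner) : Set (Fin T.num) → T.Corner → Prop
  | start : Sleeve U a {a.1} a
  | step {C : Set (Fin T.num)} {b x y : T.Corner} : Sleeve U a C b →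
      (x = T.succ b ∨ x = T.succ (T.succ b)) → T.Inner U x y → Sleeve U a (insert y.1 C) y

/-- The edges inside the explored part of a corridor are those that have been passed. -/
structure SleeveInv (U : Set (Fin T.num)) (C : Set (Fin T.num)) (b : T.Corner) : Prop where
  mem : b.1 ∈ C
  joined : ∃ w, T.Joined U b w
  matched : ∀ z w : T.Corner, z.1 ∈ C → T.Inner U z w → z ≠ T.succ b → z ≠ T.succ (T.succ b) →
    w.1 ∈ C ∧ w ≠ T.succ b ∧ w ≠ T.succ (T.succ b)

lemma SleeveInv.notMem {C : Set (Fin T.num)} {b x y : T.Corner} (h : SleeveInv U C b)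
    (hx : x = T.succ b ∨ x = T.succ (T.succ b)) (hxy : T.Inner U x y) : y.1 ∉ C := by
  intro hy
  obtain ⟨w, hw⟩ := h.joined
  by_cases h1 : y = T.succ b
  · rcases hx with rfl | rfl
    · exact hxy.1.ne h1
    · exact not_inner_of_joined hw (h1 ▸ hxy.symm) hxy
  by_cases h2 : y = T.succ (T.succ b)
  · rcases hx with rfl | rfl
    · exact not_inner_of_joined hw hxy (h2 ▸ hxy.symm)
    · exact hxy.1.ne h2
  have := h.matched y x hy hxy.symm h1 h2
  rcases hx with rfl | rfl
  · exact this.2.1 rfl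
  · exact this.2.2 rfl

lemma Sleeve.inv {a : T.Corner} (ha : T.Gate U a) {C : Set (Fin T.num)} {b : T.Corner}
    (h : Sleeve U a C b) : SleeveInv U C b := by
  induction h with
  | start =>
    obtain ⟨w, hw, hw'⟩ := ha
    refine ⟨rfl, ⟨w, hw⟩, fun z z' hz hzz h1 h2 => ?_⟩
    rcases T.eq_or_of_fst_eq (show z.1 = a.1 from hz) with rfl | rfl | rfl
    · exact absurd ⟨w, hw, hw'⟩ hzz.2
    · exact absurd rfl h1
    · exact absurd rfl h2
  | @step C b x y _ hx hxy ih =>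
    have hy := ih.notMem hx hxy
    have hxC : x.1 ∈ C := by rcases hx with rfl | rfl <;> exact ih.mem
    have hne : ∀ w : T.Corner, w.1 ∈ C → w ≠ T.succ y ∧ w ≠ T.succ (T.succ y) := fun w hw =>
      ⟨fun he => hy (by rw [he] at hw; exact hw), fun he => hy (by rw [he] at hw; exact hw)⟩
    refine ⟨mem_insert _ _, ⟨x, hxy.1.symm⟩, ?_⟩
    rintro z w (hz | hz) hzw h1 h2
    · rcases T.eq_or_of_fst_eq hz with rfl | rfl | rfl
      · obtain rfl := hzw.unique hxy.symm
        exact ⟨mem_insert_of_mem _ hxC, hne _ hxC⟩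
      · exact absurd rfl h1
      · exact absurd rfl h2
    · by_cases h3 : z = x
      · obtain rfl := h3
        obtain rfl := hzw.unique hxy
        exact ⟨mem_insert _ _, (T.succ_ne w).symm, (T.succ_succ_ne w).symm⟩
      · obtain ⟨w', hw'⟩ := ih.joined
        have h4 : z ≠ T.succ b ∧ z ≠ T.succ (T.succ b) := by
          rcases hx with rfl | rfl
          · exact ⟨h3, fun h => not_inner_of_joined hw' hxy (h ▸ hzw)⟩
          · exact ⟨fun h => not_inner_of_joined hw' (h ▸ hzw) hxy, h3⟩
        have h5 := ih.matched z w hz hzw h4.1 h4.2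
        exact ⟨mem_insert_of_mem _ h5.1, hne _ h5.1⟩

lemma Sleeve.exists_potential {a : T.Corner} (ha : T.Gate U a) {C : Set (Fin T.num)}
    {b : T.Corner} (h : Sleeve U a C b) {j : T.Corner → ZMod 2}
    (hjoin : ∀ x y, T.Inner U x y → j x = j y)
    (htri : ∀ x : T.Corner, j x + j (T.succ x) + j (T.succ (T.succ x)) = 0) :
    ∃ κ : T.Corner → ZMod 2, (∀ x : T.Corner, x.1 ∈ C → κ (T.succ x) = κ x + j x) ∧
      ∀ x y : T.Corner, x.1 ∈ C → y.1 ∈ C → T.Inner U x y → κ y = κ x + j x := by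
  -- a potential on one triangle, with a given value at one corner
  have base : ∀ (y : T.Corner) (e : ZMod 2) (κ : T.Corner → ZMod 2),
      ∃ κ' : T.Corner → ZMod 2, κ' y = e ∧ (∀ z : T.Corner, z.1 ≠ y.1 → κ' z = κ z) ∧
        ∀ x : T.Corner, x.1 = y.1 → κ' (T.succ x) = κ' x + j x := by
    intro y e κ
    classical
    set κ' : T.Corner → ZMod 2 := fun z => if z = y then e else
      if z = T.succ y then e + j y else if z = T.succ (T.succ y) then e + j y + j (T.succ y)
        else κ z
    have k0 : κ' y = e := if_pos rfl
    have k1 : κ' (T.succ y) = e + j y := (if_neg (T.succ_ne y)).trans (if_pos rfl)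
    have k2 : κ' (T.succ (T.succ y)) = e + j y + j (T.succ y) :=
      (if_neg (T.succ_succ_ne y)).trans ((if_neg (T.succ_ne _)).trans (if_pos rfl))
    refine ⟨κ', k0, fun z hz => ?_, fun x hx => ?_⟩
    · have hne : ∀ w : T.Corner, w.1 = y.1 → z ≠ w := fun w hw he => hz (by rw [he, hw])
      exact (if_neg (hne y rfl)).trans
        ((if_neg (hne (T.succ y) rfl)).trans (if_neg (hne (T.succ (T.succ y)) rfl)))
    · rcases T.eq_or_of_fst_eq hx with rfl | rfl | rfl
      · rw [k1, k0]
      · rw [k2, k1]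
      · rw [T.succ_succ_succ, k0, k2]
        linear_combination -htri y
  induction h with
  | start =>
    obtain ⟨κ, -, -, hκ⟩ := base a 0 0
    refine ⟨κ, fun x hx => hκ x hx, fun x y hx hy hxy => absurd ?_ hxy.1.fst_ne⟩
    rw [show y.1 = a.1 from hy, show x.1 = a.1 from hx]
  | @step C b x y hs hx hxy ih =>
    obtain ⟨κ, h1, h2⟩ := ih
    have hinv := hs.inv ha
    have hinv' := (hs.step hx hxy).inv ha
    have hy := hinv.notMem hx hxy
    have hxC : x.1 ∈ C := by rcases hx with rfl | rfl <;> exact hinv.mem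
    obtain ⟨κ', k0, k1, k2⟩ := base y (κ x + j x) κ
    have k3 : ∀ z : T.Corner, z.1 ∈ C → κ' z = κ z := fun z hz => k1 z fun he => hy (he ▸ hz)
    have hnew : ∀ z w : T.Corner, z.1 = y.1 → w.1 ∈ C → T.Inner U z w → z = y ∧ w = x := by
      intro z w hz hw hzw
      have h3 : z = y := by
        by_contra hne
        have h4 : z = T.succ y ∨ z = T.succ (T.succ y) :=
          (T.eq_or_of_fst_eq hz).resolve_left hne
        exact hinv'.notMem h4 hzw (mem_insert_of_mem _ hw)
      exact ⟨h3, (h3 ▸ hzw).unique hxy.symm⟩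
    refine ⟨κ', ?_, ?_⟩
    · rintro z (hz | hz)
      · exact k2 z hz
      · rw [k3 z hz, k3 (T.succ z) hz, h1 z hz]
    · rintro z w (hz | hz) (hw | hw) hzw
      · exact absurd (hw.trans hz.symm) hzw.1.fst_ne
      · obtain ⟨rfl, rfl⟩ := hnew z w hz hw hzw
        rw [k0, k3 _ hxC, hjoin _ _ hzw]
        linear_combination -two_self (j w)
      · obtain ⟨rfl, rfl⟩ := hnew w z hw hz hzw.symm
        rw [k0, k3 _ hxC]
      · rw [k3 z hz, k3 w hw, h2 z w hz hw hzw]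

/-- The corridor or junction that contains the triangle `t`. -/
def cell (U : Set (Fin T.num)) (t : Fin T.num) : Set (Fin T.num) :=
  {t' | Relation.ReflTransGen
    (fun r r' => ∃ x y : T.Corner, T.Inner U x y ∧ x.1 = r ∧ y.1 = r') t t'}

lemma self_mem_cell (t : Fin T.num) : t ∈ cell U t := .refl

lemma cell_closed {t : Fin T.num} {x y : T.Corner} (h : T.Inner U x y) (hx : x.1 ∈ cell U t) :
    y.1 ∈ cell U t := hx.tail ⟨x, y, h, rfl, rfl⟩

lemma cell_subset {t : Fin T.num} {K : Set (Fin T.num)} (ht : t ∈ K)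
    (hK : ∀ x y : T.Corner, T.Inner U x y → x.1 ∈ K → y.1 ∈ K) : cell U t ⊆ K := by
  intro t' h
  induction h with
  | refl => exact ht
  | tail _ h ih =>
    obtain ⟨x, y, hxy, rfl, rfl⟩ := h
    exact hK x y hxy ih

/-- The dual graph of a corridor with a gate is a path, so that all balanced cochains on it have
a potential. -/
lemma exists_cell_potential {a : T.Corner} (ha : T.Gate U a) {j : T.Corner → ZMod 2}
    (hjoin : ∀ x y, T.Inner U x y → j x = j y)
    (htri : ∀ x : T.Corner, j x + j (T.succ x) + j (T.succ (T.succ x)) = 0) :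
    ∃ κ : T.Corner → ZMod 2, (∀ x : T.Corner, x.1 ∈ cell U a.1 → κ (T.succ x) = κ x + j x) ∧
      ∀ x y : T.Corner, x.1 ∈ cell U a.1 → T.Inner U x y → κ y = κ x + j x := by
  obtain ⟨C, hC⟩ := (Set.toFinite {C : Set (Fin T.num) | ∃ b, Sleeve U a C b}).exists_maximal
    ⟨_, a, .start⟩
  obtain ⟨⟨b, hb⟩, hmax⟩ := hC
  have hinv := hb.inv ha
  have hclosed : ∀ x y : T.Corner, T.Inner U x y → x.1 ∈ C → y.1 ∈ C := by
    intro x y hxy hx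
    by_cases h : x = T.succ b ∨ x = T.succ (T.succ b)
    · exact hmax ⟨y, hb.step h hxy⟩ (subset_insert _ _) (mem_insert _ _)
    · push Not at h
      exact (hinv.matched x y hx hxy h.1 h.2).1
  have haC : ∀ {C b}, Sleeve U a C b → a.1 ∈ C := by
    intro C b h
    induction h with
    | start => rfl
    | step _ _ _ ih => exact mem_insert_of_mem _ ih
  have hsub := cell_subset (haC hb) hclosed
  obtain ⟨κ, h1, h2⟩ := hb.exists_potential ha hjoin htri
  exact ⟨κ, fun x hx => h1 x (hsub hx), fun x y hx hxy =>
    h2 x y (hsub hx) (hclosed x y hxy (hsub hx)) hxy⟩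

end Cell

/-! ### The triangles at the source -/

section Source

lemma isCompact_segment (p q : Plane) : IsCompact (segment ℝ p q) := by
  rw [segment_eq_image_lineMap]
  exact isCompact_Icc.image AffineMap.lineMap_continuous

lemma isClosed_boundary (Q : SimplePolygon) : IsClosed Q.boundary := by
  have : NeZero Q.n := ⟨by have := Q.three_le; omega⟩
  exact isClosed_iUnion_of_finite fun i => (isCompact_segment _ _).isClosed

lemma isOpen_inside (Q : SimplePolygon) : IsOpen Q.inside := by
  rw [isOpen_iff_mem_nhds]
  rintro x ⟨hx, hb⟩
  have ho := (isClosed_boundary Q).isOpen_compl.connectedComponentIn (x := x)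
  filter_upwards [ho.mem_nhds (mem_connectedComponentIn hx)] with y hy
  refine ⟨connectedComponentIn_subset _ _ hy, ?_⟩
  rwa [← connectedComponentIn_eq hy]

lemma isClosed_region (Q : SimplePolygon) : IsClosed Q.region := by
  rw [← isOpen_compl_iff, isOpen_iff_mem_nhds]
  intro x hx
  rw [mem_compl_iff, SimplePolygon.region, mem_union, not_or] at hx
  have ho := (isClosed_boundary Q).isOpen_compl.connectedComponentIn (x := x)
  filter_upwards [ho.mem_nhds (mem_connectedComponentIn hx.1)] with y hy
  rintro (h | h)
  · exact connectedComponentIn_subset _ _ hy h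
  · have h2 := h.2
    rw [← connectedComponentIn_eq hy] at h2
    exact hx.2 ⟨hx.1, h2⟩

lemma free_mem_nhds (D : PolygonalDomain) : D.free ∈ nhds D.s := by
  have h1 := (isOpen_inside D.outer).mem_nhds D.s_mem
  have h2 : (⋃ i, (D.hole i).region)ᶜ ∈ nhds D.s := by
    refine (isClosed_iUnion_of_finite fun i => isClosed_region _).isOpen_compl.mem_nhds ?_
    simpa using D.s_notMem
  filter_upwards [h1, h2] with x hx hx'
  refine ⟨Or.inr hx, fun h => hx' ?_⟩
  obtain ⟨i, hi⟩ := mem_iUnion.1 h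
  exact mem_iUnion.2 ⟨i, Or.inr hi⟩

variable {T} {U : Set (Fin T.num)}

/-- As the source lies in the interior of the free space, the sides that start there are not
walls. -/
lemma exists_joined_of_pos_eq_s (hU : ∀ t, D.s ∈ range (T.corner t) → t ∈ U) {o : T.Corner}
    (ho : T.pos o = D.s) : ∃ y, T.Joined U o y := by
  set A := T.pos o with hA
  set B := T.pos (T.succ o) with hB
  set C := T.pos (T.succ (T.succ o)) with hC
  have hΔ : 0 < area A B C := T.area_pos o
  have hfree : D.free ∈ nhds A := ho ▸ free_mem_nhds D
  obtain ⟨N, hN, hNo, hAN⟩ := mem_nhds_iff.1 hfree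
  -- a point on the side, close to the source
  obtain ⟨r, ⟨hr0, hr1⟩, hrN⟩ : ∃ r ∈ Ioo (0 : ℝ) 1, A + r • (B - A) ∈ N := by
    have hcont : Continuous fun r : ℝ => A + r • (B - A) := by fun_prop
    have h0 : (0 : ℝ) ∈ closure (Ioo (0 : ℝ) 1) := by rw [closure_Ioo zero_ne_one]; simp
    obtain ⟨r, hr, hr'⟩ := mem_closure_iff_nhds.1 h0 _
      ((hNo.preimage hcont).mem_nhds (by simpa using hAN))
    exact ⟨r, hr', hr⟩
  set m := A + r • (B - A) with hm
  -- it lies in another triangle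
  obtain ⟨t, hto, hmt⟩ : ∃ t, t ≠ o.1 ∧ m ∈ T.tri t := by
    by_contra! hcon
    have hF : IsClosed (⋃ t : {t // t ≠ o.1}, T.tri t) :=
      isClosed_iUnion_of_finite fun t => (T.isCompact_tri _).isClosed
    have hcont : Continuous fun η : ℝ => m - η • (C - A) := by fun_prop
    have hopen : IsOpen (N ∩ (⋃ t : {t // t ≠ o.1}, T.tri t)ᶜ) := hNo.inter hF.isOpen_compl
    have h0 : (0 : ℝ) ∈ closure (Ioo (0 : ℝ) 1) := by rw [closure_Ioo zero_ne_one]; simp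
    obtain ⟨η, ⟨hη1, hη2⟩, hη0, -⟩ := mem_closure_iff_nhds.1 h0 _
      ((hopen.preimage hcont).mem_nhds (by
        refine ⟨by simpa using hrN, ?_⟩
        simpa using fun t ht => hcon t ht))
    have hfr := hN hη1
    rw [← T.cover] at hfr
    obtain ⟨t, ht⟩ := mem_iUnion.1 hfr
    by_cases hto : t = o.1
    · subst hto
      obtain ⟨a, b, c, ha, hb, hc, hs, he⟩ := (T.mem_tri_iff o _).1 ht
      have h1 : area A B (m - η • (C - A)) = -η * area A B C := by
        rw [hm]
        simp only [area, PiLp.add_apply, PiLp.sub_apply, PiLp.smul_apply, smul_eq_mul]; ring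
      have h2 : area A B (m - η • (C - A)) = c * area A B C := by
        obtain rfl : a = 1 - b - c := by linarith
        have he' : m - η • (C - A) = _ := he
        rw [he']
        simp only [area, PiLp.add_apply, PiLp.smul_apply, smul_eq_mul, ← hA, ← hB, ← hC]; ring
      nlinarith [mul_pos hη0 hΔ, mul_nonneg hc hΔ.le]
    · exact hη2 (mem_iUnion.2 ⟨⟨t, hto⟩, ht⟩)
  have hmo : m ∈ T.tri o.1 := by
    rw [T.mem_tri_iff o]
    refine ⟨1 - r, r, 0, by linarith, hr0.le, le_rfl, by ring, ?_⟩
    rw [hm, ← hA, ← hB]; module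
  have hmem : m ∈ convexHull ℝ (range (T.corner o.1) ∩ range (T.corner t)) := by
    rw [← T.proper o.1 t hto.symm]
    exact ⟨hmo, hmt⟩
  rw [T.range_corner o, ← hA, ← hB, ← hC] at hmem
  have aux : ∀ P Q : Plane, ({A, B, C} ∩ range (T.corner t) : Set Plane) ⊆ {P, Q} →
      area P Q m = 0 := by
    intro P Q hsub
    have h := convexHull_mono hsub hmem
    rw [convexHull_pair] at h
    obtain ⟨u, v, -, -, huv, he⟩ := h
    rw [← he, area_combo _ _ _ _ _ _ huv]
    simp only [area]; ring
  have hAt : A ∈ range (T.corner t) := by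
    by_contra hcon
    have h := aux B C (by
      rintro p ⟨rfl | rfl | rfl, hp⟩
      · exact absurd hp hcon
      · simp
      · simp)
    have h1 : area B C m = (1 - r) * area A B C := by
      rw [hm]
      simp only [area, PiLp.add_apply, PiLp.sub_apply, PiLp.smul_apply, smul_eq_mul]; ring
    rw [h1] at h
    exact (mul_pos (by linarith) hΔ).ne' h
  have hBt : B ∈ range (T.corner t) := by
    by_contra hcon
    have h := aux C A (by
      rintro p ⟨rfl | rfl | rfl, hp⟩
      · simp
      · exact absurd hp hcon
      · simp)
    have h1 : area C A m = r * area A B C := by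
      rw [hm]
      simp only [area, PiLp.add_apply, PiLp.sub_apply, PiLp.smul_apply, smul_eq_mul]; ring
    rw [h1] at h
    exact (mul_pos hr0 hΔ).ne' h
  obtain ⟨i, hi⟩ := hAt
  obtain ⟨k, hk⟩ := hBt
  have hoU : o.1 ∈ U := hU _ ⟨o.2, ho⟩
  have htU : t ∈ U := hU _ ⟨i, hi.trans ho⟩
  have hi' : T.pos (t, i) = A := hi
  have hk' : T.pos (t, k) = B := hk
  rcases T.eq_or_of_fst_eq (x := (t, i)) (y := (t, k)) rfl with h | h | h
  · exact absurd (hk'.symm.trans (by rw [h]; exact hi') : B = A) (T.pos_ne o)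
  · have := T.eq_of_pos_eq (x := o) (y := (t, i)) hi'.symm (by rw [← h, hk'])
    exact absurd (by rw [this]) hto
  · refine ⟨(t, k), hoU, htU, hk', ?_⟩
    rw [h, T.succ_succ_succ, hi']

end Source

/-! ### Runs of a path inside corridors and junctions -/

section Runs

variable {T} {U : Set (Fin T.num)} {G : T.Corner → T.Corner → Prop}

/-- A path, split into a trail and its last chord. -/
structure Run (T : Triangulation D) where
  start : T.Node
  body : List T.Chord
  last : T.Node
  finish : T.Node

/-- The chords of a run. -/
def Run.chords (r : Run T) : List T.Chord := r.body ++ [(r.last, r.finish)]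

/-- The run is a path for the gluing `G`. -/
def IsRun (G : T.Corner → T.Corner → Prop) (r : Run T) : Prop :=
  Trail G r.start r.body r.last ∧ ValidChord (r.last, r.finish)

lemma IsRun.isPath {r : Run T} (h : IsRun G r) : IsPath G r.start r.chords r.finish :=
  ⟨r.body, r.last, h.1, h.2, rfl⟩

lemma IsRun.proper {r : Run T} (h : IsRun G r) : Proper r.start := h.isPath.proper

lemma Run.onTrail {r : Run T} {c : T.Chord} (hc : c ∈ r.chords) {z : T.Spot}
    (h1 : z.1 = c.1.1.1) (h2 : z.2 ∈ seg c) : OnTrail r.body r.last (T.pt r.finish) z := by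
  rcases List.mem_append.1 hc with hc | hc
  · exact Or.inl ⟨c, hc, h1, h2⟩
  · rw [List.mem_singleton.1 hc] at h1 h2
    exact Or.inr ⟨h1, h2⟩

lemma Run.len_chords (r : Run T) :
    len r.chords = len r.body + edist (T.pt r.last) (T.pt r.finish) := by
  simp [Run.chords]

lemma IsRun.nspot_finish {r : Run T} (h : IsRun G r) :
    (r.last.1.1, T.pt r.finish) = nspot r.finish := by
  rw [nspot, ← show r.last.1.1 = r.finish.1.1 from h.2.1]

lemma IsRun.finish_mem {r : Run T} (h : IsRun G r) : T.pt r.finish ∈ T.tri r.last.1.1 := by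
  rw [show r.last.1.1 = r.finish.1.1 from h.2.1]
  exact pt_mem_tri h.2.2.2

/-- No chord of the path ends on a side that is not glued to another one. -/
lemma IsPath.cnt_eq_zero (hs : ∀ x y, G x y → G y x) {n e : T.Node} {R : List T.Chord}
    (h : IsPath G n R e) {w : T.Corner} (hw : ∀ y, ¬ G w y) (hn : n.1 ≠ w) (he : e.1 ≠ w)
    {φ : T.Node → ZMod 2} (hφ : ∀ k : T.Node, k.1 ≠ w → φ k = 0) : cnt R φ = 0 := by
  rw [h.cnt_eq, hφ n hn, hφ e he, zero_add]
  rintro k k' - - ⟨hk, -⟩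
  rw [hφ k fun h => hw _ (h ▸ hk), hφ k' fun h => hw _ (h ▸ hs _ _ hk), zero_add]

lemma IsPath.ends_eq_zero (hs : ∀ x y, G x y → G y x) {n e : T.Node} {R : List T.Chord}
    (h : IsPath G n R e) {w : T.Corner} (hw : ∀ y, ¬ G w y) (hn : n.1 ≠ w) (he : e.1 ≠ w) :
    ends R w = 0 := by
  classical
  exact h.cnt_eq_zero hs hw hn he fun k hk => if_neg hk

lemma IsPath.before_eq_zero (hs : ∀ x y, G x y → G y x) {n e : T.Node} {R : List T.Chord}
    (h : IsPath G n R e) {k : T.Node} (hw : ∀ y, ¬ G k.1 y) (hn : n.1 ≠ k.1) (he : e.1 ≠ k.1) :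
    before R k = 0 := by
  classical
  exact h.cnt_eq_zero hs hw hn he fun k hk => if_neg fun h => hk h.1

/-- A path is a sequence of runs inside corridors and junctions. The property `P` holds for the
sides at which the runs start and end, except possibly for the start of the first run. -/
lemma Trail.exists_runs (hG : ∀ x y, G x y → T.Joined U x y) {P : T.Corner → Prop}
    (hP : ∀ x y, G x y → ¬ T.Inner U x y → P x ∧ P y) {n m e : T.Node} {l : List T.Chord}
    (h : Trail G n l m) (hv : ValidChord (m, e)) (he : P e.1) :
    ∃ (r₀ : Run T) (Rs : List (Run T)), r₀.start = n ∧
      (r₀ :: Rs).flatMap Run.chords = l ++ [(m, e)] ∧ (∀ r ∈ Rs, P r.start.1) ∧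
      ∀ r ∈ r₀ :: Rs, IsRun (T.Inner U) r ∧ P r.finish.1 ∧
        T.gdist G (nspot n) (nspot r.start) + len r.chords + T.gdist G (nspot r.finish) (nspot e) ≤
          len (l ++ [(m, e)]) := by
  induction l generalizing n with
  | nil =>
    obtain rfl : n = m := h
    refine ⟨⟨n, [], n, e⟩, [], rfl, by simp [Run.chords], by simp, ?_⟩
    intro r hr
    obtain rfl := List.mem_singleton.1 hr
    refine ⟨⟨rfl, hv⟩, he, ?_⟩
    rw [gdist_self (pt_mem_tri hv.2.1), gdist_self (pt_mem_tri hv.2.2)]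
    simp [Run.chords]
  | cons c l ih =>
    obtain ⟨rfl, h2, n', h3, h4⟩ := h
    have hn' := h3.proper h2.2.2
    obtain ⟨r₀, Rs, rfl, h5, h6, h7⟩ := ih h4
    have hcons := fun z => Trail.gdist_cons hG h2 h3 z
    have htail : ∀ r ∈ r₀ :: Rs, T.gdist G (nspot c.1) (nspot r.start) + len r.chords +
        T.gdist G (nspot r.finish) (nspot e) ≤ len (c :: l ++ [(m, e)]) := by
      intro r hr
      rw [List.cons_append, len_cons]
      refine le_trans ?_ (add_le_add_right (h7 r hr).2.2 _)
      rw [← add_assoc, ← add_assoc]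
      gcongr
      exact hcons _
    by_cases hin : T.Inner U c.2.1 r₀.start.1
    · refine ⟨⟨c.1, c :: r₀.body, r₀.last, r₀.finish⟩, Rs, rfl, ?_, h6, ?_⟩
      · rw [List.flatMap_cons] at h5 ⊢
        rw [List.cons_append, ← h5]
        rfl
      · rintro r (_ | ⟨_, hr⟩)
        · have h8 := h7 r₀ (by simp)
          refine ⟨⟨⟨rfl, h2, _, ⟨hin, h3.2⟩, h8.1.1⟩, h8.1.2⟩, h8.2.1, ?_⟩
          have e1 : len (⟨c.1, c :: r₀.body, r₀.last, r₀.finish⟩ : Run T).chords =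
            edist (T.pt c.1) (T.pt c.2) + len r₀.chords := by
              rw [← len_cons]; rfl
          rw [e1, gdist_self (pt_mem_tri h2.2.1), zero_add, List.cons_append, len_cons, add_assoc]
          refine add_le_add_right (le_trans ?_ h8.2.2) _
          rw [add_assoc]
          exact le_add_self
        · have hr' := List.mem_cons_of_mem r₀ hr
          exact ⟨(h7 r hr').1, (h7 r hr').2.1, htail r hr'⟩
    · have hPP := hP _ _ h3.1 hin
      refine ⟨⟨c.1, [], c.1, c.2⟩, r₀ :: Rs, rfl, ?_, ?_, ?_⟩
      · rw [List.flatMap_cons, h5]; rfl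
      · rintro r (_ | ⟨_, hr⟩)
        · exact hPP.2
        · exact h6 r hr
      · rintro r (_ | ⟨_, hr⟩)
        · refine ⟨⟨rfl, h2⟩, hPP.1, ?_⟩
          have e1 : len (⟨c.1, [], c.1, c.2⟩ : Run T).chords = edist (T.pt c.1) (T.pt c.2) := by
            simp [Run.chords]
          rw [e1, gdist_self (pt_mem_tri h2.2.1), zero_add, List.cons_append, len_cons]
          refine add_le_add_right ?_ _
          have h8 := h4.gdist_le hG hn' (hv.1 ▸ pt_mem_tri hv.2.2 : T.pt e ∈ T.tri m.1.1)
          have h9 := gdist_triangle (G := G) (nspot c.2) (nspot r₀.start) (nspot e)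
          rw [h3.gdist_eq_zero hG h2.2.2, zero_add] at h9
          rw [show (m.1.1, T.pt e) = nspot e by
            rw [nspot, ← show m.1.1 = e.1.1 from hv.1]] at h8
          rw [len_append, len_cons, len_nil, add_zero]
          exact h9.trans h8
        · exact ⟨(h7 r hr).1, (h7 r hr).2.1, htail r hr⟩

end Runs

/-! ### Corridor convex chains -/

section Chains

variable {T} {U : Set (Fin T.num)}

lemma inner_joined (x y : T.Corner) (h : T.Inner U x y) : T.Joined U x y := h.1

lemma inner_symm (x y : T.Corner) (h : T.Inner U x y) : T.Inner U y x := h.symm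

lemma cell_symm {t t' : Fin T.num} (h : t' ∈ cell U t) : t ∈ cell U t' := by
  induction h with
  | refl => exact .refl
  | tail _ h ih =>
    obtain ⟨x, y, hxy, hx, hy⟩ := h
    exact .head ⟨y, x, hxy.symm, hy, hx⟩ ih

lemma cellDist_ne_top {t t' : Fin T.num} (h : t' ∈ cell U t) {p q : Plane} (hp : p ∈ T.tri t)
    (hq : q ∈ T.tri t') : T.cellDist U (t, p) (t', q) ≠ ⊤ := by
  have key : ∀ q ∈ T.tri t', T.cellDist U (t, p) (t', q) ≠ ⊤ := by
    clear hq q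
    induction h with
    | refl =>
      intro q hq
      exact ((gdist_le_edist hp hq).trans_lt (edist_plane_ne_top _ _).lt_top).ne
    | tail _ h ih =>
      obtain ⟨x, y, hxy, rfl, rfl⟩ := h
      intro q hq
      have h1 := gdist_cross hxy (left_mem_segment ℝ (T.pos x) (T.pos (T.succ x)))
      have h2 : T.pos x ∈ T.tri y.1 :=
        T.side_subset_tri y (hxy.1.mem_side (left_mem_segment ℝ _ _))
      have h3 := gdist_le_edist (G := T.Inner U) h2 hq
      refine ne_top_of_le_ne_top ?_ ((gdist_triangle _ (x.1, T.pos x) _).trans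
          (add_le_add le_rfl ((gdist_triangle _ (y.1, T.pos x) _).trans (add_le_add h1.le h3))))
      exact ENNReal.add_ne_top.2 ⟨ih _ (T.pos_mem_tri x), by simp⟩
  exact key q hq

lemma CellNext.mem_cell {t : Fin T.num} {x y : T.Corner} (h : T.CellNext U x y)
    (hx : x.1 ∈ cell U t) : y.1 ∈ cell U t := by
  obtain ⟨h, -⟩ := h
  induction h with
  | refl => exact hx
  | tail _ h ih =>
    obtain ⟨z', hz, rfl⟩ := h
    exact show z'.1 ∈ cell U t from cell_closed hz ih

/-- A potential does not change where the boundary of the cell turns at a corner. -/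
lemma CellNext.pot_eq {t : Fin T.num} {l : List T.Chord} {κ : T.Corner → ZMod 2}
    (hκ : IsPot (T.Inner U) (cell U t) l κ) (hb : ∀ u v, T.Inner U u v → Balanced l u v)
    {x y : T.Corner} (h : T.CellNext U x y) (hx : x.1 ∈ cell U t) (h0 : ends l x = 0) :
    κ y = κ x := by
  obtain ⟨h, -⟩ := h
  suffices H : κ y = κ x ∧ y.1 ∈ cell U t from H.1
  induction h with
  | refl => exact ⟨by rw [hκ.succ_eq x hx, h0, add_zero], hx⟩
  | tail _ h ih =>
    obtain ⟨z', hz, rfl⟩ := h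
    have hz' := cell_closed hz ih.2
    refine ⟨?_, hz'⟩
    rw [hκ.succ_eq _ hz', hκ.twin_eq _ _ ih.2 hz, add_assoc, (hb _ _ hz).1, add_zero, ih.1]

/-- The properties of bounding edges that matter for the passage of paths. -/
lemma IsBoundingEdge.exists_gate {g : List T.Corner} (h : T.IsBoundingEdge U g) :
    ∃ a x₀ : T.Corner, ∃ g', g = x₀ :: g' ∧ T.Gate U a ∧ x₀.1 ∈ cell U a.1 ∧
      g.IsChain (T.CellNext U) ∧ ∀ x ∈ g, ∀ y, ¬ T.Inner U x y := by
  rcases h with ⟨x, hx, rfl⟩ | ⟨hw, hc, ⟨x, hx, a, ha, hax⟩, -⟩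
  · refine ⟨x, x, [], rfl, hx, self_mem_cell _, by simp, ?_⟩
    intro y hy z hz
    rw [List.mem_singleton.1 hy] at hz
    exact hz.2 hx
  · cases g with
    | nil => simp at hx
    | cons x₀ g' =>
      obtain rfl : x₀ = x := by simpa using hx
      refine ⟨a, x₀, g', rfl, ha, hax.mem_cell (self_mem_cell _), hc, ?_⟩
      intro y hy z hz
      exact (hw y hy).2 ⟨z, hz.1⟩

lemma mem_cell_of_isChain {t : Fin T.num} {x₀ : T.Corner} {g' : List T.Corner}
    (hc : (x₀ :: g').IsChain (T.CellNext U)) (h0 : x₀.1 ∈ cell U t) :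
    ∀ x ∈ x₀ :: g', x.1 ∈ cell U t := by
  induction g' generalizing x₀ with
  | nil => simpa using h0
  | cons y g' ih =>
    rw [List.isChain_cons_cons] at hc
    rintro x (_ | ⟨_, hx⟩)
    · exact h0
    · exact ih hc.2 (hc.1.mem_cell h0) x hx

lemma pot_eq_of_isChain {t : Fin T.num} {l : List T.Chord} {κ : T.Corner → ZMod 2}
    (hκ : IsPot (T.Inner U) (cell U t) l κ) (hb : ∀ u v, T.Inner U u v → Balanced l u v)
    {x₀ : T.Corner} {g' : List T.Corner}
    (hc : (x₀ :: g').IsChain (T.CellNext U)) (h0 : x₀.1 ∈ cell U t)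
    (hends : ∀ x ∈ x₀ :: g', ends l x = 0) : ∀ x ∈ x₀ :: g', κ x = κ x₀ := by
  induction g' generalizing x₀ with
  | nil => simp
  | cons y g' ih =>
    rw [List.isChain_cons_cons] at hc
    rintro x (_ | ⟨_, hx⟩)
    · rfl
    · rw [ih hc.2 (hc.1.mem_cell h0) (fun x hx => hends x (List.mem_cons_of_mem _ hx)) x hx]
      exact hc.1.pot_eq hκ hb h0 (hends x₀ (by simp))

/-- Potentials for the same chords differ by a constant. -/
lemma IsPot.add_eq {t : Fin T.num} {l : List T.Chord} {κ κ' : T.Corner → ZMod 2}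
    (hκ : IsPot (T.Inner U) (cell U t) l κ) (hκ' : IsPot (T.Inner U) (cell U t) l κ')
    {x y : T.Corner} (hx : x.1 ∈ cell U t) (hy : y.1 ∈ cell U t) : κ x + κ' x = κ y + κ' y := by
  have hsucc : ∀ z : T.Corner, z.1 ∈ cell U t → κ (T.succ z) + κ' (T.succ z) = κ z + κ' z := by
    intro z hz
    rw [hκ.succ_eq z hz, hκ'.succ_eq z hz]
    linear_combination two_self (ends l z)
  have htri : ∀ z w : T.Corner, z.1 ∈ cell U t → w.1 = z.1 → κ w + κ' w = κ z + κ' z := by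
    intro z w hz hw
    rcases T.eq_or_of_fst_eq hw with rfl | rfl | rfl
    · rfl
    · exact hsucc z hz
    · rw [hsucc (T.succ z) hz, hsucc z hz]
  have key : ∀ t' ∈ cell U t, ∀ z : T.Corner, z.1 = t' →
      κ z + κ' z = κ (t, 0) + κ' (t, 0) := by
    intro t' ht'
    induction ht' with
    | refl => exact fun z hz => htri (t, 0) z (self_mem_cell _) hz
    | @tail r r' hr h ih =>
      obtain ⟨u, v, huv, rfl, rfl⟩ := h
      intro z hz
      have hv : v.1 ∈ cell U t := cell_closed huv hr
      rw [htri v z hv hz, hκ.twin_eq _ _ hr huv, hκ'.twin_eq _ _ hr huv, ← ih u rfl]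
      linear_combination two_self (ends l u)
  rw [key _ hx x rfl, key _ hy y rfl]

end Chains

/-! ### Paths that cross a convex chain -/

section Crossings

variable {T} {U : Set (Fin T.num)}

/-- If the colours of a run separate the node `n`, from which the point `b` can be reached, from
the side `w`, then the run meets a nearly shortest path inside the cell between `b` and a point
of `w`. -/
lemma IsRun.exists_meet {t : Fin T.num} {r : Run T} (hr : IsRun (T.Inner U) r)
    {κ : T.Corner → ZMod 2} (hκ : IsPot (T.Inner U) (cell U t) r.chords κ)
    (hbal : ∀ u v, T.Inner U u v → Balanced r.chords u v) {w : T.Corner} (hwC : w.1 ∈ cell U t)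
    (hw : ∀ y, ¬ T.Inner U w y) (hs : r.start.1 ≠ w) (he : r.finish.1 ≠ w) {p : Plane}
    (hp : p ∈ T.side w) {b : T.Spot} (hb : T.cellDist U (w.1, p) b ≠ ⊤) {n : T.Node}
    (hn : n.1.1 = b.1) (hnp : Proper n) (hav : Avoids r.chords b.1 (T.pt n) b.2)
    (hcol : col κ r.chords n ≠ κ w) {ε : ℝ≥0∞} (hε : ε ≠ 0) :
    ∃ c ∈ r.chords, ∃ z : T.Spot, z.1 = c.1.1.1 ∧ z.2 ∈ seg c ∧
      T.cellDist U (w.1, p) z + T.cellDist U z b ≤ T.cellDist U (w.1, p) b + 4 * ε := by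
  obtain ⟨ℓ, hℓ, hℓ'⟩ := exists_route_le hb hε
  obtain ⟨k, rfl, hkp, hk⟩ := exists_node_near w hp hε
  obtain ⟨l, m, h1, h2, h3⟩ := hℓ.exists_trail inner_joined (n := k) rfl hkp hε
  have hbt := hℓ.mem_tri inner_joined
  have hlen : len l + edist (T.pt m) b.2 ≤ T.cellDist U (k.1.1, p) b + 3 * ε := by
    refine (h3 _ hbt).trans ?_
    rw [edist_self, add_zero]
    calc ℓ + edist p (T.pt k) + ε ≤ (T.cellDist U (k.1.1, p) b + ε) + ε + ε := by
          gcongr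
          exact hℓ'
      _ = _ := by ring
  by_cases hmeet : ∃ c ∈ r.chords, ∃ z : T.Spot, z.1 = c.1.1.1 ∧ z.2 ∈ seg c ∧ OnTrail l m b.2 z
  · obtain ⟨c, hc, z, hz1, hz2, hz⟩ := hmeet
    refine ⟨c, hc, z, hz1, hz2, ?_⟩
    have h4 := h1.gdist_add_le inner_joined hkp (h2 ▸ hbt) hz
    rw [h2] at h4
    have h5 : T.cellDist U (k.1.1, p) z ≤ ε + T.gdist (T.Inner U) (nspot k) z :=
      (gdist_triangle _ (nspot k) _).trans (add_le_add_left
        ((gdist_le_edist (T.side_subset_tri _ hp) (pt_mem_tri hkp)).trans hk) _)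
    calc _ ≤ (ε + T.gdist (T.Inner U) (nspot k) z) + T.cellDist U z b := add_le_add_left h5 _
      _ = ε + (T.gdist (T.Inner U) (nspot k) z + T.gdist (T.Inner U) z (b.1, b.2)) :=
          add_assoc _ _ _
      _ ≤ ε + (T.cellDist U (k.1.1, p) b + 3 * ε) := add_le_add_right (h4.trans hlen) _
      _ = _ := by ring
  · exfalso
    push Not at hmeet
    -- otherwise the colour does not change along the path from `w` to `b`
    have hl := hr.isPath.valid
    have hav1 : ∀ c ∈ l, Avoids r.chords c.1.1.1 (T.pt c.1) (T.pt c.2) := by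
      intro c hc c' hc' ht
      rw [Set.disjoint_left]
      intro q hq hq'
      exact hmeet c' hc' (c.1.1.1, q) ht.symm hq (Or.inl ⟨c, hc, rfl, hq'⟩)
    have hav2 : Avoids r.chords b.1 (T.pt m) b.2 := by
      intro c' hc' ht
      rw [Set.disjoint_left]
      intro q hq hq'
      exact hmeet c' hc' (b.1, q) ht.symm hq (Or.inr ⟨h2.symm, hq'⟩)
    obtain ⟨h5, h6⟩ := h1.col_eq (fun x y hxy hx => cell_closed hxy hx) hl hκ hbal hwC hav1
    have h7 : col κ r.chords m = col κ r.chords n :=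
      col_eq_of_avoids hl (h1.proper hkp) hnp (hn.trans h2.symm)
        (fun x hx => hκ.succ_eq x (hx ▸ h6)) (h2 ▸ hbt) (h2 ▸ hav2) (h2 ▸ hav.symm)
    apply hcol
    rw [← h7, ← h5, col, hr.isPath.before_eq_zero inner_symm hw hs he, add_zero]

/-- The nearly shortest paths from `e` to `b` and from `b` to `e'` meet a path in the points `z`
and `z'`. As `b` lies on a shortest path from `e` to `e'`, the path could pass through `b`. -/
lemma detour_le {E : Set (Fin T.num)} {S : Set T.Corner}
    (hE : ∀ x y, T.Inner U x y → x.1 ∈ E → T.Passed U S x y ∧ y.1 ∈ E)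
    {e e' b z z' s c p q : T.Spot} {m ε : ℝ≥0∞} (hb : b.1 ∈ E) (hp : p.1 ∈ E) (hz : z.1 ∈ E)
    (hz' : z'.1 ∈ E) (hε : ε ≠ ⊤)
    (hee : T.cellDist U e b + T.cellDist U b e' = T.cellDist U e e') (htop : T.cellDist U e e' ≠ ⊤)
    (h1 : T.cellDist U e z + T.cellDist U z b ≤ T.cellDist U e b + 4 * ε)
    (h2 : T.cellDist U e' z' + T.cellDist U z' b ≤ T.cellDist U e' b + 4 * ε)
    (h3 : T.cellDist U p z + T.cellDist U z z' + T.cellDist U z' q ≤ m) :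
    T.stageDist U S s b + T.stageDist U S b c ≤
      T.stageDist U S s p + m + T.stageDist U S q c + 8 * ε := by
  have hcomm := fun x y => gdist_comm (T := T) (inner_joined (U := U)) inner_symm x y
  have hmono : ∀ x y : T.Spot, x.1 ∈ E → T.stageDist U S x y ≤ T.cellDist U x y :=
    fun x y hx => gdist_mono_on hE hx
  have htri := fun x y z => gdist_triangle (T := T) (G := T.Inner U) x y z
  have htriS := fun x y z => gdist_triangle (T := T) (G := T.Passed U S) x y z
  have hfin1 : T.cellDist U e b ≠ ⊤ := fun h => htop (by rw [← hee, h, top_add])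
  have hfin2 : T.cellDist U b e' ≠ ⊤ := fun h => htop (by rw [← hee, h, add_top])
  have h4ε : 4 * ε ≠ ⊤ := ENNReal.mul_ne_top (by norm_num) hε
  have hfin3 : T.cellDist U e z ≠ ⊤ :=
    ne_top_of_le_ne_top (ENNReal.add_ne_top.2 ⟨hfin1, h4ε⟩) (le_self_add.trans h1)
  have hfin4 : T.cellDist U e' z' ≠ ⊤ := by
    refine ne_top_of_le_ne_top (ENNReal.add_ne_top.2 ⟨?_, h4ε⟩) (le_self_add.trans h2)
    rw [cellDist, hcomm]; exact hfin2
  have hmid : T.cellDist U z b + T.cellDist U b z' ≤ T.cellDist U z z' + 8 * ε := by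
    refine ENNReal.le_of_add_le_add_left (ENNReal.add_ne_top.2 ⟨hfin3, hfin4⟩) ?_
    have h5 : T.cellDist U e e' ≤ T.cellDist U e z + (T.cellDist U z z' + T.cellDist U e' z') := by
      refine (htri e z e').trans (add_le_add_right ((htri z z' e').trans ?_) _)
      rw [hcomm z' e']; rfl
    calc T.cellDist U e z + T.cellDist U e' z' + (T.cellDist U z b + T.cellDist U b z')
        = (T.cellDist U e z + T.cellDist U z b) + (T.cellDist U e' z' + T.cellDist U z' b) := by
          rw [show T.cellDist U b z' = T.cellDist U z' b from hcomm _ _]; ring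
      _ ≤ (T.cellDist U e b + 4 * ε) + (T.cellDist U e' b + 4 * ε) := add_le_add h1 h2
      _ = T.cellDist U e e' + 8 * ε := by
          rw [← hee, show T.cellDist U b e' = T.cellDist U e' b from hcomm _ _]; ring
      _ ≤ T.cellDist U e z + (T.cellDist U z z' + T.cellDist U e' z') + 8 * ε :=
          add_le_add_left h5 _
      _ = _ := by ring
  calc T.stageDist U S s b + T.stageDist U S b c
      ≤ (T.stageDist U S s p + (T.stageDist U S p z + T.stageDist U S z b)) +
        (T.stageDist U S b z' + (T.stageDist U S z' q + T.stageDist U S q c)) := by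
        refine add_le_add ((htriS _ p _).trans (add_le_add_right (htriS _ z _) _))
          ((htriS _ z' _).trans (add_le_add_right (htriS _ q _) _))
    _ ≤ (T.stageDist U S s p + (T.cellDist U p z + T.cellDist U z b)) +
        (T.cellDist U b z' + (T.cellDist U z' q + T.stageDist U S q c)) := by
        gcongr
        · exact hmono _ _ hp
        · exact hmono _ _ hz
        · exact hmono _ _ hb
        · exact hmono _ _ hz'
    _ = T.stageDist U S s p + (T.cellDist U p z + (T.cellDist U z b + T.cellDist U b z') +
        T.cellDist U z' q) + T.stageDist U S q c := by ring
    _ ≤ T.stageDist U S s p + (T.cellDist U p z + (T.cellDist U z z' + 8 * ε) +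
        T.cellDist U z' q) + T.stageDist U S q c := by gcongr
    _ = T.stageDist U S s p + (T.cellDist U p z + T.cellDist U z z' + T.cellDist U z' q) +
        T.stageDist U S q c + 8 * ε := by ring
    _ ≤ _ := by gcongr

/-- A run that is part of a path which could not nearly as well pass through the point `b` of the
chain `g` does not separate `b` from the walls below the chain. -/
lemma IsRun.col_eq {E : Set (Fin T.num)} {S : Set T.Corner}
    (hE : ∀ x y, T.Inner U x y → x.1 ∈ E → T.Passed U S x y ∧ y.1 ∈ E)
    {t : Fin T.num} (hCE : cell U t ⊆ E) {r : Run T} (hr : IsRun (T.Inner U) r)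
    {κ : T.Corner → ZMod 2} (hκ : IsPot (T.Inner U) (cell U t) r.chords κ)
    (hbal : ∀ u v, T.Inner U u v → Balanced r.chords u v)
    {x₀ : T.Corner} {g' : List T.Corner} (hc : (x₀ :: g').IsChain (T.CellNext U))
    (h0 : x₀.1 ∈ cell U t) (hin : ∀ x ∈ x₀ :: g', ∀ y, ¬ T.Inner U x y)
    (hs : r.start.1 ∉ x₀ :: g') (he : r.finish.1 ∉ x₀ :: g') (hrE : r.start.1.1 ∈ E)
    {b : T.Spot} (hb : b ∈ T.points U (x₀ :: g')) {n : T.Node}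
    (hn : n.1.1 = b.1) (hnp : Proper n) (hav : Avoids r.chords b.1 (T.pt n) b.2)
    {s c : T.Spot} {ε : ℝ≥0∞} (hε : ε ≠ 0) (hε' : ε ≠ ⊤)
    (hgap : T.stageDist U S s (nspot r.start) + len r.chords +
      T.stageDist U S (nspot r.finish) c + 8 * ε < T.stageDist U S s b + T.stageDist U S b c) :
    col κ r.chords n = κ x₀ := by
  by_contra hcol
  obtain ⟨x, hx, y, hy, hpts⟩ := hb
  obtain rfl : x₀ = x := by simpa using hx
  have hyg : y ∈ x₀ :: g' := List.mem_of_mem_getLast? hy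
  have hcell := mem_cell_of_isChain hc h0
  have hends : ∀ x ∈ x₀ :: g', ends r.chords x = 0 := fun x hx =>
    hr.isPath.ends_eq_zero inner_symm (hin x hx) (fun h => hs (h ▸ hx)) fun h => he (h ▸ hx)
  have hconst := pot_eq_of_isChain hκ hbal hc h0 hends
  have hcomm := fun x y => gdist_comm (T := T) (inner_joined (U := U)) inner_symm x y
  have htop : T.cellDist U (T.spot x₀) (y.1, T.pos (T.succ y)) ≠ ⊤ := by
    have h1 := cellDist_ne_top (cell_symm h0) (T.pos_mem_tri x₀) (T.pos_mem_tri (t, 0))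
    have h2 := cellDist_ne_top (hcell y hyg) (T.pos_mem_tri (t, 0)) (T.pos_mem_tri (T.succ y))
    exact ne_top_of_le_ne_top (ENNReal.add_ne_top.2 ⟨h1, h2⟩) (gdist_triangle _ _ _)
  have hfin1 : T.cellDist U (T.spot x₀) b ≠ ⊤ := fun h => htop (by rw [← hpts, h, top_add])
  have hfin2 : T.cellDist U (y.1, T.pos (T.succ y)) b ≠ ⊤ := fun h => htop (by
    rw [← hpts, show T.cellDist U b (y.1, T.pos (T.succ y)) = _ from hcomm _ _, ← cellDist, h,
      add_top])
  have hbC : b.1 ∈ cell U t := mem_of_gdist_ne_top (fun x y hxy hx => cell_closed hxy hx) h0 hfin1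
  obtain ⟨c₁, hc₁, z, hz1, hz2, hz⟩ := hr.exists_meet hκ hbal h0 (hin x₀ (by simp))
    (fun h => hs (by simp [h])) (fun h => he (by simp [h])) (left_mem_segment ℝ _ _) hfin1 hn hnp
    hav hcol hε
  obtain ⟨c₂, hc₂, z', hz1', hz2', hz'⟩ := hr.exists_meet hκ hbal (hcell y hyg) (hin y hyg)
    (fun h => hs (by rw [h]; exact hyg)) (fun h => he (by rw [h]; exact hyg))
    (right_mem_segment ℝ _ _) hfin2 hn hnp hav (by rwa [hconst y hyg]) hε
  have hzC : ∀ z : T.Spot, T.cellDist U (T.spot x₀) z ≠ ⊤ → z.1 ∈ E := fun z hz =>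
    hCE (mem_of_gdist_ne_top (fun x y hxy hx => cell_closed hxy hx) h0 hz)
  have h4ε : 4 * ε ≠ ⊤ := ENNReal.mul_ne_top (by norm_num) hε'
  have hzE : z.1 ∈ E := hzC z
    (ne_top_of_le_ne_top (ENNReal.add_ne_top.2 ⟨hfin1, h4ε⟩) (le_self_add.trans hz))
  have hzE' : z'.1 ∈ E := by
    refine hzC z' (ne_top_of_le_ne_top (ENNReal.add_ne_top.2 ⟨htop, ?_⟩)
      (gdist_triangle _ (y.1, T.pos (T.succ y)) _))
    exact ne_top_of_le_ne_top (ENNReal.add_ne_top.2 ⟨hfin2, h4ε⟩) (le_self_add.trans hz')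
  have hm := hr.1.gdist_add_add_le inner_joined hr.proper hr.finish_mem
    (Run.onTrail hc₁ hz1 hz2) (Run.onTrail hc₂ hz1' hz2')
  rw [hr.nspot_finish, ← Run.len_chords] at hm
  rcases hm with hm | hm
  · exact (detour_le hE (hCE hbC) hrE hzE hzE' hε' hpts htop hz hz' hm).not_gt hgap
  · refine (detour_le hE (hCE hbC) hrE hzE' hzE hε' (e := (y.1, T.pos (T.succ y)))
      (e' := T.spot x₀) ?_ ?_ hz' hz hm).not_gt hgap
    · have e1 := hcomm (y.1, T.pos (T.succ y)) b
      have e2 := hcomm b (T.spot x₀)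
      have e3 := hcomm (y.1, T.pos (T.succ y)) (T.spot x₀)
      rw [cellDist, cellDist, cellDist, e1, e2, e3, add_comm]
      exact hpts
    · rw [cellDist, hcomm]; exact htop

lemma ends_append (l l' : List (Chord T)) (x : T.Corner) :
    ends (l ++ l') x = ends l x + ends l' x := cnt_append _ _ _

lemma before_append (l l' : List (Chord T)) (n : T.Node) :
    before (l ++ l') n = before l n + before l' n := cnt_append _ _ _

/-- The colours defined by several runs are the sums of those defined by each of them. -/
lemma exists_pot_of_runs {a x₀ : T.Corner} (ha : T.Gate U a) (n : T.Node) {Rs : List (Run T)}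
    (hr : ∀ r ∈ Rs, IsRun (T.Inner U) r)
    (hbal : ∀ r ∈ Rs, ∀ u v, T.Inner U u v → Balanced r.chords u v)
    (hcol : ∀ r ∈ Rs, ∀ κ, IsPot (T.Inner U) (cell U a.1) r.chords κ →
      col κ r.chords n = κ x₀) :
    ∃ κ, IsPot (T.Inner U) (cell U a.1) (Rs.flatMap Run.chords) κ ∧
      col κ (Rs.flatMap Run.chords) n = κ x₀ := by
  induction Rs with
  | nil => exact ⟨0, ⟨by simp [ends], by simp [ends]⟩, by simp [col, before]⟩
  | cons r Rs ih =>
    obtain ⟨κ, h1, h2⟩ := ih (fun r hr' => hr r (by simp [hr']))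
      (fun r hr' => hbal r (by simp [hr'])) fun r hr' => hcol r (by simp [hr'])
    have hb := hbal r (by simp)
    obtain ⟨κ', h3, h4⟩ := exists_cell_potential ha (j := ends r.chords)
      (fun x y hxy => CharTwo.add_eq_zero.1 (hb x y hxy).1)
      (ends_sum_triangle (hr r (by simp)).isPath.valid)
    have h5 := hcol r (by simp) κ' ⟨h3, h4⟩
    refine ⟨fun x => κ' x + κ x, ⟨fun x hx => ?_, fun x y hx hxy => ?_⟩, ?_⟩
    · rw [h3 x hx, h1.succ_eq x hx, List.flatMap_cons, ends_append]; ring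
    · rw [h4 x y hx hxy, h1.twin_eq x y hx hxy, List.flatMap_cons, ends_append]; ring
    · change _ = κ' x₀ + κ x₀
      rw [← h5, ← h2, col, col, col, List.flatMap_cons, before_append]; ring

end Crossings

/-! ### Stages of the wavefront -/

section Stages

variable {T} {U : Set (Fin T.num)} {o : T.Corner} {d : ℝ} {E : Set (Fin T.num)}
  {S : Set T.Corner} {M : Multiset (List T.Corner)}

lemma passed_joined (x y : T.Corner) (h : T.Passed U S x y) : T.Joined U x y := h.1

lemma passed_symm (x y : T.Corner) (h : T.Passed U S x y) : T.Passed U S y x :=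
  ⟨h.1.symm, h.2.2, h.2.1⟩

lemma DevInv.mem_of_passed (h : DevInv U o E S M) (x y : T.Corner) (hp : T.Passed U S x y) :
    y.1 ∈ E := (h.passed y hp.2.2).1

/-- Sides of entered triangles that have not been passed are on the boundary cycles. -/
lemma IsStage.gate_of_notMem (hM : T.IsStage U o d E S M) {x y : T.Corner} (hj : T.Joined U x y)
    (hx : x.1 ∈ E) (hS : x ∉ S) : T.Gate U x ∧ ¬ T.Struck U o d x := by
  obtain ⟨L, hL, hxL⟩ := mem_cycleSides.1 ((hM.1.inv.side_mem x hx).resolve_left hS)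
  exact hM.2.2 L hL x hxL ⟨y, hj⟩

lemma IsStage.passed_of_mem (hM : T.IsStage U o d E S M) {x y : T.Corner} (hj : T.Joined U x y)
    (hx : x ∈ S) : T.Passed U S x y := by
  obtain ⟨-, y', hy', h⟩ := hM.1.inv.passed x hx
  obtain rfl := hj.unique h
  exact ⟨hj, hx, hy'⟩

/-- A corridor or junction is entered as a whole. -/
lemma IsStage.passed_of_inner (hM : T.IsStage U o d E S M) (x y : T.Corner) (h : T.Inner U x y)
    (hx : x.1 ∈ E) : T.Passed U S x y ∧ y.1 ∈ E := by
  have hS : x ∈ S := by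
    by_contra hS
    exact h.2 (hM.gate_of_notMem h.1 hx hS).1
  have hp := hM.passed_of_mem h.1 hS
  exact ⟨hp, hM.1.inv.mem_of_passed x y hp⟩

lemma not_inner_of_gate {x : T.Corner} (h : T.Gate U x) (y : T.Corner) : ¬ T.Inner U x y :=
  fun hi => hi.2 h

lemma not_inner_of_notMem (hM : T.IsStage U o d E S M) {x : T.Corner} (hx : x.1 ∈ E) (hS : x ∉ S)
    (y : T.Corner) : ¬ T.Inner U x y :=
  fun hi => hS (hM.passed_of_inner x y hi hx).1.2.1

lemma not_inner_of_passed {x y : T.Corner} (h : T.Passed U S x y) (hi : ¬ T.Inner U x y) :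
    (∀ z, ¬ T.Inner U x z) ∧ ∀ z, ¬ T.Inner U y z := by
  have hg : T.Gate U x := by
    by_contra hg
    exact hi ⟨h.1, hg⟩
  exact ⟨not_inner_of_gate hg, not_inner_of_gate (hg.of_joined h.1)⟩

lemma gate_start (hU : ∀ t, D.s ∈ range (T.corner t) → t ∈ U) (ho : T.pos o = D.s) :
    T.Gate U o := by
  obtain ⟨y, hy⟩ := T.exists_joined_of_pos_eq_s hU ho
  exact ⟨y, hy, Or.inl (Or.inr (Or.inl ⟨o.2, ho⟩))⟩

/-- All sides at the source are passed, as they are sides of struck gates. -/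
lemma IsStage.start_mem (hM : T.IsStage U o d E S M) (hU : ∀ t, D.s ∈ range (T.corner t) → t ∈ U)
    (ho : T.pos o = D.s) : o ∈ S := by
  by_contra hS
  obtain ⟨y, hy⟩ := T.exists_joined_of_pos_eq_s hU ho
  refine (hM.gate_of_notMem hy hM.1.inv.start_mem hS).2
    ⟨T.pos o, left_mem_segment ℝ _ _, ?_⟩
  have : T.dist U (T.spot o) (o.1, T.pos o) = 0 := gdist_self (T.pos_mem_tri o)
  rw [this]
  exact zero_le

lemma mem_cell_of_mem_points {t : Fin T.num} {x₀ : T.Corner} {g' : List T.Corner}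
    (hc : (x₀ :: g').IsChain (T.CellNext U)) (h0 : x₀.1 ∈ cell U t) {b : T.Spot}
    (hb : b ∈ T.points U (x₀ :: g')) : b.1 ∈ cell U t ∧ b.2 ∈ T.tri b.1 := by
  obtain ⟨x, hx, y, hy, hpts⟩ := hb
  obtain rfl : x₀ = x := by simpa using hx
  have hyg : y ∈ x₀ :: g' := List.mem_of_mem_getLast? hy
  have h1 := cellDist_ne_top (cell_symm h0) (T.pos_mem_tri x₀) (T.pos_mem_tri (t, 0))
  have h2 := cellDist_ne_top (mem_cell_of_isChain hc h0 y hyg) (T.pos_mem_tri (t, 0))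
    (T.pos_mem_tri (T.succ y))
  have h3 : T.cellDist U (T.spot x₀) b ≠ ⊤ := fun h => by
    have h4 := gdist_triangle (G := T.Inner U) (T.spot x₀) (t, T.pos (t, 0)) (y.1, T.pos (T.succ y))
    rw [← cellDist, ← hpts, h, top_add, top_le_iff] at h4
    exact ENNReal.add_ne_top.2 ⟨h1, h2⟩ h4
  exact ⟨mem_of_gdist_ne_top (fun x y hxy hx => cell_closed hxy hx) h0 h3,
    mem_tri_of_gdist_ne_top inner_joined h3⟩

/-- The colour at the point `b` of a bounding edge, for two paths with a common start that could
not nearly as well pass through `b`, is the colour on the sides below the bounding edge. -/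
lemma IsStage.col_eq (hM : T.IsStage U o d E S M) {k e e' : T.Node} {R R' : List T.Chord}
    (h : IsPath (T.Passed U S) k R e) (h' : IsPath (T.Passed U S) k R' e') (hkE : k.1.1 ∈ E)
    {g : List T.Corner} (hg : T.IsBoundingEdge U g) (hgE : ∀ x ∈ g, x.1 ∈ E)
    (hk : (∀ y, ¬ T.Inner U k.1 y) ∧ k.1 ∉ g) (he : (∀ y, ¬ T.Inner U e.1 y) ∧ e.1 ∉ g)
    (he' : (∀ y, ¬ T.Inner U e'.1 y) ∧ e'.1 ∉ g) (hgS : ∀ x ∈ g, x ∉ S)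
    {κ : T.Corner → ZMod 2} (hκ : IsPot (T.Passed U S) E (R ++ R') κ) {b : T.Spot}
    (hb : b ∈ T.points U g) {n : T.Node} (hn : n.1.1 = b.1) (hnp : Proper n)
    (hav : Avoids (R ++ R') b.1 (T.pt n) b.2) {ε : ℝ≥0∞} (hε : ε ≠ 0) (hε' : ε ≠ ⊤)
    (hgap : len R + 8 * ε < T.stageDist U S (nspot k) b + T.stageDist U S b (nspot e))
    (hgap' : len R' + 8 * ε < T.stageDist U S (nspot k) b + T.stageDist U S b (nspot e')) :
    ∃ x ∈ g, col κ (R ++ R') n = κ x := by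
  obtain ⟨a, x₀, g', rfl, ha, h0, hc, hin⟩ := hg.exists_gate
  refine ⟨x₀, by simp, ?_⟩
  have hE := hM.passed_of_inner
  have hCE : cell U a.1 ⊆ E := by
    have : a.1 ∈ E := cell_subset (hgE x₀ (by simp)) (fun x y hxy hx => (hE x y hxy hx).2)
      (cell_symm h0)
    exact cell_subset this fun x y hxy hx => (hE x y hxy hx).2
  have hbC := (mem_cell_of_mem_points hc h0 hb).1
  have hP : ∀ x y, T.Passed U S x y → ¬ T.Inner U x y →
      ((∀ z, ¬ T.Inner U x z) ∧ x ∉ x₀ :: g') ∧ ((∀ z, ¬ T.Inner U y z) ∧ y ∉ x₀ :: g') :=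
    fun x y hp hi => ⟨⟨(not_inner_of_passed hp hi).1, fun hx => hgS x hx hp.2.1⟩,
      ⟨(not_inner_of_passed hp hi).2, fun hy => hgS y hy hp.2.2⟩⟩
  -- both paths are sequences of runs that do not separate `b` from the sides
  have hruns : ∀ (e : T.Node) (R : List T.Chord), IsPath (T.Passed U S) k R e →
      ((∀ y, ¬ T.Inner U e.1 y) ∧ e.1 ∉ x₀ :: g') → Avoids R b.1 (T.pt n) b.2 →
      len R + 8 * ε < T.stageDist U S (nspot k) b + T.stageDist U S b (nspot e) →
      ∃ Rs : List (Run T), Rs.flatMap Run.chords = R ∧ ∀ r ∈ Rs, IsRun (T.Inner U) r ∧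
        (∀ u v, T.Inner U u v → Balanced r.chords u v) ∧
        ∀ κ, IsPot (T.Inner U) (cell U a.1) r.chords κ → col κ r.chords n = κ x₀ := by
    rintro e R ⟨l, m, hl, hv, rfl⟩ he hav hgap
    obtain ⟨r₀, Rs, h1, h2, h3, h4⟩ := hl.exists_runs passed_joined hP hv he
    refine ⟨r₀ :: Rs, h2, fun r hr => ?_⟩
    obtain ⟨h5, h6, h7⟩ := h4 r hr
    have h8 : (∀ y, ¬ T.Inner U r.start.1 y) ∧ r.start.1 ∉ x₀ :: g' := by
      rcases List.mem_cons.1 hr with rfl | hr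
      · rw [h1]; exact hk
      · exact h3 r hr
    have hbal : ∀ u v, T.Inner U u v → Balanced r.chords u v := fun u v huv =>
      h5.isPath.balanced inner_joined huv.1 (fun hu => h8.1 v (hu ▸ huv))
        (fun hu => h8.1 u (hu ▸ huv.symm)) (fun hu => h6.1 v (hu ▸ huv))
        fun hu => h6.1 u (hu ▸ huv.symm)
    have hfin : T.gdist (T.Passed U S) (nspot k) (nspot r.start) ≠ ⊤ := by
      refine ne_top_of_le_ne_top (ne_top_of_le_ne_top hgap.ne_top le_self_add) (le_trans ?_ h7)
      rw [add_assoc]; exact le_self_add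
    refine ⟨h5, hbal, fun κ hκ => h5.col_eq hE hCE hκ hbal hc h0 hin h8.2 h6.2 ?_ hb hn hnp ?_
      hε hε' ((add_le_add_left h7 _).trans_lt hgap)⟩
    · exact mem_of_gdist_ne_top (fun x y hp _ => hM.1.inv.mem_of_passed x y hp)
        (a := nspot k) hkE hfin
    · intro c hc
      exact hav c (h2 ▸ List.mem_flatMap.2 ⟨r, hr, hc⟩)
  obtain ⟨Rs, hR1, hR2⟩ := hruns e R h he (fun c hc => hav c (by simp [hc])) hgap
  obtain ⟨Rs', hR1', hR2'⟩ := hruns e' R' h' he' (fun c hc => hav c (by simp [hc])) hgap'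
  have hall : ∀ r ∈ Rs ++ Rs', IsRun (T.Inner U) r ∧
        (∀ u v, T.Inner U u v → Balanced r.chords u v) ∧
        ∀ κ, IsPot (T.Inner U) (cell U a.1) r.chords κ → col κ r.chords n = κ x₀ := fun r hr =>
    (List.mem_append.1 hr).elim (hR2 r) (hR2' r)
  obtain ⟨κ', h1, h2⟩ := exists_pot_of_runs (x₀ := x₀) ha n (fun r hr => (hall r hr).1)
    (fun r hr => (hall r hr).2.1) fun r hr => (hall r hr).2.2
  rw [List.flatMap_append, hR1, hR1'] at h1 h2
  have hκC : IsPot (T.Inner U) (cell U a.1) (R ++ R') κ :=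
    ⟨fun x hx => hκ.succ_eq x (hCE hx), fun x y hx hxy =>
      hκ.twin_eq x y (hCE hx) (hE x y hxy (hCE hx)).1⟩
  have h3 := hκC.add_eq h1 h0 (y := n.1) (hn ▸ hbC)
  rw [col] at h2 ⊢
  linear_combination h2 - h3 + two_self (κ' x₀) - two_self (κ' n.1)

end Stages

/-! ### Shortest paths do not cross -/

section NonCrossing

variable {T} {U : Set (Fin T.num)} {G : T.Corner → T.Corner → Prop}

/-- The slack `ε` is used up to 14 times below. -/
lemma exists_gap {a b : ℝ≥0∞} (h : a < b) : ∃ ε : ℝ≥0∞, ε ≠ 0 ∧ ε ≠ ⊤ ∧ a + 16 * ε < b := by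
  obtain ⟨c, hac, hcb⟩ := exists_between h
  have hc : c ≠ ⊤ := hcb.ne_top
  refine ⟨(c - a) / 16, ?_, ?_, ?_⟩
  · simpa using (tsub_pos_of_lt hac).ne'
  · exact ENNReal.div_ne_top (ENNReal.sub_ne_top hc) (by norm_num)
  · rwa [ENNReal.mul_div_cancel (by norm_num) (by norm_num), add_tsub_cancel_of_le hac.le]

lemma IsPath.gdist_add_le (hG : ∀ x y, G x y → T.Joined U x y) {k e : T.Node} {R : List T.Chord}
    (h : IsPath G k R e) {c : T.Chord} (hc : c ∈ R) {z : T.Spot} (h1 : z.1 = c.1.1.1)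
    (h2 : z.2 ∈ seg c) :
    T.gdist G (nspot k) z + T.gdist G z (nspot e) ≤ len R := by
  have hk := h.proper
  obtain ⟨l, m, hl, hv, rfl⟩ := h
  have hr : IsRun G ⟨k, l, m, e⟩ := ⟨hl, hv⟩
  have := hl.gdist_add_le hG hk hr.finish_mem (Run.onTrail (r := ⟨k, l, m, e⟩) hc h1 h2)
  rw [hr.nspot_finish] at this
  exact this.trans (Run.len_chords ⟨k, l, m, e⟩).ge

/-- Nearly shortest paths in general position. -/
lemma exists_isPath (hG : ∀ x y, G x y → T.Joined U x y) {a b : T.Spot} (h : T.gdist G a b ≠ ⊤)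
    {k e : T.Node} (hka : k.1.1 = a.1) (heb : e.1.1 = b.1) (hk : Proper k) (he : Proper e)
    {ε : ℝ≥0∞} (hε : ε ≠ 0) (hak : edist a.2 (T.pt k) ≤ ε) (hbe : edist b.2 (T.pt e) ≤ ε) :
    ∃ R, IsPath G k R e ∧ len R ≤ T.gdist G a b + 4 * ε := by
  obtain ⟨ℓ, h1, h2⟩ := exists_route_le h hε
  obtain ⟨l, m, h3, h4, h5⟩ := h1.exists_trail hG hka hk hε
  refine ⟨l ++ [(m, e)], ⟨l, m, h3, ⟨h4.trans heb.symm, h3.proper hk, he⟩, rfl⟩, ?_⟩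
  rw [len_append, len_cons, len_nil, add_zero]
  refine (h5 _ (heb ▸ pt_mem_tri he)).trans ?_
  calc ℓ + edist a.2 (T.pt k) + edist b.2 (T.pt e) + ε
      ≤ (T.gdist G a b + ε) + ε + ε + ε := by gcongr
    _ = _ := by ring

lemma exists_trail_to (hG : ∀ x y, G x y → T.Joined U x y) {a b : T.Spot} (h : T.gdist G a b ≠ ⊤)
    {k : T.Node} (hka : k.1.1 = a.1) (hk : Proper k) {ε : ℝ≥0∞} (hε : ε ≠ 0)
    (hak : edist a.2 (T.pt k) ≤ ε) :
    ∃ l m, Trail G k l m ∧ m.1.1 = b.1 ∧ len l + edist (T.pt m) b.2 ≤ T.gdist G a b + 3 * ε := by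
  obtain ⟨ℓ, h1, h2⟩ := exists_route_le h hε
  obtain ⟨l, m, h3, h4, h5⟩ := h1.exists_trail hG hka hk hε
  refine ⟨l, m, h3, h4, (h5 _ (h1.mem_tri hG)).trans ?_⟩
  rw [edist_self, add_zero]
  calc ℓ + edist a.2 (T.pt k) + ε ≤ (T.gdist G a b + ε) + ε + ε := by gcongr
    _ = _ := by ring

/-- A nearly shortest path to `c` cannot nearly as well pass through `b` if `v` is on a shortest
path to `b`, but not to `c`. -/
lemma gap_of_via (hc : ∀ a b, T.gdist G a b = T.gdist G b a) {s c v b k e : T.Spot}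
    {ε m : ℝ≥0∞} (hm : m ≤ T.gdist G s c + 4 * ε)
    (hb : T.gdist G s b = T.gdist G s v + T.gdist G v b)
    (hgap : T.gdist G s c + 16 * ε < T.gdist G s v + T.gdist G v c) (hk : T.gdist G s k ≤ ε)
    (he : T.gdist G c e ≤ ε) : m + 8 * ε < T.gdist G k b + T.gdist G b e := by
  by_contra! hcon
  refine hgap.not_ge ?_
  calc T.gdist G s v + T.gdist G v c ≤ T.gdist G s v + (T.gdist G v b + T.gdist G b c) := by
        gcongr; exact gdist_triangle _ _ _
    _ = T.gdist G s b + T.gdist G b c := by rw [hb, add_assoc]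
    _ ≤ (T.gdist G s k + T.gdist G k b) + (T.gdist G b e + T.gdist G e c) :=
        add_le_add (gdist_triangle _ _ _) (gdist_triangle _ _ _)
    _ = (T.gdist G k b + T.gdist G b e) + (T.gdist G s k + T.gdist G c e) := by
        rw [hc e c]; ring
    _ ≤ (T.gdist G s c + 4 * ε + 8 * ε) + (ε + ε) :=
        add_le_add (hcon.trans (add_le_add_left hm _)) (add_le_add hk he)
    _ = T.gdist G s c + 14 * ε := by ring
    _ ≤ T.gdist G s c + 16 * ε := by gcongr; norm_num

/-- Nearly shortest paths from the source to `c` and from `v` to `b` do not meet if `v` is on a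
shortest path to `b`, but not to `c`. -/
lemma not_meet_of_via (hc : ∀ a b, T.gdist G a b = T.gdist G b a) {s c v b k e n z : T.Spot}
    {ε m m' : ℝ≥0∞} (hm : m ≤ T.gdist G s c + 4 * ε) (hm' : m' ≤ T.gdist G v b + 3 * ε)
    (hε : ε ≠ ⊤) (hb : T.gdist G s b = T.gdist G s v + T.gdist G v b) (hbt : T.gdist G s b ≠ ⊤)
    (hgap : T.gdist G s c + 16 * ε < T.gdist G s v + T.gdist G v c) (hk : T.gdist G s k ≤ ε)
    (he : T.gdist G c e ≤ ε) (hn : T.gdist G v n ≤ ε)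
    (h1 : T.gdist G k z + T.gdist G z e ≤ m) (h2 : T.gdist G n z + T.gdist G z b ≤ m') : False := by
  have hzb : T.gdist G z b ≠ ⊤ := by
    refine ne_top_of_le_ne_top ?_ (le_add_self.trans (h2.trans hm'))
    refine ENNReal.add_ne_top.2 ⟨fun h => hbt (by rw [hb, h, add_top]), ?_⟩
    exact ENNReal.mul_ne_top (by norm_num) hε
  refine hgap.not_ge (ENNReal.le_of_add_le_add_right hzb ?_)
  calc T.gdist G s v + T.gdist G v c + T.gdist G z b
      ≤ T.gdist G s v + (T.gdist G v n + (T.gdist G n z + (T.gdist G z e + T.gdist G e c))) +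
        T.gdist G z b := by
        gcongr
        refine (gdist_triangle _ n _).trans (add_le_add_right ((gdist_triangle _ z _).trans
          (add_le_add_right (gdist_triangle _ _ _) _)) _)
    _ = T.gdist G s v + (T.gdist G n z + T.gdist G z b) + T.gdist G z e +
        (T.gdist G v n + T.gdist G c e) := by rw [hc e c]; ring
    _ ≤ T.gdist G s v + (T.gdist G v b + 3 * ε) + T.gdist G z e + (ε + ε) := by
        exact add_le_add (add_le_add_left (add_le_add_right (h2.trans hm') _) _) (add_le_add hn he)
    _ = T.gdist G s b + T.gdist G z e + 5 * ε := by rw [hb]; ring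
    _ ≤ (T.gdist G s k + (T.gdist G k z + T.gdist G z b)) + T.gdist G z e + 5 * ε := by
        gcongr
        exact (gdist_triangle _ k _).trans (add_le_add_right (gdist_triangle _ _ _) _)
    _ = T.gdist G s k + (T.gdist G k z + T.gdist G z e) + 5 * ε + T.gdist G z b := by ring
    _ ≤ ε + (T.gdist G s c + 4 * ε) + 5 * ε + T.gdist G z b := by
        exact add_le_add_left (add_le_add_left (add_le_add hk (h1.trans hm)) _) _
    _ = T.gdist G s c + 10 * ε + T.gdist G z b := by ring
    _ ≤ T.gdist G s c + 16 * ε + T.gdist G z b := by gcongr; norm_num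

open Classical in
/-- A path ends on a side that is not glued to another one only if it is its last side. -/
lemma IsPath.ends_eq (hs : ∀ x y, G x y → G y x) {k e : T.Node} {R : List T.Chord}
    (h : IsPath G k R e) {w : T.Corner} (hw : ∀ y, ¬ G w y) (hk : k.1 ≠ w) :
    ends R w = if e.1 = w then 1 else 0 := by
  rw [ends, h.cnt_eq, if_neg hk, zero_add]
  rintro k k' - - ⟨hk, -⟩
  rw [if_neg fun h => hw _ (h ▸ hk), if_neg fun h => hw _ (h ▸ hs _ _ hk), zero_add]

/-- The colours along a closed walk that changes its colour at two sides only, `x` and `x'`; for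
the latter this is implied, as the walk is closed. -/
lemma Walk.eq_of_two {κ j : T.Corner → ZMod 2} {x x' : T.Corner} {p q : List T.Corner} {a : ZMod 2}
    (h : Walk κ j (x :: (p ++ x' :: q)) a a) (hx : j x = 1)
    (hp : ∀ y ∈ p, j y = 0) (hq : ∀ y ∈ q, j y = 0) :
    (∀ y ∈ p, κ y = a + 1) ∧ ∀ y ∈ q, κ y = a := by
  obtain ⟨c, h1, h2⟩ := walk_append.1 h.2
  obtain ⟨h3, h4⟩ := h1.const hp
  obtain ⟨h5, h6⟩ := h2.2.const hq
  rw [hx] at h4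
  refine ⟨h4, fun y hy => ?_⟩
  rw [h6 y hy, ← h5]

lemma Walk.exists_of_isRotated {κ j : T.Corner → ZMod 2} {l l' : List T.Corner} (hl : l ~r l')
    (h : ∃ a, Walk κ j l a a) : ∃ a, Walk κ j l' a a := by
  obtain ⟨n, hn, rfl⟩ := List.isRotated_iff_mod.1 hl
  obtain ⟨a, h⟩ := h
  rw [List.rotate_eq_drop_append_take hn]
  rw [← List.take_append_drop n l, walk_append] at h
  obtain ⟨c, h1, h2⟩ := h
  exact ⟨c, walk_append.2 ⟨a, h2, h1⟩⟩

end NonCrossing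

section NonCrossingStage

variable {T} {U : Set (Fin T.num)} {o : T.Corner} {d : ℝ} {E : Set (Fin T.num)}
  {S : Set T.Corner} {M : Multiset (List T.Corner)}

lemma DevInv.stageDist_ne_top (h : DevInv U o E S M) {b : T.Spot} (hb : b.1 ∈ E)
    (hb' : b.2 ∈ T.tri b.1) : T.stageDist U S (T.spot o) b ≠ ⊤ := h.connected b.1 hb b.2 hb'

lemma IsStage.mem_of_mem_points (hM : T.IsStage U o d E S M) {g : List T.Corner}
    (hg : T.IsBoundingEdge U g) (hgE : ∀ x ∈ g, x.1 ∈ E) {b : T.Spot} (hb : b ∈ T.points U g) :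
    b.1 ∈ E ∧ b.2 ∈ T.tri b.1 := by
  obtain ⟨a, x₀, g', rfl, -, h0, hc, -⟩ := hg.exists_gate
  obtain ⟨h1, h2⟩ := mem_cell_of_mem_points hc h0 hb
  have hE := fun x y hxy hx => (hM.passed_of_inner x y hxy hx).2
  exact ⟨cell_subset (cell_subset (hgE x₀ (by simp)) hE (cell_symm h0)) hE h1, h2⟩

lemma nodup_of_mem {L : List T.Corner} (hL : L ∈ M) (h : (cycleSides M).Nodup) :
    L.Nodup ∧ ∀ L' ∈ M, L' ≠ L → ∀ x ∈ L, x ∉ L' := by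
  obtain ⟨M', rfl⟩ := Multiset.exists_cons_of_mem hL
  rw [cycleSides_cons, Multiset.nodup_add] at h
  refine ⟨Multiset.coe_nodup.1 h.1, fun L' hL' hne x hx hx' => ?_⟩
  exact Multiset.disjoint_left.1 h.2.2 (Multiset.mem_coe.2 hx)
    (mem_cycleSides.2 ⟨L', (Multiset.mem_cons.1 hL').resolve_left hne, hx'⟩)

/-- If two points of a boundary cycle do not have a shortest path to the source via `v`, then the
shortest paths from the source to them separate the two parts of the boundary cycle between them,
so that `v` cannot be on shortest paths to both parts. -/
lemma IsStage.not_via_both (hM : T.IsStage U o d E S M)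
    (hU : ∀ t, D.s ∈ range (T.corner t) → t ∈ U) (ho : T.pos o = D.s) {L : List T.Corner}
    (hL : L ∈ M) {x x' : T.Corner} {p q : List T.Corner} (hrot : L ~r x :: (p ++ x' :: q))
    {v : T.Corner} {g g' : List T.Corner} (hg : T.IsBoundingEdge U g)
    (hg' : T.IsBoundingEdge U g') (hgp : ∀ y ∈ g, y ∈ p) (hgq : ∀ y ∈ g', y ∈ q) {b b' : T.Spot}
    (hb : b ∈ T.points U g) (hb' : b' ∈ T.points U g') (hvb : T.Via U o S v b)
    (hvb' : T.Via U o S v b') (hvx : ¬ T.Via U o S v (T.spot x))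
    (hvx' : ¬ T.Via U o S v (T.spot x')) : False := by
  classical
  have hinv := hM.1.inv
  -- the sides of the boundary cycle
  have hmem : ∀ y ∈ x :: (p ++ x' :: q), y.1 ∈ E ∧ y ∉ S := fun y hy =>
    hinv.cycle_mem y (mem_cycleSides.2 ⟨L, hL, hrot.mem_iff.2 hy⟩)
  have hnd := hrot.nodup_iff.1 (nodup_of_mem hL hinv.nodup).1
  have hxE := hmem x (by simp)
  have hxE' := hmem x' (by simp)
  have hp : ∀ y ∈ p, y.1 ∈ E ∧ y ∉ S := fun y hy => hmem y (by simp [hy])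
  have hq : ∀ y ∈ q, y.1 ∈ E ∧ y ∉ S := fun y hy => hmem y (by simp [hy])
  simp only [List.nodup_cons, List.mem_append, List.mem_cons, not_or, List.nodup_append] at hnd
  obtain ⟨⟨hxp, hxx, hxq⟩, hndp, ⟨hxq', hndq⟩, hdisj⟩ := hnd
  have hxp' : x' ∉ p := fun h => hdisj x' h x' (Or.inl rfl) rfl
  have hoS := hM.start_mem hU ho
  -- distances
  have hcomm := fun a b => gdist_comm (T := T) (passed_joined (U := U) (S := S)) passed_symm a b
  have hfin : ∀ y : T.Corner, y.1 ∈ E → T.stageDist U S (T.spot o) (T.spot y) ≠ ⊤ := fun y hy =>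
    hinv.stageDist_ne_top hy (T.pos_mem_tri y)
  have hbE := hM.mem_of_mem_points hg (fun y hy => (hp y (hgp y hy)).1) hb
  have hbE' := hM.mem_of_mem_points hg' (fun y hy => (hq y (hgq y hy)).1) hb'
  have hbt := hinv.stageDist_ne_top hbE.1 hbE.2
  have hbt' := hinv.stageDist_ne_top hbE'.1 hbE'.2
  have hvt : T.stageDist U S (T.spot o) (T.spot v) ≠ ⊤ := fun h => hbt (by rw [hvb, h, top_add])
  have hvb1 : T.stageDist U S (T.spot v) b ≠ ⊤ := fun h => hbt (by rw [hvb, h, add_top])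
  have hvb1' : T.stageDist U S (T.spot v) b' ≠ ⊤ := fun h => hbt' (by rw [hvb', h, add_top])
  have hvE : v.1 ∈ E := mem_of_gdist_ne_top (fun x y hp _ => hinv.mem_of_passed x y hp)
    (a := T.spot o) hinv.start_mem hvt
  have hlt : T.stageDist U S (T.spot o) (T.spot x) <
      T.stageDist U S (T.spot o) (T.spot v) + T.stageDist U S (T.spot v) (T.spot x) :=
    (gdist_triangle _ _ _).lt_of_ne hvx
  have hlt' : T.stageDist U S (T.spot o) (T.spot x') <
      T.stageDist U S (T.spot o) (T.spot v) + T.stageDist U S (T.spot v) (T.spot x') :=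
    (gdist_triangle _ _ _).lt_of_ne hvx'
  obtain ⟨ε, hε, hε', hgap, hgap'⟩ : ∃ ε : ℝ≥0∞, ε ≠ 0 ∧ ε ≠ ⊤ ∧
      T.stageDist U S (T.spot o) (T.spot x) + 16 * ε <
        T.stageDist U S (T.spot o) (T.spot v) + T.stageDist U S (T.spot v) (T.spot x) ∧
      T.stageDist U S (T.spot o) (T.spot x') + 16 * ε <
        T.stageDist U S (T.spot o) (T.spot v) + T.stageDist U S (T.spot v) (T.spot x') := by
    obtain ⟨ε₁, h1, h2, h3⟩ := exists_gap hlt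
    obtain ⟨ε₂, h1', h2', h3'⟩ := exists_gap hlt'
    refine ⟨min ε₁ ε₂, ?_, (min_le_left _ _).trans_lt h2.lt_top |>.ne, ?_, ?_⟩
    · exact (lt_min (pos_iff_ne_zero.2 h1) (pos_iff_ne_zero.2 h1')).ne'
    · refine lt_of_le_of_lt ?_ h3
      gcongr; exact min_le_left _ _
    · refine lt_of_le_of_lt ?_ h3'
      gcongr; exact min_le_right _ _
  -- nearly shortest paths in general position
  have hnode : ∀ y : T.Corner, ∃ n : T.Node, n.1 = y ∧ Proper n ∧ edist (T.pos y) (T.pt n) ≤ ε :=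
    fun y => exists_node_near y (left_mem_segment ℝ _ _) hε
  have hnear : ∀ n : T.Node, Proper n → edist (T.pos n.1) (T.pt n) ≤ ε →
      T.stageDist U S (T.spot n.1) (nspot n) ≤ ε := fun n hn h =>
    (gdist_le_edist (T.pos_mem_tri _) (pt_mem_tri hn)).trans h
  obtain ⟨k, hko, hk, hkε⟩ := hnode o
  obtain ⟨e, hex, he, heε⟩ := hnode x
  obtain ⟨e', hex', he', heε'⟩ := hnode x'
  obtain ⟨n, hnv, hn, hnε⟩ := hnode v
  subst hko hex hex' hnv
  obtain ⟨R, hR, hRl⟩ := exists_isPath passed_joined (hfin e.1 hxE.1) (k := k) (e := e)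
    rfl rfl hk he hε hkε heε
  obtain ⟨R', hR', hRl'⟩ := exists_isPath passed_joined (hfin e'.1 hxE'.1) (k := k) (e := e')
    rfl rfl hk he' hε hkε heε'
  have hkd := hnear k hk hkε
  have hnd' := hnear n hn hnε
  have hed := hnear e he heε
  have hed' := hnear e' he' heε'
  -- the colours defined by the two paths from the source
  set B := R ++ R' with hB
  have hvalid : ∀ c ∈ B, ValidChord c := fun c hc =>
    (List.mem_append.1 hc).elim (hR.valid c) (hR'.valid c)
  have hbal : ∀ y z, T.Passed U S y z → Balanced B y z := fun y z hyz =>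
    hR.balanced_append passed_joined hR' hyz.1 (fun h => hxE.2 (h ▸ hyz.2.1))
      (fun h => hxE.2 (h ▸ hyz.2.2)) (fun h => hxE'.2 (h ▸ hyz.2.1))
      fun h => hxE'.2 (h ▸ hyz.2.2)
  have hends : ∀ y : T.Corner, y ∉ S →
      ends B y = (if e.1 = y then 1 else 0) + if e'.1 = y then 1 else 0 := fun y hy => by
    have hw : ∀ z, ¬ T.Passed U S y z := fun z hz => hy hz.2.1
    have hky : k.1 ≠ y := fun h => hy (h ▸ hoS)
    rw [hB, ends_append, hR.ends_eq passed_symm hw hky, hR'.ends_eq passed_symm hw hky]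
  have hje : ends B e.1 = 1 := by
    rw [hends _ hxE.2, if_pos rfl, if_neg (Ne.symm hxx), add_zero]
  have hje' : ends B e'.1 = 1 := by
    rw [hends _ hxE'.2, if_neg hxx, if_pos rfl, zero_add]
  have hj0 : ∀ y : T.Corner, y ∉ S → e.1 ≠ y → e'.1 ≠ y → ends B y = 0 := fun y hy h1 h2 => by
    rw [hends y hy, if_neg h1, if_neg h2, add_zero]
  have hjp : ∀ y ∈ p, ends B y = 0 := fun y hy =>
    hj0 y (hp y hy).2 (fun h => hxp (h ▸ hy)) fun h => hxp' (h ▸ hy)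
  have hjq : ∀ y ∈ q, ends B y = 0 := fun y hy =>
    hj0 y (hq y hy).2 (fun h => hxq (h ▸ hy)) fun h => hxq' (h ▸ hy)
  have hsum0 : ∀ l : List T.Corner, (∀ y ∈ l, ends B y = 0) → (l.map (ends B)).sum = 0 :=
    fun l hl => List.sum_eq_zero fun a ha => by
      obtain ⟨y, hy, rfl⟩ := List.mem_map.1 ha
      exact hl y hy
  obtain ⟨κ, hκ1, hκ2, hκ3⟩ := hM.1.exists_potential (j := ends B)
    (fun y z h => CharTwo.add_eq_zero.1 (hbal y z h).1) (ends_sum_triangle hvalid) (by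
      intro L' hL'
      by_cases hne : L' = L
      · rw [hne, (hrot.perm.map _).sum_eq]
        simp only [List.map_cons, List.map_append, List.sum_cons, List.sum_append, hje, hje',
          hsum0 p hjp, hsum0 q hjq]
        rfl
      · have h1 := (nodup_of_mem hL hinv.nodup).2 L' hL' hne
        refine hsum0 _ fun y hy => hj0 y (hinv.cycle_mem y (mem_cycleSides.2 ⟨L', hL', hy⟩)).2
          (fun h => h1 e.1 (hrot.mem_iff.2 (by simp)) (h ▸ hy))
          fun h => h1 e'.1 (hrot.mem_iff.2 (by simp)) (h ▸ hy))
  have hκ : IsPot (T.Passed U S) E B κ := ⟨hκ1, fun y z _ h => hκ2 y z h⟩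
  obtain ⟨a, hwalk⟩ := Walk.exists_of_isRotated hrot (hκ3 L hL)
  obtain ⟨hcp, hcq⟩ := hwalk.eq_of_two hje hjp hjq
  -- the colour of `v` is the colour below each of the two bounding edges
  have key : ∀ (g : List T.Corner) (b : T.Spot), T.IsBoundingEdge U g →
      (∀ y ∈ g, y.1 ∈ E ∧ y ∉ S ∧ y ≠ e.1 ∧ y ≠ e'.1) → b ∈ T.points U g →
      T.Via U k.1 S n.1 b → T.stageDist U S (T.spot k.1) b ≠ ⊤ →
      T.stageDist U S (T.spot n.1) b ≠ ⊤ → ∃ y ∈ g, col κ B n = κ y := by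
    intro g b hg hgm hb hvia hbt hvb
    obtain ⟨l, m, hl, hmb, hlen⟩ := exists_trail_to passed_joined hvb (k := n) rfl hn hε hnε
    have hbE := hM.mem_of_mem_points hg (fun y hy => (hgm y hy).1) hb
    have havoid : ∀ z : T.Spot, OnTrail l m b.2 z → ∀ c ∈ B, z.1 = c.1.1.1 → z.2 ∉ seg c := by
      intro z hz c hc hz1 hz2
      have h2 := hl.gdist_add_le passed_joined hn (hmb ▸ hbE.2) hz
      rw [hmb] at h2
      rcases List.mem_append.1 hc with hc | hc
      · exact not_meet_of_via hcomm hRl hlen hε' hvia hbt hgap hkd hed hnd'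
          (hR.gdist_add_le passed_joined hc hz1 hz2) h2
      · exact not_meet_of_via hcomm hRl' hlen hε' hvia hbt hgap' hkd hed' hnd'
          (hR'.gdist_add_le passed_joined hc hz1 hz2) h2
    have hav1 : ∀ c ∈ l, Avoids B c.1.1.1 (T.pt c.1) (T.pt c.2) := by
      intro c hc c' hc' ht
      rw [Set.disjoint_left]
      intro r hr hr'
      exact havoid (c.1.1.1, r) (Or.inl ⟨c, hc, rfl, hr'⟩) c' hc' ht.symm hr
    have hav2 : Avoids B b.1 (T.pt m) b.2 := by
      intro c' hc' ht
      rw [Set.disjoint_left]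
      intro r hr hr'
      exact havoid (b.1, r) (Or.inr ⟨hmb.symm, hr'⟩) c' hc' ht.symm hr
    obtain ⟨h1, h2⟩ := hl.col_eq (fun x y hp _ => hinv.mem_of_passed x y hp) hvalid hκ hbal hvE hav1
    rw [h1]
    exact hM.col_eq hR hR' hinv.start_mem hg (fun y hy => (hgm y hy).1)
      ⟨not_inner_of_gate (gate_start hU ho), fun h => (hgm _ h).2.1 hoS⟩
      ⟨not_inner_of_notMem hM hxE.1 hxE.2, fun h => (hgm _ h).2.2.1 rfl⟩
      ⟨not_inner_of_notMem hM hxE'.1 hxE'.2, fun h => (hgm _ h).2.2.2 rfl⟩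
      (fun y hy => (hgm y hy).2.1) hκ hb hmb (hl.proper hn) hav2 hε hε'
      (gap_of_via hcomm hRl hvia hgap hkd hed) (gap_of_via hcomm hRl' hvia hgap' hkd hed')
  obtain ⟨y, hy, h1⟩ := key g b hg (fun y hy => ⟨(hp y (hgp y hy)).1, (hp y (hgp y hy)).2,
    fun h => hxp (h ▸ hgp y hy), fun h => hxp' (h ▸ hgp y hy)⟩) hb hvb hbt hvb1
  obtain ⟨y', hy', h2⟩ := key g' b' hg' (fun y hy => ⟨(hq y (hgq y hy)).1, (hq y (hgq y hy)).2,
    fun h => hxq (h ▸ hgq y hy), fun h => hxq' (h ▸ hgq y hy)⟩) hb' hvb' hbt' hvb1'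
  rw [h1, hcp y (hgp y hy), hcq y' (hgq y' hy')] at h2
  simp at h2

end NonCrossingStage

/-! ### Contiguous parts of cyclic sequences -/

section Cyclic

variable {α : Type*} {Γ : List α} {X : α → Prop}

/-- No two elements outside `X` separate two elements of `X` on the cyclic sequence. -/
def Unseparated (Γ : List α) (X : α → Prop) : Prop :=
  ∀ (k : ℕ) (h : α) (l : List α) (h' : α) (l' : List α), Γ.rotate k = h :: (l ++ h' :: l') →
    ¬ X h → ¬ X h' → (∃ g ∈ l, X g) → ¬ ∃ g ∈ l', X g

lemma Contiguous.of_rotate {i : ℕ} (h : Contiguous (Γ.rotate i) X) : Contiguous Γ X := by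
  obtain ⟨k, l₁, l₂, h1, h2⟩ := h
  exact ⟨i + k, l₁, l₂, by rwa [← List.rotate_rotate], h2⟩

lemma Unseparated.contiguous (hX : Unseparated Γ X) : Contiguous Γ X := by
  classical
  by_cases hall : ∀ g ∈ Γ, X g
  · exact ⟨0, Γ, [], by simp, hall, by simp⟩
  push Not at hall
  obtain ⟨h, hΓ, hh⟩ := hall
  obtain ⟨s, t, rfl⟩ := List.append_of_mem hΓ
  have hrot : (s ++ h :: t).rotate s.length = h :: (t ++ s) := by
    rw [List.rotate_append_length_eq, List.cons_append]
  refine Contiguous.of_rotate (i := s.length) ?_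
  rw [hrot]
  set m := t ++ s
  -- the elements of `X` after `h` begin after `a` and extend to the end of `b`
  set a := m.takeWhile (fun g => !decide (X g)) with ha
  set c := m.dropWhile (fun g => !decide (X g)) with hc
  set b := c.takeWhile (fun g => X g) with hb
  set e := c.dropWhile (fun g => X g) with he
  have hm : m = a ++ c := List.takeWhile_append_dropWhile.symm
  have hcbe : c = b ++ e := List.takeWhile_append_dropWhile.symm
  have hbX : ∀ g ∈ b, X g := fun g hg => by simpa using List.mem_takeWhile_imp hg
  have haX : ∀ g ∈ a, ¬ X g := fun g hg => by simpa using List.mem_takeWhile_imp hg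
  have heX : ∀ g ∈ e, ¬ X g := by
    intro g hg hXg
    have hene : e ≠ [] := List.ne_nil_of_mem hg
    have hcne : c ≠ [] := fun h0 => hene (by rw [he, h0]; rfl)
    have h1 : ¬ X (e.head hene) := by
      simpa using List.head_dropWhile_not (p := fun g => decide (X g)) hene
    have h2 : X (c.head hcne) := by
      simpa using List.head_dropWhile_not (p := fun g => !decide (X g)) hcne
    have hbne : c.head hcne ∈ b := by
      rw [hb]
      obtain ⟨y, ys, hy⟩ := List.exists_cons_of_ne_nil hcne
      simp only [hy, List.head_cons] at h2 ⊢
      simp [h2]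
    obtain ⟨h', e', hee⟩ := List.exists_cons_of_ne_nil hene
    simp only [hee, List.head_cons] at h1
    refine hX s.length h (a ++ b) h' e' ?_ hh h1 ⟨_, by simp [hbne], h2⟩ ⟨g, ?_, hXg⟩
    · rw [hrot, hm, hcbe, hee, List.append_assoc]
    · rw [hee] at hg
      rcases List.mem_cons.1 hg with rfl | hg
      · exact absurd hXg h1
      · exact hg
  refine ⟨(h :: a).length, b, e ++ (h :: a), ?_, hbX, ?_⟩
  · rw [hm, hcbe, ← List.cons_append, List.rotate_append_length_eq, List.append_assoc]
  · intro g hg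
    rcases List.mem_append.1 hg with hg | hg
    · exact heX g hg
    · rcases List.mem_cons.1 hg with rfl | hg
      · exact hh
      · exact haX g hg

/-- Unseparated sets with a common element have an unseparated union. -/
lemma Unseparated.union {ι : Type*} {I : ι → Prop} {Y : ι → α → Prop}
    (hY : ∀ i, I i → Unseparated Γ (Y i)) {C : α} (hC : C ∈ Γ) (hCY : ∀ i, I i → Y i C) :
    Unseparated Γ fun g => ∃ i, I i ∧ Y i g := by
  rintro k h l h' l' hrot hh hh' ⟨g, hg, i, hi, hgi⟩ ⟨g', hg', i', hi', hgi'⟩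
  have hn : ∀ i, I i → ¬ Y i h ∧ ¬ Y i h' := fun i hi =>
    ⟨fun hy => hh ⟨i, hi, hy⟩, fun hy => hh' ⟨i, hi, hy⟩⟩
  have hC' : C ∈ h :: (l ++ h' :: l') := hrot ▸ List.mem_rotate.2 hC
  simp only [List.mem_cons, List.mem_append] at hC'
  rcases hC' with rfl | hC' | rfl | hC'
  · exact (hn i hi).1 (hCY i hi)
  · exact hY i' hi' k h l h' l' hrot (hn i' hi').1 (hn i' hi').2 ⟨C, hC', hCY i' hi'⟩
      ⟨g', hg', hgi'⟩
  · exact (hn i hi).2 (hCY i hi)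
  · exact hY i hi k h l h' l' hrot (hn i hi).1 (hn i hi).2 ⟨g, hg, hgi⟩ ⟨C, hC', hCY i hi⟩

lemma flatten_rotate_isRotated {β : Type*} (Γ : List (List β)) (k : ℕ) :
    Γ.flatten ~r (Γ.rotate k).flatten := by
  rw [List.rotate_eq_drop_append_take_mod, List.flatten_append]
  conv_lhs => rw [← List.take_append_drop (k % Γ.length) Γ, List.flatten_append]
  exact List.isRotated_append

end Cyclic

/-! ### Shortest paths via a vertex -/

section Associated

variable {T} {U : Set (Fin T.num)} {o : T.Corner} {d : ℝ} {E : Set (Fin T.num)}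
  {S : Set T.Corner} {M : Multiset (List T.Corner)}

variable (U o S) in
/-- Some point of the bounding edge `g` has a shortest path to the source via `v`. -/
def Assoc (g : List T.Corner) (v : T.Corner) : Prop := ∃ b ∈ T.points U g, T.Via U o S v b

/-- A bounding edge contains the first corner of its first side, so that this corner has no
shortest path via `v` if the bounding edge is not associated with `v`. -/
lemma IsStage.unseparated (hM : T.IsStage U o d E S M)
    (hU : ∀ t, D.s ∈ range (T.corner t) → t ∈ U) (ho : T.pos o = D.s) {Γ : List (List T.Corner)}
    (hΓ : T.IsBoundaryCycle U M Γ) (v : T.Corner) : Unseparated Γ fun g => Assoc U o S g v := by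
  rintro k h l h' l' hrot hh hh' ⟨g, hg, b, hb, hvb⟩ ⟨g', hg', b', hb', hvb'⟩
  obtain ⟨⟨L, hL, -, hLΓ⟩, hbe⟩ := hΓ
  have hbe' : ∀ g ∈ h :: (l ++ h' :: l'), T.IsBoundingEdge U g := fun g hg =>
    hbe g (List.mem_rotate.1 (hrot ▸ hg))
  have hhead : ∀ g, T.IsBoundingEdge U g → ¬ Assoc U o S g v →
      ∃ x g', g = x :: g' ∧ ¬ T.Via U o S v (T.spot x) := by
    intro g hg hn
    obtain ⟨-, x, g', rfl, -⟩ := hg.exists_gate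
    refine ⟨x, g', rfl, fun hv => hn ⟨T.spot x, ⟨x, rfl, (x :: g').getLast (by simp),
      List.getLast?_eq_some_getLast _, ?_⟩, hv⟩⟩
    rw [show T.cellDist U (T.spot x) (T.spot x) = 0 from gdist_self (T.pos_mem_tri x), zero_add]
  obtain ⟨x, t, rfl, hvx⟩ := hhead h (hbe' h (by simp)) hh
  obtain ⟨x', t', rfl, hvx'⟩ := hhead h' (hbe' h' (by simp)) hh'
  refine hM.not_via_both hU ho hL (x := x) (x' := x') (p := t ++ l.flatten)
    (q := t' ++ l'.flatten) ?_ (hbe' g (by simp [hg])) (hbe' g' (by simp [hg']))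
    (fun y hy => List.mem_append_right _ (List.mem_flatten.2 ⟨g, hg, hy⟩))
    (fun y hy => List.mem_append_right _ (List.mem_flatten.2 ⟨g', hg', hy⟩)) hb hb' hvb
    hvb' hvx hvx'
  have := hLΓ.trans (flatten_rotate_isRotated Γ k)
  rw [hrot] at this
  simpa using this

/-- Gates that are not struck have a positive distance from the wavefront. -/
lemma IsStage.exists_margin (hM : T.IsStage U o d E S M) :
    ∃ δ, ENNReal.ofReal d < δ ∧ ∀ x y, T.Joined U x y → x.1 ∈ E → x ∉ S → ∀ p ∈ T.side x,
      δ ≤ T.dist U (T.spot o) (x.1, p) := by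
  classical
  have key : ∀ x : T.Corner, ∃ δ, ENNReal.ofReal d < δ ∧ ∀ y, T.Joined U x y → x.1 ∈ E → x ∉ S →
      ∀ p ∈ T.side x, δ ≤ T.dist U (T.spot o) (x.1, p) := by
    intro x
    by_cases hx : ∃ y, T.Joined U x y ∧ x.1 ∈ E ∧ x ∉ S
    · obtain ⟨y, h1, h2, h3⟩ := hx
      have hns := (hM.gate_of_notMem h1 h2 h3).2
      have hcomp : CompactSpace (T.side x) := isCompact_iff_compactSpace.1 (isCompact_segment _ _)
      have hcont : Continuous fun p : T.side x => T.dist U (T.spot o) (x.1, p.1) := by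
        refine continuous_of_le_add_edist 1 (by simp) fun p q => ?_
        rw [one_mul, edist_comm]
        exact (gdist_triangle _ (x.1, q.1) _).trans (add_le_add_right (gdist_le_edist
          (T.side_subset_tri x q.2) (T.side_subset_tri x p.2)) _)
      obtain ⟨p, -, hp⟩ := isCompact_univ.exists_isMinOn
        ⟨⟨T.pos x, left_mem_segment ℝ _ _⟩, mem_univ _⟩ hcont.continuousOn
      refine ⟨T.dist U (T.spot o) (x.1, p.1), ?_, fun y _ _ _ q hq => hp (mem_univ ⟨q, hq⟩)⟩
      by_contra! hle
      exact hns ⟨p.1, p.2, hle⟩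
    · exact ⟨⊤, by simp, fun y h1 h2 h3 => absurd ⟨y, h1, h2, h3⟩ hx⟩
  choose δ h1 h2 using key
  refine ⟨Finset.univ.inf δ, (Finset.lt_inf_iff (by simp)).2 fun x _ => h1 x,
    fun x y hxy hx hS p hp => (Finset.inf_le (Finset.mem_univ x)).trans (h2 x y hxy hx hS p hp)⟩

/-- Routes on which the distance from the source remains below that of all gates which are not
struck pass through struck gates only. -/
lemma Route.passed (hM : T.IsStage U o d E S M) {δ : ℝ≥0∞}
    (hδ : ∀ x y, T.Joined U x y → x.1 ∈ E → x ∉ S → ∀ p ∈ T.side x,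
      δ ≤ T.dist U (T.spot o) (x.1, p)) {a b : T.Spot} {ℓ : ℝ≥0∞}
    (h : T.Route (T.Joined U) a b ℓ) (ha : a.1 ∈ E) (hℓ : T.dist U (T.spot o) a + ℓ < δ) :
    T.Route (T.Passed U S) a b ℓ ∧ b.1 ∈ E := by
  induction h with
  | refl h => exact ⟨.refl h, ha⟩
  | move h hy ih =>
    obtain ⟨h1, h2⟩ := ih (lt_of_le_of_lt (add_le_add_right le_self_add _) hℓ)
    exact ⟨h1.move hy, h2⟩
  | @cross u v x ℓ h huv hx ih =>
    obtain ⟨h1, h2⟩ := ih hℓ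
    have hS : u ∈ S := by
      by_contra hS
      refine (hδ u v huv h2 hS x hx).not_gt (lt_of_le_of_lt ?_ hℓ)
      exact (gdist_triangle _ a _).trans (add_le_add_right (gdist_le_of_route h) _)
    have hp := hM.passed_of_mem huv hS
    exact ⟨h1.cross hp hx, hM.1.inv.mem_of_passed u v hp⟩

lemma dist_le_stageDist (a b : T.Spot) : T.dist U a b ≤ T.stageDist U S a b :=
  gdist_mono_on (K := univ) (fun _ _ hp _ => ⟨hp.1, mem_univ _⟩) (mem_univ _)

/-- Behind the wavefront, shortest paths do not cross the boundary cycles. -/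
lemma IsStage.via_of_dist_eq (hM : T.IsStage U o d E S M) {p q : T.Corner}
    (hp : T.Initiated U o d p) (hq : T.Initiated U o d q)
    (hpq : T.dist U (T.spot o) (T.spot q) =
      T.dist U (T.spot o) (T.spot p) + T.dist U (T.spot p) (T.spot q)) :
    T.Via U o S p (T.spot q) := by
  obtain ⟨δ, hδ, hmargin⟩ := hM.exists_margin
  have hinv := hM.1.inv
  have key : ∀ a b : T.Spot, a.1 ∈ E → T.dist U (T.spot o) a + T.dist U a b < δ →
      T.stageDist U S a b ≤ T.dist U a b := by
    intro a b ha hab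
    refine le_of_forall_gt fun c hc => ?_
    obtain ⟨ℓ, h1, h2⟩ := exists_route_lt (lt_min hc (lt_tsub_iff_left.2 hab))
    have h3 := h1.passed hM hmargin ha (lt_tsub_iff_left.1 (h2.trans_le (min_le_right _ _)))
    exact (gdist_le_of_route h3.1).trans_lt (h2.trans_le (min_le_left _ _))
  have h0 : T.dist U (T.spot o) (T.spot o) = 0 := gdist_self (T.pos_mem_tri o)
  have hop := key (T.spot o) (T.spot p) hinv.start_mem (by rw [h0, zero_add]; exact hp.trans_lt hδ)
  have hpE : p.1 ∈ E := mem_of_gdist_ne_top (fun x y hp _ => hinv.mem_of_passed x y hp)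
    (a := T.spot o) hinv.start_mem (hop.trans_lt (hp.trans_lt ENNReal.ofReal_lt_top)).ne
  refine le_antisymm (gdist_triangle _ _ _) (le_trans ?_ (dist_le_stageDist _ _))
  rw [hpq]
  exact add_le_add hop (key _ _ hpE (hpq ▸ hq.trans_lt hδ))

lemma Assoc.of_via {g : List T.Corner} {p q : T.Corner} (h : Assoc U o S g q)
    (hpq : T.Via U o S p (T.spot q)) : Assoc U o S g p := by
  obtain ⟨b, hb, hv⟩ := h
  refine ⟨b, hb, le_antisymm (gdist_triangle _ _ _) ?_⟩
  rw [hv, hpq, add_assoc]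
  exact add_le_add_right (gdist_triangle _ _ _) _

/-- A bounding edge is associated with a bunch if and only if it is associated with the first
segment of the bunch. -/
lemma IsStage.bunchAssoc_iff (hM : T.IsStage U o d E S M) {B : List T.Corner}
    (hB : T.IsBunch U o d B) :
    ∃ p, ∀ g, T.BunchAssoc (Assoc U o S) g B ↔ Assoc U o S g p := by
  rcases hB with rfl | ⟨hne, g₀, -, hinit, hchain⟩
  · exact ⟨o, fun g => by simp [BunchAssoc]⟩
  have key : ∀ g, ∀ v ∈ B, Assoc U o S g v → Assoc U o S g (B.head hne) := by
    intro g
    induction B with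
    | nil => exact absurd rfl hne
    | cons p B ih =>
      intro v hv hA
      rcases List.mem_cons.1 hv with rfl | hv
      · exact hA
      cases B with
      | nil => simp at hv
      | cons q B =>
        rw [List.isChain_cons_cons] at hchain
        have h1 := ih (by simp) (fun v hv => hinit v (List.mem_cons_of_mem _ hv)) hchain.2 v hv hA
        exact h1.of_via (hM.via_of_dist_eq (hinit p (by simp)).1 (hinit q (by simp)).1
          hchain.1.2)
  exact ⟨B.head hne, fun g => ⟨fun ⟨v, hv, h⟩ => key g v hv h, fun h => ⟨_, List.head_mem hne, h⟩⟩⟩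

end Associated

end Triangulation

end Wavefront

end

theorem mainTheorem7 (D : Wavefront.PolygonalDomain) (T : Wavefront.Triangulation D)
    (U : Set (Fin T.num)) (hU : ∀ t, D.s ∈ Set.range (T.corner t) → t ∈ U)
    (o : T.Corner) (ho : T.pos o = D.s) (d : ℝ) (hd : 0 ≤ d)
    (E : Set (Fin T.num)) (S : Set T.Corner) (M : Multiset (List T.Corner))
    (hM : T.IsStage U o d E S M) :
    ∃ A : List T.Corner → T.Corner → Prop, T.IsAssociation U o d S M A ∧
      ∀ Γ, T.IsBoundaryCycle U M Γ →
        (∀ v, T.Initiated U o d v → Wavefront.Triangulation.Contiguous Γ fun g => A g v) ∧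
        (∀ B, T.IsBunch U o d B →
          Wavefront.Triangulation.Contiguous Γ fun g => T.BunchAssoc A g B) ∧
        (∀ W, T.IsSection U o d A Γ W →
          Wavefront.Triangulation.Contiguous Γ fun g => ∃ B ∈ W, T.BunchAssoc A g B) := by
  refine ⟨Wavefront.Triangulation.Assoc U o S, fun Γ _ g _ v _ => ⟨id, fun _ h => h⟩,
    fun Γ hΓ => ?_⟩
  have hseg := hM.unseparated hU ho hΓ
  have hbunch : ∀ B, T.IsBunch U o d B → Wavefront.Triangulation.Unseparated Γ
      fun g => T.BunchAssoc (Wavefront.Triangulation.Assoc U o S) g B := by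
    intro B hB
    obtain ⟨p, hp⟩ := hM.bunchAssoc_iff hB
    simp only [hp]
    exact hseg p
  refine ⟨fun v _ => (hseg v).contiguous, fun B hB => (hbunch B hB).contiguous, ?_⟩
  rintro W ⟨hW, ⟨B, rfl⟩ | ⟨C, hC, hCW⟩⟩
  · simpa using (hbunch B (hW B (by simp))).contiguous
  · exact (Wavefront.Triangulation.Unseparated.union (I := fun B => B ∈ W)
      (fun B hB => hbunch B (hW B hB)) hC hCW).contiguous
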